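/- Let $L,T,h>0$ and let $\alpha\in\mathbb R$, $\beta>0$ satisfy $0<2\alpha^2+\tfrac32\beta<\tfrac12$. Put $X_0=[L^2(0,L)]^2$ and $H=X_0\times L^2(0,1)$ with norm $\|(u,v,z)\|_H^2=\|(u,v)\|_{X_0}^2+\beta h\|z\|_{L^2(0,1)}^2$, and let $\mathcal B=\mathcal B_T=C([0,T];X_0)\cap L^2(0,T;[H^1(0,L)]^2)$ with norm $\|(u,v)\|_{\mathcal B}=\sup_{t\in[0,T]}\|(u(t),v(t))\|_{X_0}+\|(u_x,v_x)\|_{L^2(0,T;X_0)}$. For $U_0=(u_0,v_0,z_0)\in H$ and $(f_1,f_2)\in L^1(0,T;X_0)$ consider the source problem $$\begin{cases}u_t-\tfrac12u_{xxx}=f_1,\qquad v_t+v_{xxx}=f_2, & 0<x<L,\ 0<t<T,\\ u(t,0)=u(t,L)=v(t,0)=v(t,L)=u_x(t,0)=0,\\ v_x(t,L)=\alpha u_x(t,L)+\beta u_x(t-h,L),\\ u(0,\cdot)=u_0,\quad v(0,\cdot)=v_0,\quad u_x(-h\rho,L)=z_0(\rho)\ \ (0<\rho<1).\end{cases}$$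 A pair $(u,v)\in C([0,T];X_0)$ is a solution if, for some $z\in C([0,T];L^2(0,1))$ (the delay variable $z(t,\rho)=u_x(t-h\rho,L)$), $U=(u,v,z)$ is the mild solution of $U'=AU+(f_1,f_2,0)$, $U(0)=U_0$, that is, for all $t\in[0,T]$, $\int_0^tU\,ds\in D(A)$ and $U(t)=U_0+A\int_0^tU\,ds+\int_0^t(f_1,f_2,0)\,ds$. Here $A(u,v,z)=(\tfrac12u_{xxx},-v_{xxx},-\tfrac1hz_\rho)$, and $D(A)$ is the set of $(u,v,z)$ with $u,v\in H^3(0,L)\cap H^1_0(0,L)$, $z\in H^1(0,1)$, $u_x(0)=0$, $z(0)=u_x(L)$, $v_x(L)=\alpha u_x(L)+\beta z(1)$. A solution on $[0,T]$ of the nonlinear Hirota–Satsuma system with delay is a pair $(u,v)\in\mathcal B$ that solves the source problem with $f_1=3uu_x+3vv_x$ and $f_2=-3uv_x$. Then there are constants $C,r>0$ and $\kappa\in[0,1)$, depending only on $L,T,h,\alpha,\beta$, such that for every $U_0\in H$ with $\|U_0\|_H\le r$: 1. For every $(\tilde u,\tilde v)\in\mathcal B$ the source problem with data $U_0$ and sources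 $f_1=3\tilde u\tilde u_x+3\tilde v\tilde v_x$, $f_2=-3\tilde u\tilde v_x$ has exactly one solution $\Gamma(\tilde u,\tilde v)\in C([0,T];X_0)$, and $\Gamma(\tilde u,\tilde v)\in\mathcal B$. 2. For every $R$ with $2C\|U_0\|_H\le R\le 2Cr$, $\Gamma$ maps the closed ball $B(0,R)=\{w\in\mathcal B:\|w\|_{\mathcal B}\le R\}$ into itself and $\|\Gamma w_1-\Gamma w_2\|_{\mathcal B}\le\kappa\|w_1-w_2\|_{\mathcal B}$ for all $w_1,w_2\in B(0,R)$. 3. For every such $R$, the nonlinear Hirota–Satsuma system with delay and data $U_0$ has exactly one solution $(u,v)$ on $[0,T]$ in $B(0,R)$. This solution is global: it extends to a continuous function on $[0,\infty)$ with values in $X_0$ whose restriction to $[0,T']$ belongs to $\mathcal B_{T'}$ and solves the system with data $U_0$ on $[0,T']$, for every $T'>0$. -/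

import Mathlib

open MeasureTheory

noncomputable section

namespace HirotaSatsuma

/-- The real Lebesgue space `L²(a,b)`. -/
abbrev L2 (a b : ℝ) : Type := Lp ℝ 2 (volume.restrict (Set.Ioo a b))

/-- `X₀ = [L²(0,L)]²` with its Hilbert norm. -/
abbrev X0 (L : ℝ) : Type := WithLp 2 (L2 0 L × L2 0 L)

/-- `H = X₀ × L²(0,1)`.  The type carries the usual (unweighted) Hilbert structure; the equivalent
weighted norm used to measure the data is `hNorm`. -/
abbrev H (L : ℝ) : Type := WithLp 2 (X0 L × L2 0 1)

/-- The norm of `H` coming from the inner product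
`⟨(u,v),(u',v')⟩_{X₀} + β h ⟨z,z'⟩_{L²(0,1)}`. -/
def hNorm (h β : ℝ) {L : ℝ} (U : H L) : ℝ :=
  Real.sqrt (‖U.fst‖ ^ 2 + β * h * ‖U.snd‖ ^ 2)

/-! ### One-dimensional Sobolev spaces -/

/-- `F` is (on `[a,b]`) the absolutely continuous representative of `f ∈ H¹(a,b)`, and
`g ∈ L²(a,b)` is the weak derivative of `f`. -/
def IsH1Rep (a b : ℝ) (F : ℝ → ℝ) (f g : L2 a b) : Prop :=
  (∀ᵐ x ∂(volume.restrict (Set.Ioo a b)), f x = F x) ∧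
    ∀ x ∈ Set.Icc a b, F x = F a + ∫ y in a..x, g y

/-- Membership in `H¹(a,b)`. -/
def MemH1 {a b : ℝ} (f : L2 a b) : Prop :=
  ∃ (F : ℝ → ℝ) (g : L2 a b), IsH1Rep a b F f g

open Classical in
/-- The weak derivative of `f ∈ H¹(a,b)` (it is unique); `0` if `f ∉ H¹(a,b)`. -/
def wderiv {a b : ℝ} (f : L2 a b) : L2 a b :=
  if hf : MemH1 f then hf.choose_spec.choose else 0

open Classical in
/-- The continuous representative of `f ∈ H¹(a,b)` (unique on `[a,b]`), through which boundary
values are taken; `0` if `f ∉ H¹(a,b)`. -/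
def contRep {a b : ℝ} (f : L2 a b) : ℝ → ℝ :=
  if hf : MemH1 f then hf.choose else 0

/-- Membership in `H³(a,b)`. -/
def MemH3 {a b : ℝ} (f : L2 a b) : Prop :=
  MemH1 f ∧ MemH1 (wderiv f) ∧ MemH1 (wderiv (wderiv f))

/-! ### The linear operator -/

/-- `(u, v, z)` belongs to `D(A)`: `u, v ∈ H³(0,L) ∩ H₀¹(0,L)`, `z ∈ H¹(0,1)`, `u_x(0) = 0`,
`z(0) = u_x(L)`, `v_x(L) = α u_x(L) + β z(1)`. -/
structure MemDom (L α β : ℝ) (u v : L2 0 L) (z : L2 0 1) : Prop where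
  u_H3 : MemH3 u
  v_H3 : MemH3 v
  z_H1 : MemH1 z
  u_left : contRep u 0 = 0
  u_right : contRep u L = 0
  v_left : contRep v 0 = 0
  v_right : contRep v L = 0
  ux_left : contRep (wderiv u) 0 = 0
  z_left : contRep z 0 = contRep (wderiv u) L
  vx_right : contRep (wderiv v) L = α * contRep (wderiv u) L + β * contRep z 1

/-- The domain `D(A) ⊆ H`. -/
def domA (L α β : ℝ) : Set (H L) := {U | MemDom L α β U.fst.fst U.fst.snd U.snd}

/-- `A (u, v, z) = (½ u_xxx, - v_xxx, - (1/h) z_ρ)`; meaningful on `domA`. -/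
def opA (L h : ℝ) (U : H L) : H L :=
  WithLp.toLp 2
    (WithLp.toLp 2 ((1 / 2 : ℝ) • wderiv (wderiv (wderiv U.fst.fst)),
        -wderiv (wderiv (wderiv U.fst.snd))),
      -((1 / h) • wderiv U.snd))

/-! ### Paths and solutions -/

open Classical in
/-- A path on `[0,T]` as a function on `ℝ` (`0` outside `[0,T]`). -/
def path {T : ℝ} {E : Type*} [TopologicalSpace E] [Zero E] (w : C(Set.Icc (0 : ℝ) T, E)) (s : ℝ) :
    E :=
  if hs : s ∈ Set.Icc (0 : ℝ) T then w ⟨s, hs⟩ else 0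

/-- `U = (u,v,z) ∈ C([0,T];H)` is the mild solution of `U' = A U + (f, 0)`, `U(0) = U₀`, with
`f = (f₁,f₂) ∈ L¹(0,T;X₀)`: for all `t ∈ [0,T]` one has `∫₀ᵗ U ds ∈ D(A)` and
`U(t) = U₀ + A ∫₀ᵗ U ds + ∫₀ᵗ (f, 0) ds`. -/
def IsMildSolution (L T h α β : ℝ) (U₀ : H L) (f : ℝ → X0 L) (U : C(Set.Icc (0 : ℝ) T, H L)) :
    Prop :=
  IntegrableOn f (Set.Ioc 0 T) ∧
    ∀ t : Set.Icc (0 : ℝ) T,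
      (∫ s in (0 : ℝ)..t, path U s) ∈ domA L α β ∧
        U t = U₀ + opA L h (∫ s in (0 : ℝ)..t, path U s)
          + WithLp.toLp 2 ((∫ s in (0 : ℝ)..t, f s), (0 : L2 0 1))

/-- `w = (u,v) ∈ C([0,T];X₀)` solves
`u_t - ½ u_xxx = f₁`, `v_t + v_xxx = f₂`,
`u(t,0) = u(t,L) = v(t,0) = v(t,L) = u_x(t,0) = 0`, `v_x(t,L) = α u_x(t,L) + β u_x(t-h,L)`
with initial data `U₀ = (u₀,v₀,z₀)`: together with the delay variable `z(t,ρ) = u_x(t-hρ,L)`, which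
satisfies `h z_t + z_ρ = 0`, `z(t,0) = u_x(t,L)`, `z(0,ρ) = z₀(ρ)`, it is the mild solution of the
Cauchy problem for `A`. -/
def IsSourceSolution (L T h α β : ℝ) (U₀ : H L) (f : ℝ → X0 L) (w : C(Set.Icc (0 : ℝ) T, X0 L)) :
    Prop :=
  ∃ U : C(Set.Icc (0 : ℝ) T, H L), IsMildSolution L T h α β U₀ f U ∧ ∀ t, (U t).fst = w t

open Classical in
/-- The class in `L²(a,b)` of a square integrable function (`0` otherwise). -/
def toL2 (a b : ℝ) (g : ℝ → ℝ) : L2 a b :=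
  if hg : MemLp g 2 (volume.restrict (Set.Ioo a b)) then hg.toLp g else 0

/-- The nonlinear terms `(3 u u_x + 3 v v_x, - 3 u v_x)`, which belong to `X₀` for
`(u,v) ∈ [H¹(0,L)]²`. -/
def nonlin {L : ℝ} (w : X0 L) : X0 L :=
  WithLp.toLp 2
    (toL2 0 L (fun x => 3 * w.fst x * wderiv w.fst x + 3 * w.snd x * wderiv w.snd x),
      toL2 0 L (fun x => -3 * w.fst x * wderiv w.snd x))

/-- `𝓑 = C([0,T];X₀) ∩ L²(0,T;[H¹(0,L)]²)`. -/
def spaceB (L T : ℝ) : Set C(Set.Icc (0 : ℝ) T, X0 L) :=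
  {w | (∀ᵐ t ∂(volume.restrict (Set.Ioo 0 T)), MemH1 (path w t).fst ∧ MemH1 (path w t).snd) ∧
    MemLp (fun t => wderiv (path w t).fst) 2 (volume.restrict (Set.Ioo 0 T)) ∧
    MemLp (fun t => wderiv (path w t).snd) 2 (volume.restrict (Set.Ioo 0 T))}

/-- `‖(u,v)‖_𝓑 = sup_{t ∈ [0,T]} ‖(u(t),v(t))‖_{X₀} + ‖(u_x,v_x)‖_{L²(0,T;X₀)}`. -/
def bNorm {L T : ℝ} (w : C(Set.Icc (0 : ℝ) T, X0 L)) : ℝ :=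
  ‖w‖ + Real.sqrt (∫ t in Set.Ioo 0 T, (‖wderiv (path w t).fst‖ ^ 2 + ‖wderiv (path w t).snd‖ ^ 2))

/-- The closed ball of radius `R` about `0` in `𝓑`. -/
def ballB (L T R : ℝ) : Set C(Set.Icc (0 : ℝ) T, X0 L) := {w | w ∈ spaceB L T ∧ bNorm w ≤ R}

/-- `w = (u,v)` in `𝓑` solves on `[0,T]` the nonlinear Hirota–Satsuma system with delay. -/
def IsHSSolution (L T h α β : ℝ) (U₀ : H L) (w : C(Set.Icc (0 : ℝ) T, X0 L)) : Prop :=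
  w ∈ spaceB L T ∧ IsSourceSolution L T h α β U₀ (fun t => nonlin (path w t)) w

end HirotaSatsuma

end

/-!
Well-posedness of the Hirota–Satsuma system with delayed boundary feedback.

*Linear theory.* In the weighted norm of `H` the operator `A` is dissipative: integrating by parts,
all boundary terms combine into a quadratic form in `u_x(L)`, `z(1)`, `v_x(0)` which is nonpositive
since `2α² + 3β/2 < 1/2`. Moreover `1 - A` is onto, because the boundary conditions are triangular:
`u` is found by shooting, then `z` by solving a transport equation, then `v` by shooting from the
right. So `A` has a firmly nonexpansive resolvent `R = (1 - A)⁻¹` (`exists_isHSResolvent`). The rest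
of the linear theory is written in terms of `R` alone, where the mild formulation reads
`∫₀ᵗ U = R (∫₀ᵗ U - U t + x + ∫₀ᵗ F)` (`IsMild`, `isMildSolution_iff`). Replacing `A` by the bounded
operators `(R - 1) (R + 1/(n+1))⁻¹` gives existence for integrable sources (`exists_isMild`), and
regularising a mild solution by `R (R + 1/(n+1))⁻¹` gives the energy inequality (`IsMild.energy`),
hence uniqueness.

*Smoothing.* For the form with weights `M + (L - x)` on `u`, `M + x` on `v` and `M` on `z`, with `M`
large, the same integration by parts leaves the interior term `-¾ ‖(u_x, v_x)‖²` (`wForm_opA_le`).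
The regularised energy identity for this form shows that the derivatives of the regularisations are
Cauchy in `L²(0,T;X₀)` (`IsMild.exists_smoothing`); as the weak derivative has closed graph, the
solution lies in `𝓑` with a bound (`IsHSResolvent.smoothing`, `IsSourceSolution.bound`).

*Nonlinear theory.* Since `H¹(0,L) ⊆ L^∞`, the nonlinearity is a bounded quadratic map of
`(w, w_x)`, and by the Cauchy–Schwarz inequality in time it is Lipschitz from balls of `𝓑` to
`L¹(0,T;X₀)`, with a constant proportional to the radius (`integral_norm_nonlin_sub_le`). On a small
ball of the complete space `𝓑` the map `Γ` is thus a contraction. Finally the nonlinearity does no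
work, `⟪N(w), w⟫ = ∫ (u³)_x = 0` (`inner_nonlin_self`), so the norm of `H` does not grow: the state
at time `T` is again small, and local solutions can be concatenated indefinitely
(`IsHSFlow.exists_global`).
-/

open MeasureTheory Set Filter Topology
open scoped RealInnerProductSpace ENNReal

noncomputable section

namespace HirotaSatsuma

/-! ### Primitives of integrable vector-valued functions -/

section Calculus
variable {E F : Type*} [NormedAddCommGroup E] [NormedSpace ℝ E] [NormedAddCommGroup F]
  [NormedSpace ℝ F]

theorem continuousOn_of_eq_primitive {a c : ℝ} (hac : a ≤ c) {G U : ℝ → E}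
    (hG : IntervalIntegrable G volume a c) (hU : ∀ t ∈ Icc a c, U t = U a + ∫ s in a..t, G s) :
    ContinuousOn U (Icc a c) := by
  have h := intervalIntegral.continuousOn_primitive_interval (μ := volume) (f := G) (a := a)
    (b := c) (by
      rw [uIcc_of_le hac]
      exact (intervalIntegrable_iff_integrableOn_Icc_of_le hac).1 hG)
  rw [uIcc_of_le hac] at h
  exact (continuousOn_const.add h).congr hU

theorem intervalIntegrable_sub {E : Type*} [NormedAddCommGroup E] {a c s t : ℝ} {G : ℝ → E}
    (hG : IntervalIntegrable G volume a c) (hac : a ≤ c) (hs : s ∈ Icc a c)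
    (ht : t ∈ Icc a c) : IntervalIntegrable G volume s t := by
  apply hG.mono_set
  rw [uIcc_of_le hac]
  exact uIcc_subset_Icc hs ht

theorem intervalIntegrable_clm_apply {E' : Type*} [NormedAddCommGroup E'] [NormedSpace ℝ E']
    (b : E →L[ℝ] F →L[ℝ] E') {a c : ℝ} (hac : a ≤ c) {G : ℝ → E} {V : ℝ → F}
    (hG : IntervalIntegrable G volume a c) (hV : ContinuousOn V (Icc a c)) :
    IntervalIntegrable (fun s => b (G s) (V s)) volume a c := by
  rw [intervalIntegrable_iff_integrableOn_Ioc_of_le hac] at hG ⊢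
  obtain ⟨C, hC⟩ := isCompact_Icc.exists_bound_of_continuousOn hV
  have hVm : AEStronglyMeasurable V (volume.restrict (Ioc a c)) :=
    (hV.mono Ioc_subset_Icc_self).aestronglyMeasurable measurableSet_Ioc
  refine Integrable.mono' (hG.norm.const_mul (‖b‖ * C)) ?_ ?_
  · exact (b.isBoundedBilinearMap.continuous).comp_aestronglyMeasurable
      (hG.aestronglyMeasurable.prodMk hVm)
  · refine (ae_restrict_iff' measurableSet_Ioc).2 (Eventually.of_forall fun s hs => ?_)
    calc ‖b (G s) (V s)‖ ≤ ‖b‖ * ‖G s‖ * ‖V s‖ := b.le_opNorm₂ _ _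
      _ ≤ ‖b‖ * ‖G s‖ * C := by gcongr; exact hC s (Ioc_subset_Icc_self hs)
      _ = _ := by ring

/-- Product rule, in integrated form, for a bounded bilinear form evaluated at two primitives of
integrable vector-valued functions. -/
theorem bilin_primitive [CompleteSpace E] [CompleteSpace F] (b : E →L[ℝ] F →L[ℝ] ℝ) {a c : ℝ}
    (hac : a ≤ c) {G U : ℝ → E} {K V : ℝ → F}
    (hG : IntervalIntegrable G volume a c) (hK : IntervalIntegrable K volume a c)
    (hU : ∀ t ∈ Icc a c, U t = U a + ∫ s in a..t, G s)
    (hV : ∀ t ∈ Icc a c, V t = V a + ∫ s in a..t, K s) :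
    b (U c) (V c) = b (U a) (V a) + ∫ s in a..c, (b (G s) (V s) + b (U s) (K s)) := by
  have hUc := continuousOn_of_eq_primitive hac hG hU
  have hVc := continuousOn_of_eq_primitive hac hK hV
  obtain ⟨CU, hCU⟩ := isCompact_Icc.exists_bound_of_continuousOn hUc
  obtain ⟨CV, hCV⟩ := isCompact_Icc.exists_bound_of_continuousOn hVc
  set φ : ℝ → ℝ := fun t => b (U t) (V t) with hφ
  have hac' : uIcc a c = Icc a c := uIcc_of_le hac
  have hN : IntervalIntegrable (fun s => ‖G s‖ + ‖K s‖) volume a c := hG.norm.add hK.norm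
  -- the increments of `φ` are dominated by those of the primitive of `‖G‖ + ‖K‖`, so that `φ` is
  -- absolutely continuous
  have hdist : ∀ s ∈ Icc a c, ∀ t ∈ Icc a c, dist (φ s) (φ t) ≤ ‖b‖ * (|CU| + |CV|) *
      dist (∫ r in a..s, (‖G r‖ + ‖K r‖)) (∫ r in a..t, (‖G r‖ + ‖K r‖)) := by
    have key : ∀ s ∈ Icc a c, ∀ t ∈ Icc a c, s ≤ t → dist (φ s) (φ t) ≤ ‖b‖ * (|CU| + |CV|) *
      dist (∫ r in a..s, (‖G r‖ + ‖K r‖)) (∫ r in a..t, (‖G r‖ + ‖K r‖)) := by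
      intro s hs t ht hst
      have ha : a ∈ Icc a c := ⟨le_rfl, hac⟩
      have e1 : U t - U s = ∫ r in s..t, G r := by
        rw [hU t ht, hU s hs, ← intervalIntegral.integral_add_adjacent_intervals
          (intervalIntegrable_sub hG hac ha hs) (intervalIntegrable_sub hG hac hs ht)]
        abel
      have e2 : V t - V s = ∫ r in s..t, K r := by
        rw [hV t ht, hV s hs, ← intervalIntegral.integral_add_adjacent_intervals
          (intervalIntegrable_sub hK hac ha hs) (intervalIntegrable_sub hK hac hs ht)]
        abel
      have e3 : (∫ r in a..t, (‖G r‖ + ‖K r‖)) - (∫ r in a..s, (‖G r‖ + ‖K r‖))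
          = (∫ r in s..t, ‖G r‖) + ∫ r in s..t, ‖K r‖ := by
        rw [intervalIntegral.integral_interval_sub_left (intervalIntegrable_sub hN hac ha ht)
          (intervalIntegrable_sub hN hac ha hs)]
        exact intervalIntegral.integral_add (intervalIntegrable_sub hG hac hs ht).norm
          (intervalIntegrable_sub hK hac hs ht).norm
      have hU0 : ‖U t - U s‖ ≤ ∫ r in s..t, ‖G r‖ := by
        rw [e1]; exact intervalIntegral.norm_integral_le_integral_norm hst
      have hV0 : ‖V t - V s‖ ≤ ∫ r in s..t, ‖K r‖ := by
        rw [e2]; exact intervalIntegral.norm_integral_le_integral_norm hst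
      have hU1 := (hCU s hs).trans (le_abs_self _)
      have p1 : 0 ≤ ∫ r in s..t, ‖G r‖ := (norm_nonneg _).trans hU0
      have p2 : 0 ≤ ∫ r in s..t, ‖K r‖ := (norm_nonneg _).trans hV0
      have hV1 := (hCV t ht).trans (le_abs_self _)
      rw [dist_comm, dist_comm (∫ r in a..s, (‖G r‖ + ‖K r‖)), Real.dist_eq, Real.dist_eq, e3]
      have e4 : φ t - φ s = b (U t - U s) (V t) + b (U s) (V t - V s) := by
        simp [hφ]
      rw [e4]
      have h1 : |b (U t - U s) (V t)| ≤ ‖b‖ * (∫ r in s..t, ‖G r‖) * |CV| :=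
        (b.le_opNorm₂ _ _).trans (by gcongr)
      have h2 : |b (U s) (V t - V s)| ≤ ‖b‖ * |CU| * (∫ r in s..t, ‖K r‖) :=
        (b.le_opNorm₂ _ _).trans (by gcongr)
      rw [abs_of_nonneg (add_nonneg p1 p2)]
      refine (abs_add_le _ _).trans ((add_le_add h1 h2).trans ?_)
      have q1 : 0 ≤ ‖b‖ * |CU| * (∫ r in s..t, ‖G r‖) := by positivity
      have q2 : 0 ≤ ‖b‖ * |CV| * (∫ r in s..t, ‖K r‖) := by positivity
      nlinarith
    intro s hs t ht
    rcases le_total s t with h | h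
    · exact key s hs t ht h
    · rw [dist_comm, dist_comm (∫ r in a..s, (‖G r‖ + ‖K r‖))]; exact key t ht s hs h
  have hACN := hN.absolutelyContinuousOnInterval_intervalIntegral (c := a) (by simp)
  have hAC : AbsolutelyContinuousOnInterval φ a c := by
    have h0 := Tendsto.const_mul (‖b‖ * (|CU| + |CV|)) hACN
    rw [mul_zero] at h0
    refine squeeze_zero' (Eventually.of_forall fun _ => Finset.sum_nonneg fun _ _ => dist_nonneg)
      ?_ h0
    refine eventually_inf_principal.2 (Eventually.of_forall fun I hI => ?_)
    rw [Finset.mul_sum]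
    refine Finset.sum_le_sum fun i hi => ?_
    have := hI.1 i hi
    rw [hac'] at this
    exact hdist _ this.1 _ this.2
  have := hAC.integral_deriv_eq_sub
  have hend : φ c = φ a + ∫ s in a..c, deriv φ s := by rw [this]; ring
  change φ c = φ a + _
  rw [hend]
  congr 1
  apply intervalIntegral.integral_congr_ae
  have hne : ∀ᵐ x : ℝ, x ≠ c := by simp [ae_iff, measure_singleton]
  filter_upwards [hG.ae_hasDerivAt_integral, hK.ae_hasDerivAt_integral, hne] with x h1 h2 h3 hx
  rw [uIoc_of_le hac] at hx
  have hx' : x ∈ uIcc a c := by rw [hac']; exact Ioc_subset_Icc_self hx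
  have hnhds : Icc a c ∈ 𝓝 x := Icc_mem_nhds hx.1 (lt_of_le_of_ne hx.2 h3)
  have d1 : HasDerivAt U (G x) x := by
    refine ((h1 hx' a (by simp)).const_add (U a)).congr_of_eventuallyEq ?_
    filter_upwards [hnhds] with y hy using hU y hy
  have d2 : HasDerivAt V (K x) x := by
    refine ((h2 hx' a (by simp)).const_add (V a)).congr_of_eventuallyEq ?_
    filter_upwards [hnhds] with y hy using hV y hy
  have d3 := (b.hasFDerivAt_of_bilinear d1.hasFDerivAt d2.hasFDerivAt).hasDerivAt
  rw [d3.deriv]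
  simp [add_comm]

theorem ae_eq_zero_of_primitive_eq_zero [CompleteSpace E] {a c : ℝ} (hac : a ≤ c) {G : ℝ → E}
    (hG : IntervalIntegrable G volume a c) (h : ∀ t ∈ Icc a c, ∫ s in a..t, G s = 0) :
    ∀ᵐ x ∂(volume.restrict (Ioo a c)), G x = 0 := by
  rw [ae_restrict_iff' measurableSet_Ioo]
  filter_upwards [hG.ae_hasDerivAt_integral] with x h1 hx
  have hx' : x ∈ uIcc a c := by rw [uIcc_of_le hac]; exact Ioo_subset_Icc_self hx
  have d1 := h1 hx' a (by simp)
  have d2 : HasDerivAt (fun x => ∫ t in a..x, G t) 0 x := by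
    refine (hasDerivAt_const x (0 : E)).congr_of_eventuallyEq ?_
    filter_upwards [Icc_mem_nhds hx.1 hx.2] with y hy using h y hy
  exact d1.unique d2

/-- Variation of constants for a bounded generator. -/
theorem exists_bounded_ode [CompleteSpace E] (B : E →L[ℝ] E) (t₀ : ℝ) (x : E) {G : ℝ → E}
    (hG : Integrable G) :
    ∃ U : ℝ → E, Continuous U ∧ ∀ t, U t = x + B (∫ s in t₀..t, U s) + ∫ s in t₀..t, G s := by
  set Φ : ℝ → E := fun t => ∫ s in t₀..t, G s with hΦ
  have hΦc : Continuous Φ :=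
    intervalIntegral.continuous_primitive (fun a b => hG.intervalIntegrable) t₀
  -- `W = U - Φ` solves an equation with continuous forcing
  set e : ℝ → (E →L[ℝ] E) := fun t => NormedSpace.exp (t • B) with he
  have hed : ∀ t, HasDerivAt e (B * e t) t := fun t => hasDerivAt_exp_smul_const' (𝕂 := ℝ) B t
  have hec : Continuous e := continuous_iff_continuousAt.2 fun t => (hed t).continuousAt
  have hinv : ∀ t, e t * e (-t) = 1 := by
    intro t
    have hc : Commute (t • B) ((-t) • B) := ((Commute.refl B).smul_left t).smul_right (-t)
    let _ : NormedAlgebra ℚ (E →L[ℝ] E) := NormedAlgebra.restrictScalars ℚ ℝ _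
    have := NormedSpace.exp_add_of_commute hc
    rw [he]; simp only
    rw [← this, ← add_smul]; simp
  set I : ℝ → E := fun t => ∫ s in t₀..t, e (-s) (B (Φ s)) with hI
  have hIc : Continuous (fun s => e (-s) (B (Φ s))) :=
    (hec.comp continuous_neg).clm_apply (B.continuous.comp hΦc)
  have hId : ∀ t, HasDerivAt I (e (-t) (B (Φ t))) t := fun t =>
    intervalIntegral.integral_hasDerivAt_right (hIc.intervalIntegrable _ _)
      hIc.stronglyMeasurable.stronglyMeasurableAtFilter hIc.continuousAt
  set W : ℝ → E := fun t => e t (e (-t₀) x + I t) with hW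
  have hWd : ∀ t, HasDerivAt W (B (W t + Φ t)) t := by
    intro t
    have h1 := (hed t).clm_apply ((hId t).const_add (e (-t₀) x))
    have h2 : e t (e (-t) (B (Φ t))) = B (Φ t) := by
      rw [← mul_apply_eq_comp, hinv]; rfl
    convert h1 using 1
    rw [h2, map_add]; rfl
  have hWc : Continuous W := continuous_iff_continuousAt.2 fun t => (hWd t).continuousAt
  refine ⟨fun t => W t + Φ t, hWc.add hΦc, fun t => ?_⟩
  have hcont : Continuous fun s => W s + Φ s := hWc.add hΦc
  have h1 := intervalIntegral.integral_eq_sub_of_hasDerivAt (a := t₀) (b := t) (fun s _ => hWd s)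
    ((B.continuous.comp hcont).intervalIntegrable _ _)
  have h0 : W t₀ = x := by
    simp only [hW, hI, intervalIntegral.integral_same, add_zero]
    rw [← mul_apply_eq_comp, hinv]; rfl
  rw [ContinuousLinearMap.intervalIntegral_comp_comm B (hcont.intervalIntegrable _ _), h0] at h1
  rw [h1]
  simp only [hΦ]
  abel

end Calculus

/-! ### Resolvents of maximal dissipative operators -/

section Resolvent
variable {E : Type*} [NormedAddCommGroup E] [InnerProductSpace ℝ E]

variable (E) in
/-- The real inner product as an `ℝ`-bilinear bounded form. -/
def innerForm : E →L[ℝ] E →L[ℝ] ℝ := innerSL ℝ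

theorem innerForm_apply (y z : E) : innerForm E y z = ⟪y, z⟫ := rfl

/-- `R` is the resolvent `(1 - A)⁻¹` of a maximal dissipative operator `A` on a Hilbert space:
it is injective and firmly nonexpansive, the latter being the inequality `⟪A X, X⟫ ≤ 0` for
`X = R y`, as `A X = R y - y`. -/
structure IsDissipativeResolvent (R : E →L[ℝ] E) : Prop where
  firm : ∀ y, ‖R y‖ ^ 2 ≤ ⟪R y, y⟫
  inj : Function.Injective R

/-- The inverse of `R + (n+1)⁻¹`.  As `A = 1 - R⁻¹`, the operators `R * regInv R n` form an
approximation of the identity with values in the domain of `A`, and `(R - 1) * regInv R n` is a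
bounded approximation of `A`. -/
def regInv (R : E →L[ℝ] E) (n : ℕ) : E →L[ℝ] E :=
  Ring.inverse (R + (1 / ((n : ℝ) + 1)) • (1 : E →L[ℝ] E))

namespace IsDissipativeResolvent
variable {R : E →L[ℝ] E} (hR : IsDissipativeResolvent R)
include hR

theorem norm_le (y : E) : ‖R y‖ ≤ ‖y‖ := by
  have h1 := hR.firm y
  have h2 := real_inner_le_norm (R y) y
  by_contra! h
  nlinarith [norm_nonneg y, norm_nonneg (R y)]

theorem inner_nonneg (y : E) : 0 ≤ ⟪R y, y⟫ := (sq_nonneg _).trans (hR.firm y)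

variable [CompleteSpace E]

theorem isUnit (n : ℕ) : IsUnit (R + (1 / ((n : ℝ) + 1)) • (1 : E →L[ℝ] E)) := by
  have hn : (0 : ℝ) < 1 / ((n : ℝ) + 1) := by positivity
  refine ContinuousLinearMap.isUnit_of_forall_le_norm_inner_map _ (c := ⟨_, hn.le⟩) hn fun x => ?_
  have h := hR.inner_nonneg x
  refine le_trans ?_ (le_abs_self _)
  simp only [add_apply, smul_apply, one_apply_eq_self, inner_add_left, inner_smul_left,
    real_inner_self_eq_norm_sq, conj_trivial]
  change ‖x‖ ^ 2 * (1 / ((n : ℝ) + 1)) ≤ _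
  linarith

theorem apply_regInv (n : ℕ) (y : E) :
    R (regInv R n y) = y - (1 / ((n : ℝ) + 1)) • regInv R n y := by
  have h := Ring.mul_inverse_cancel _ (hR.isUnit n)
  have := congrArg (fun f : E →L[ℝ] E => f y) h
  exact eq_sub_of_add_eq this

theorem regInv_apply (n : ℕ) (y : E) :
    regInv R n (R y) = y - (1 / ((n : ℝ) + 1)) • regInv R n y := by
  have h := Ring.inverse_mul_cancel _ (hR.isUnit n)
  have := congrArg (fun f : E →L[ℝ] E => f y) h
  refine eq_sub_of_add_eq ?_
  rw [← map_smul, ← map_add]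
  exact this

theorem comm (n : ℕ) (y : E) : R (regInv R n y) = regInv R n (R y) := by
  rw [hR.apply_regInv, hR.regInv_apply]

theorem norm_approx_le (n : ℕ) (y : E) : ‖R (regInv R n y)‖ ≤ ‖y‖ := by
  set x := regInv R n y with hx
  have h := hR.apply_regInv n y
  rw [← hx] at h
  have hn : (0 : ℝ) < 1 / ((n : ℝ) + 1) := by positivity
  have hy : y = R x + (1 / ((n : ℝ) + 1)) • x := by rw [h]; abel
  have h2 : ‖y‖ ^ 2 = ‖R x‖ ^ 2 + 2 * ((1 / ((n : ℝ) + 1)) * ⟪R x, x⟫)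
      + ‖(1 / ((n : ℝ) + 1)) • x‖ ^ 2 := by
    rw [hy, norm_add_sq_real, inner_smul_right]
  have h3 := hR.inner_nonneg x
  have h4 : ‖R x‖ ^ 2 ≤ ‖y‖ ^ 2 := by
    rw [h2]; have := mul_nonneg hn.le h3; nlinarith [sq_nonneg ‖(1 / ((n : ℝ) + 1)) • x‖]
  exact (pow_le_pow_iff_left₀ (norm_nonneg _) (norm_nonneg _) two_ne_zero).1 h4

/-- A vector `y` orthogonal to the range satisfies `‖R y‖² ≤ ⟪R y, y⟫ = 0`. -/
theorem range_dense : DenseRange R := by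
  have : (LinearMap.range (R : E →ₗ[ℝ] E)).topologicalClosure = ⊤ := by
    rw [Submodule.topologicalClosure_eq_top_iff, Submodule.eq_bot_iff]
    intro y hy
    have h1 : ⟪R y, y⟫ = 0 := hy (R y) ⟨y, rfl⟩
    have h2 := hR.firm y
    rw [h1] at h2
    have h3 : R y = 0 := by
      have : ‖R y‖ = 0 := by nlinarith [norm_nonneg (R y)]
      exact norm_eq_zero.1 this
    exact hR.inj (by rw [h3, map_zero])
  intro y
  have hy : y ∈ (LinearMap.range (R : E →ₗ[ℝ] E)).topologicalClosure := by rw [this]; trivial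
  exact hy

/-- The regularisations `R (R + (n+1)⁻¹)⁻¹` tend strongly to the identity: they do so on the dense
range of `R`, and they are contractions. -/
theorem tendsto_approx (y : E) :
    Tendsto (fun n => R (regInv R n y)) atTop (𝓝 y) := by
  rw [Metric.tendsto_atTop]
  intro ε hε
  obtain ⟨z, hz⟩ := Metric.denseRange_iff.1 hR.range_dense y (ε / 4) (by positivity)
  have h0 : Tendsto (fun n : ℕ => 1 / ((n : ℝ) + 1) * ‖z‖) atTop (𝓝 0) := by
    simpa using tendsto_one_div_add_atTop_nhds_zero_nat.mul_const ‖z‖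
  obtain ⟨N, hN⟩ := (Metric.tendsto_atTop.1 h0) (ε / 4) (by positivity)
  refine ⟨N, fun n hn => ?_⟩
  have h1 := hN n hn
  have hn0 : (0 : ℝ) < 1 / ((n : ℝ) + 1) := by positivity
  rw [Real.dist_eq, sub_zero, abs_of_nonneg (by positivity)] at h1
  rw [dist_eq_norm] at hz ⊢
  have e : R (regInv R n y) - y = R (regInv R n (y - R z)) - (y - R z)
      - (1 / ((n : ℝ) + 1)) • R (regInv R n z) := by
    have := hR.apply_regInv n (R z)
    rw [← hR.comm] at this
    rw [map_sub, map_sub, ← hR.comm n z]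
    rw [this]
    abel
  rw [e]
  have n1 := hR.norm_approx_le n (y - R z)
  have n2 := hR.norm_approx_le n z
  have n3 := norm_sub_le (R (regInv R n (y - R z)) - (y - R z))
    ((1 / ((n : ℝ) + 1)) • R (regInv R n z))
  have n4 := norm_sub_le (R (regInv R n (y - R z))) (y - R z)
  rw [norm_smul, Real.norm_of_nonneg hn0.le] at n3
  have n5 := mul_le_mul_of_nonneg_left n2 hn0.le
  linarith

/-- The bounded approximations of `A` are dissipative. -/
theorem inner_bounded_le (n : ℕ) (x : E) :
    ⟪R (regInv R n x) - regInv R n x, x⟫ ≤ 0 := by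
  set y := regInv R n x with hy
  have h := hR.apply_regInv n x
  rw [← hy] at h
  have hx : x = R y + (1 / ((n : ℝ) + 1)) • y := by rw [h]; abel
  have hn0 : (0 : ℝ) < 1 / ((n : ℝ) + 1) := by positivity
  have h1 := hR.firm y
  have h2 : ⟪R y, y⟫ ≤ ‖y‖ ^ 2 := (real_inner_le_norm _ _).trans (by
    rw [sq]; exact mul_le_mul_of_nonneg_right (hR.norm_le y) (norm_nonneg _))
  have h3 : ⟪R y - y, x⟫ = ‖R y‖ ^ 2 - ⟪R y, y⟫ + (1 / ((n : ℝ) + 1)) * (⟪R y, y⟫ - ‖y‖ ^ 2) := by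
    rw [hx, inner_add_right, inner_smul_right, inner_sub_left, inner_sub_left,
      real_inner_self_eq_norm_sq, real_inner_self_eq_norm_sq, real_inner_comm (R y) y]
  rw [h3]
  nlinarith

end IsDissipativeResolvent

/-! ### Mild solutions -/

/-- Integrated form of `U' = A U + F`, `U 0 = x` on `[0,T]`, expressed through the resolvent
`R = (1 - A)⁻¹`: the relation `V = R (V - Y)` says that `V` is in the domain and `A V = Y`. -/
def IsMild (R : E →L[ℝ] E) (T : ℝ) (x : E) (F U : ℝ → E) : Prop :=
  ∀ t ∈ Icc 0 T, ∫ s in (0 : ℝ)..t, U s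
    = R ((∫ s in (0 : ℝ)..t, U s) - U t + x + ∫ s in (0 : ℝ)..t, F s)

variable [CompleteSpace E]

/-- A mild solution regularised by `R Q`, with `Q` commuting with `R`, is absolutely continuous
with derivative `A R Q U + R Q F`. -/
theorem IsMild.regularize {R Q : E →L[ℝ] E} (hRQ : ∀ y, R (Q y) = Q (R y)) {T : ℝ} {x : E}
    {F U : ℝ → E} (hU : Continuous U) (hF : IntervalIntegrable F volume 0 T)
    (h : IsMild R T x F U) {t : ℝ} (ht : t ∈ Icc 0 T) :
    R (Q (U t)) = R (Q x) + ∫ s in (0 : ℝ)..t, (R (Q (U s)) - Q (U s) + R (Q (F s))) := by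
  have hFt : IntervalIntegrable F volume 0 t :=
    intervalIntegrable_sub hF (ht.1.trans ht.2) ⟨le_rfl, ht.1.trans ht.2⟩ ht
  have hUi : IntervalIntegrable U volume 0 t := hU.intervalIntegrable _ _
  have c1 : Continuous fun s => R (Q (U s)) := by fun_prop
  have c2 : Continuous fun s => Q (U s) := by fun_prop
  have i3 : IntervalIntegrable (fun s => R (Q (F s))) volume 0 t := by
    have := ((R.comp Q).integrable_comp hFt.1)
    have h2 := ((R.comp Q).integrable_comp hFt.2)
    exact ⟨this, h2⟩
  have c3 : Continuous fun s => R (Q (U s)) - Q (U s) := c1.sub c2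
  rw [intervalIntegral.integral_add (c3.intervalIntegrable _ _) i3,
    intervalIntegral.integral_sub (c1.intervalIntegrable _ _) (c2.intervalIntegrable _ _)]
  have e1 : ∫ s in (0:ℝ)..t, R (Q (U s)) = R (Q (∫ s in (0:ℝ)..t, U s)) :=
    (R.comp Q).intervalIntegral_comp_comm hUi
  have e2 : ∫ s in (0:ℝ)..t, Q (U s) = Q (∫ s in (0:ℝ)..t, U s) :=
    Q.intervalIntegral_comp_comm hUi
  have e3 : ∫ s in (0:ℝ)..t, R (Q (F s)) = R (Q (∫ s in (0:ℝ)..t, F s)) :=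
    (R.comp Q).intervalIntegral_comp_comm hFt
  rw [e1, e2, e3]
  have h1 := congrArg Q (h t ht)
  rw [← hRQ] at h1
  simp only [map_add, map_sub] at h1
  nth_rewrite 2 [h1]
  abel

/-- Energy inequality for regularised mild solutions, for a symmetric form `b` along which `A`
is dissipative with dissipation at least `c ‖S ·‖²`. -/
theorem IsMild.energy_regularized {K : Type*} [NormedAddCommGroup K] [NormedSpace ℝ K]
    {R Q : E →L[ℝ] E} (hRQ : ∀ y, R (Q y) = Q (R y)) {T : ℝ} {x : E}
    {F U : ℝ → E} (hU : Continuous U) (hF : IntervalIntegrable F volume 0 T)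
    (h : IsMild R T x F U) (b : E →L[ℝ] E →L[ℝ] ℝ) (hsymm : ∀ y z, b y z = b z y)
    (S : E →L[ℝ] K) {c : ℝ} (hb : ∀ y, b (R y - y) (R y) ≤ -(c * ‖S y‖ ^ 2))
    {t : ℝ} (ht : t ∈ Icc 0 T) :
    b (R (Q (U t))) (R (Q (U t))) + 2 * ∫ s in (0 : ℝ)..t, c * ‖S (Q (U s))‖ ^ 2
      ≤ b (R (Q x)) (R (Q x)) + 2 * ∫ s in (0 : ℝ)..t, b (R (Q (F s))) (R (Q (U s))) := by
  have hFt : IntervalIntegrable F volume 0 t :=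
    intervalIntegrable_sub hF (ht.1.trans ht.2) ⟨le_rfl, ht.1.trans ht.2⟩ ht
  have c1 : Continuous fun s => R (Q (U s)) := by fun_prop
  have c2 : Continuous fun s => Q (U s) := by fun_prop
  have i3 : IntervalIntegrable (fun s => R (Q (F s))) volume 0 t :=
    ⟨(R.comp Q).integrable_comp hFt.1, (R.comp Q).integrable_comp hFt.2⟩
  have c3 : Continuous fun s => R (Q (U s)) - Q (U s) := c1.sub c2
  have iG := (c3.intervalIntegrable (μ := volume) 0 t).add i3
  have hW0 : R (Q (U 0)) = R (Q x) := by
    simpa using h.regularize hRQ hU hF ⟨le_rfl, ht.1.trans ht.2⟩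
  have hprim : ∀ r ∈ Icc 0 t, R (Q (U r)) = R (Q (U 0)) +
      ∫ s in (0 : ℝ)..r, (R (Q (U s)) - Q (U s) + R (Q (F s))) := fun r hr => by
    rw [hW0]; exact h.regularize hRQ hU hF ⟨hr.1, hr.2.trans ht.2⟩
  have key := bilin_primitive b ht.1 iG iG (U := fun t => R (Q (U t)))
    (V := fun t => R (Q (U t))) hprim hprim
  have j1 : IntervalIntegrable (fun s => b (R (Q (F s))) (R (Q (U s)))) volume 0 t :=
    intervalIntegrable_clm_apply b ht.1 i3 c1.continuousOn
  have j2 : Continuous fun s => b (R (Q (U s)) - Q (U s)) (R (Q (U s))) :=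
    (b.continuous.comp (c1.sub c2)).clm_apply c1
  have j3 : Continuous fun s => c * ‖S (Q (U s))‖ ^ 2 := by fun_prop
  rw [key, hW0]
  have e1 : ∫ s in (0:ℝ)..t, (b (R (Q (U s)) - Q (U s) + R (Q (F s))) (R (Q (U s)))
      + b (R (Q (U s))) (R (Q (U s)) - Q (U s) + R (Q (F s))))
      = 2 * (∫ s in (0:ℝ)..t, b (R (Q (U s)) - Q (U s)) (R (Q (U s))))
        + 2 * ∫ s in (0:ℝ)..t, b (R (Q (F s))) (R (Q (U s))) := by
    rw [← mul_add, ← intervalIntegral.integral_add (j2.intervalIntegrable _ _) j1,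
      ← intervalIntegral.integral_const_mul]
    congr 1
    ext s
    rw [hsymm (R (Q (U s))) (R (Q (U s)) - Q (U s) + R (Q (F s)))]
    rw [map_add b, add_apply]
    ring
  have e2 : ∫ s in (0:ℝ)..t, b (R (Q (U s)) - Q (U s)) (R (Q (U s)))
      ≤ ∫ s in (0:ℝ)..t, -(c * ‖S (Q (U s))‖ ^ 2) :=
    intervalIntegral.integral_mono_on ht.1 (j2.intervalIntegrable _ _)
      (j3.neg.intervalIntegrable _ _) fun s _ => hb _
  rw [intervalIntegral.integral_neg] at e2
  rw [e1]
  linarith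

/-- Passage from the quadratic energy inequality to a bound on the supremum. -/
theorem norm_le_of_energy {E : Type*} [NormedAddCommGroup E] [InnerProductSpace ℝ E] {T : ℝ}
    {x : E} {F U : ℝ → E}
    (hU : ContinuousOn U (Icc 0 T)) (hF : IntervalIntegrable F volume 0 T)
    (h : ∀ t ∈ Icc 0 T, ‖U t‖ ^ 2 ≤ ‖x‖ ^ 2 + 2 * ∫ s in (0 : ℝ)..t, ⟪F s, U s⟫)
    {t : ℝ} (ht : t ∈ Icc 0 T) : ‖U t‖ ≤ ‖x‖ + 2 * ∫ s in (0 : ℝ)..T, ‖F s‖ := by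
  have hT : 0 ≤ T := ht.1.trans ht.2
  obtain ⟨m, hm, hmax⟩ := isCompact_Icc.exists_isMaxOn ⟨t, ht⟩ hU.norm
  have hmt : ‖U t‖ ≤ ‖U m‖ := hmax ht
  have hFm : IntervalIntegrable F volume 0 m := intervalIntegrable_sub hF hT ⟨le_rfl, hT⟩ hm
  have hUm : ContinuousOn U (Icc 0 m) := hU.mono (Icc_subset_Icc_right hm.2)
  have h1 : ∫ s in (0 : ℝ)..m, ⟪F s, U s⟫ ≤ ∫ s in (0 : ℝ)..m, ‖F s‖ * ‖U m‖ := by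
    refine intervalIntegral.integral_mono_on hm.1
      (intervalIntegrable_clm_apply (innerForm E) hm.1 hFm hUm) (hFm.norm.mul_const _)
      fun s hs => ?_
    exact (real_inner_le_norm _ _).trans (mul_le_mul_of_nonneg_left
      (hmax ⟨hs.1, hs.2.trans hm.2⟩) (norm_nonneg _))
  have h2 : ∫ s in (0 : ℝ)..m, ‖F s‖ ≤ ∫ s in (0 : ℝ)..T, ‖F s‖ :=
    intervalIntegral.integral_mono_interval le_rfl hm.1 hm.2
      (Eventually.of_forall fun _ => norm_nonneg _) hF.norm
  rw [intervalIntegral.integral_mul_const] at h1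
  have h3 := h m hm
  have h4 : 0 ≤ ∫ s in (0 : ℝ)..m, ‖F s‖ :=
    intervalIntegral.integral_nonneg hm.1 fun _ _ => norm_nonneg _
  have h5 : ‖U m‖ ^ 2 ≤ ‖x‖ ^ 2 + 2 * ((∫ s in (0 : ℝ)..T, ‖F s‖) * ‖U m‖) := by
    have := mul_le_mul_of_nonneg_right h2 (norm_nonneg (U m)); linarith
  have h6 : ‖U m‖ ≤ ‖x‖ + 2 * ∫ s in (0 : ℝ)..T, ‖F s‖ := by
    by_contra! hlt
    nlinarith [norm_nonneg x, norm_nonneg (U m)]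
  exact hmt.trans h6

theorem tendsto_integral_bilin_approx {R : E →L[ℝ] E} (hR : IsDissipativeResolvent R)
    {T : ℝ} (hT : 0 ≤ T) {F U : ℝ → E} (hU : Continuous U)
    (hF : IntervalIntegrable F volume 0 T) (b : E →L[ℝ] E →L[ℝ] ℝ) :
    Tendsto (fun n => ∫ s in (0 : ℝ)..T, b (R (regInv R n (F s))) (R (regInv R n (U s)))) atTop
      (𝓝 (∫ s in (0 : ℝ)..T, b (F s) (U s))) := by
  refine intervalIntegral.tendsto_integral_filter_of_dominated_convergence
    (fun s => ‖b‖ * ‖F s‖ * ‖U s‖) (Eventually.of_forall fun n => ?_)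
    (Eventually.of_forall fun n => Eventually.of_forall fun s _ => ?_) ?_
    (Eventually.of_forall fun s _ => ?_)
  · have i3 : IntervalIntegrable (fun s => R (regInv R n (F s))) volume 0 T :=
      ⟨(R.comp (regInv R n)).integrable_comp hF.1, (R.comp (regInv R n)).integrable_comp hF.2⟩
    have := intervalIntegrable_clm_apply (V := fun s => R (regInv R n (U s))) b hT i3
      (by fun_prop)
    exact (intervalIntegrable_iff.1 this).aestronglyMeasurable
  · refine (b.le_opNorm₂ _ _).trans ?_
    have := hR.norm_approx_le n (F s)
    have := hR.norm_approx_le n (U s)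
    gcongr
  · exact (hF.norm.const_mul _).mul_continuousOn hU.norm.continuousOn
  · exact (b.isBoundedBilinearMap.continuous.tendsto (F s, U s)).comp
      ((hR.tendsto_approx (F s)).prodMk_nhds (hR.tendsto_approx (U s)))

/-- Energy inequality for mild solutions, the limit of those for the regularised solutions. -/
theorem IsMild.energy {R : E →L[ℝ] E} (hR : IsDissipativeResolvent R) {T : ℝ} {x : E}
    {F U : ℝ → E} (hU : Continuous U) (hF : IntervalIntegrable F volume 0 T)
    (h : IsMild R T x F U) {t : ℝ} (ht : t ∈ Icc 0 T) :
    ‖U t‖ ^ 2 ≤ ‖x‖ ^ 2 + 2 * ∫ s in (0 : ℝ)..t, ⟪F s, U s⟫ := by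
  have hFt : IntervalIntegrable F volume 0 t :=
    intervalIntegrable_sub hF (ht.1.trans ht.2) ⟨le_rfl, ht.1.trans ht.2⟩ ht
  have l1 : Tendsto (fun n => ‖R (regInv R n (U t))‖ ^ 2) atTop (𝓝 (‖U t‖ ^ 2)) :=
    (hR.tendsto_approx _).norm.pow 2
  have l2 : Tendsto (fun n => ‖R (regInv R n x)‖ ^ 2) atTop (𝓝 (‖x‖ ^ 2)) :=
    (hR.tendsto_approx _).norm.pow 2
  have l3 := tendsto_integral_bilin_approx hR ht.1 hU hFt (innerForm E)
  refine le_of_tendsto_of_tendsto' l1 (l2.add (l3.const_mul 2)) fun n => ?_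
  have := h.energy_regularized (hR.comm n) hU hF (innerForm E)
    (fun y z => by rw [innerForm_apply, innerForm_apply, real_inner_comm]) (0 : E →L[ℝ] E) (c := 0)
    (fun y => by
      have := hR.firm y
      rw [innerForm_apply, inner_sub_left, real_inner_self_eq_norm_sq]
      rw [real_inner_comm] at this
      simpa using this) ht
  simpa only [innerForm_apply, real_inner_self_eq_norm_sq, zero_mul,
    intervalIntegral.integral_zero, mul_zero, add_zero] using this

theorem IsMild.norm_le {R : E →L[ℝ] E} (hR : IsDissipativeResolvent R) {T : ℝ} {x : E}
    {F U : ℝ → E} (hU : Continuous U) (hF : IntervalIntegrable F volume 0 T)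
    (h : IsMild R T x F U) {t : ℝ} (ht : t ∈ Icc 0 T) :
    ‖U t‖ ≤ ‖x‖ + 2 * ∫ s in (0 : ℝ)..T, ‖F s‖ :=
  norm_le_of_energy hU.continuousOn hF (fun _ hs => h.energy hR hU hF hs) ht

theorem IsMild.sub {E : Type*} [NormedAddCommGroup E] [InnerProductSpace ℝ E] {R : E →L[ℝ] E}
    {T : ℝ} {x x' : E} {F F' U U' : ℝ → E} (hU : Continuous U)
    (hU' : Continuous U') (hF : IntervalIntegrable F volume 0 T)
    (hF' : IntervalIntegrable F' volume 0 T) (h : IsMild R T x F U) (h' : IsMild R T x' F' U') :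
    IsMild R T (x - x') (fun s => F s - F' s) (fun s => U s - U' s) := by
  intro t ht
  have hT := ht.1.trans ht.2
  rw [intervalIntegral.integral_sub (hU.intervalIntegrable _ _) (hU'.intervalIntegrable _ _),
    intervalIntegral.integral_sub (intervalIntegrable_sub hF hT ⟨le_rfl, hT⟩ ht)
      (intervalIntegrable_sub hF' hT ⟨le_rfl, hT⟩ ht)]
  conv_lhs => rw [h t ht, h' t ht]
  rw [← map_sub]
  congr 1
  dsimp only
  abel

end Resolvent

/-! ### Existence of mild solutions -/

section Existence
variable {E : Type*} [NormedAddCommGroup E] [InnerProductSpace ℝ E] [CompleteSpace E]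

/-- A uniformly Cauchy sequence of approximate mild solutions converges to a mild solution. -/
theorem exists_isMild_of_approx {R : E →L[ℝ] E} {T : ℝ} (hT : 0 ≤ T) {x : ℕ → E} {x' : E}
    {F : ℕ → ℝ → E} {F' : ℝ → E} {U : ℕ → ℝ → E} (hU : ∀ n, Continuous (U n))
    (hUC : UniformCauchySeqOn U atTop (Icc 0 T)) (hx : Tendsto x atTop (𝓝 x'))
    (hF : ∀ t ∈ Icc 0 T, Tendsto (fun n => ∫ s in (0 : ℝ)..t, F n s) atTop
      (𝓝 (∫ s in (0 : ℝ)..t, F' s)))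
    (hm : ∀ t ∈ Icc 0 T, Tendsto (fun n => (∫ s in (0 : ℝ)..t, U n s)
      - R ((∫ s in (0 : ℝ)..t, U n s) - U n t + x n + ∫ s in (0 : ℝ)..t, F n s)) atTop (𝓝 0)) :
    ∃ U' : ℝ → E, Continuous U' ∧ IsMild R T x' F' U' := by
  have hlim : ∀ t ∈ Icc 0 T, ∃ y, Tendsto (fun n => U n t) atTop (𝓝 y) := fun t ht =>
    cauchySeq_tendsto_of_complete (hUC.cauchySeq ht)
  choose! V hV using hlim
  have hunif : TendstoUniformlyOn U V atTop (Icc 0 T) :=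
    hUC.tendstoUniformlyOn_of_tendsto hV
  have hVc : ContinuousOn V (Icc 0 T) :=
    hunif.continuousOn (Eventually.of_forall fun n => (hU n).continuousOn).frequently
  set U' : ℝ → E := IccExtend hT ((Icc 0 T).domRestrict V) with hU'
  have hU'c : Continuous U' := continuous_IccExtend_iff.2 hVc.domRestrict
  have heq : ∀ t ∈ Icc 0 T, U' t = V t := fun t ht => by
    rw [hU', IccExtend_of_mem _ _ ht]; rfl
  refine ⟨U', hU'c, fun t ht => ?_⟩
  have hI : Tendsto (fun n => ∫ s in (0 : ℝ)..t, U n s) atTop (𝓝 (∫ s in (0 : ℝ)..t, U' s)) := by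
    have h1 : TendstoUniformlyOn U U' atTop (uIcc 0 t) := by
      rw [uIcc_of_le ht.1]
      refine (hunif.congr_right fun s hs => (heq s hs).symm).mono (Icc_subset_Icc_right ht.2)
    exact h1.tendsto_intervalIntegral_of_continuousOn
      (Eventually.of_forall fun n => (hU n).continuousOn)
  have h2 : Tendsto (fun n => U n t) atTop (𝓝 (U' t)) := by rw [heq t ht]; exact hV t ht
  have h3 := hI.sub ((R.continuous.tendsto _).comp (((hI.sub h2).add hx).add (hF t ht)))
  exact sub_eq_zero.1 (tendsto_nhds_unique h3 (hm t ht))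

omit [CompleteSpace E] in
theorem tendsto_integral_norm_sub {P : ℕ → E →L[ℝ] E} (hP : ∀ n y, ‖P n y‖ ≤ ‖y‖)
    (hl : ∀ y, Tendsto (fun n => P n y) atTop (𝓝 y)) {a c : ℝ} {F : ℝ → E}
    (hF : IntervalIntegrable F volume a c) :
    Tendsto (fun n => ∫ s in a..c, ‖P n (F s) - F s‖) atTop (𝓝 0) := by
  have key : Tendsto (fun n => ∫ s in a..c, ‖P n (F s) - F s‖) atTop
      (𝓝 (∫ s in a..c, (0 : ℝ))) := by
    refine intervalIntegral.tendsto_integral_filter_of_dominated_convergence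
      (fun s => 2 * ‖F s‖) (Eventually.of_forall fun n => ?_)
      (Eventually.of_forall fun n => Eventually.of_forall fun s _ => ?_) ?_
      (Eventually.of_forall fun s _ => ?_)
    · have hm := (intervalIntegrable_iff.1 hF).aestronglyMeasurable
      exact (((P n).continuous.comp_aestronglyMeasurable hm).sub hm).norm
    · rw [norm_norm]
      have := norm_sub_le (P n (F s)) (F s)
      have := hP n (F s)
      linarith
    · exact hF.norm.const_mul 2
    · simpa using ((hl (F s)).sub_const (F s)).norm
  simpa using key

variable {R : E →L[ℝ] E}

/-- A bound, uniform in `n`, for the solutions of `U' = (R - 1) (R + (n+1)⁻¹)⁻¹ U + F`. -/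
theorem norm_le_of_bounded_ode (hR : IsDissipativeResolvent R) (n : ℕ) {T : ℝ} {x : E}
    {F U : ℝ → E} (hU : Continuous U) (hF : IntervalIntegrable F volume 0 T)
    (h : ∀ t ∈ Icc 0 T, U t = x + (R - 1) (regInv R n (∫ s in (0 : ℝ)..t, U s))
      + ∫ s in (0 : ℝ)..t, F s)
    {t : ℝ} (ht : t ∈ Icc 0 T) : ‖U t‖ ≤ ‖x‖ + 2 * ∫ s in (0 : ℝ)..T, ‖F s‖ := by
  refine norm_le_of_energy hU.continuousOn hF (fun r hr => ?_) ht
  have hT := ht.1.trans ht.2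
  have hFr : IntervalIntegrable F volume 0 r := intervalIntegrable_sub hF hT ⟨le_rfl, hT⟩ hr
  set A : E →L[ℝ] E := (R - 1).comp (regInv R n) with hA
  have cA : Continuous fun s => A (U s) := by fun_prop
  have hU0 : U 0 = x := by simpa using h 0 ⟨le_rfl, hT⟩
  have hprim : ∀ s ∈ Icc 0 r, U s = U 0 + ∫ s in (0 : ℝ)..s, (A (U s) + F s) := by
    intro s hs
    rw [intervalIntegral.integral_add (cA.intervalIntegrable _ _)
      (intervalIntegrable_sub hFr hr.1 ⟨le_rfl, hr.1⟩ hs),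
      A.intervalIntegral_comp_comm (hU.intervalIntegrable _ _), hU0,
      h s ⟨hs.1, hs.2.trans hr.2⟩, ← add_assoc]
    rfl
  have iG := (cA.intervalIntegrable (μ := volume) 0 r).add hFr
  have key := bilin_primitive (innerForm E) hr.1 iG iG hprim hprim
  simp only [innerForm_apply, real_inner_self_eq_norm_sq, hU0] at key
  rw [key, add_le_add_iff_left, ← intervalIntegral.integral_const_mul]
  have iFU : IntervalIntegrable (fun s => ⟪F s, U s⟫) volume 0 r :=
    intervalIntegrable_clm_apply (innerForm E) hr.1 hFr hU.continuousOn
  have iGU : IntervalIntegrable (fun s => ⟪A (U s) + F s, U s⟫) volume 0 r :=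
    intervalIntegrable_clm_apply (innerForm E) hr.1 iG hU.continuousOn
  have iGU' : IntervalIntegrable (fun s => ⟪U s, A (U s) + F s⟫) volume 0 r := by
    simpa only [real_inner_comm] using iGU
  refine intervalIntegral.integral_mono_on hr.1 (iGU.add iGU') (iFU.const_mul 2) fun s _ => ?_
  have h1 : ⟪A (U s), U s⟫ ≤ 0 := hR.inner_bounded_le n (U s)
  rw [real_inner_comm (A (U s) + F s) (U s), inner_add_left]
  linarith

/-- Existence for data in the range of `R ^ 2`: the solutions for the bounded approximations of
the generator are uniformly Cauchy. -/
theorem exists_isMild_of_sq (hR : IsDissipativeResolvent R) {T : ℝ} (hT : 0 ≤ T) (z : E)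
    {g : ℝ → E} (hg : Integrable g) :
    ∃ U : ℝ → E, Continuous U ∧ IsMild R T (R (R z)) (fun s => R (R (g s))) U := by
  have hex := fun n : ℕ => exists_bounded_ode ((R - 1).comp (regInv R n)) 0 z hg
  choose Z hZc hZ using hex
  set M : ℝ := ‖z‖ + 2 * ∫ s in (0 : ℝ)..T, ‖g s‖ with hM
  have hZb : ∀ n, ∀ t ∈ Icc 0 T, ‖Z n t‖ ≤ M := fun n t ht =>
    norm_le_of_bounded_ode hR n (hZc n) hg.intervalIntegrable (fun t _ => hZ n t) ht
  set e : ℕ → ℝ := fun n => 1 / ((n : ℝ) + 1) with he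
  have he0 : ∀ n, 0 < e n := fun n => by simp only [he]; positivity
  have hel : Tendsto e atTop (𝓝 0) := tendsto_one_div_add_atTop_nhds_zero_nat
  set RR : E →L[ℝ] E := R.comp R with hRR
  have hcA : ∀ n y, RR ((R - 1) (regInv R n y)) = (R - 1) (regInv R n (RR y)) := by
    intro n y
    simp only [hRR, ContinuousLinearMap.comp_apply, sub_apply, one_apply_eq_self, map_sub,
      hR.comm n]
  have hUeq : ∀ n t, RR (Z n t) = RR z + (R - 1) (regInv R n (∫ s in (0 : ℝ)..t, RR (Z n s)))
      + ∫ s in (0 : ℝ)..t, RR (g s) := by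
    intro n t
    rw [RR.intervalIntegral_comp_comm ((hZc n).intervalIntegrable _ _),
      RR.intervalIntegral_comp_comm hg.intervalIntegrable, ← hcA]
    conv_lhs => rw [hZ n t]
    rw [map_add, map_add]; rfl
  have hcU : ∀ n, Continuous fun t => RR (Z n t) := fun n => RR.continuous.comp (hZc n)
  have hIg : ∀ t, IntervalIntegrable (fun s => RR (g s)) volume 0 t := fun t =>
    (RR.integrable_comp hg).intervalIntegrable
  -- consistency of the approximations on the range of `R ^ 2`
  have hcons : ∀ n m y, ‖(R - 1) (regInv R n (RR y)) - (R - 1) (regInv R m (RR y))‖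
      ≤ 2 * (e n + e m) * ‖y‖ := by
    intro n m y
    have h1 : ∀ k, regInv R k (RR y) = R y - e k • R (regInv R k y) := fun k => by
      rw [hR.comm k y]; exact hR.regInv_apply k (R y)
    have h2 : (R - 1) (regInv R n (RR y)) - (R - 1) (regInv R m (RR y))
        = (R - 1) (e m • R (regInv R m y) - e n • R (regInv R n y)) := by
      rw [← map_sub, h1, h1]; congr 1; abel
    have h3 : ∀ w, ‖(R - 1) w‖ ≤ 2 * ‖w‖ := fun w => by
      have := norm_sub_le (R w) w
      have := hR.norm_le w
      change ‖R w - w‖ ≤ _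
      linarith
    rw [h2]
    refine (h3 _).trans ?_
    have h4 := norm_sub_le (e m • R (regInv R m y)) (e n • R (regInv R n y))
    rw [norm_smul, norm_smul, Real.norm_of_nonneg (he0 _).le, Real.norm_of_nonneg (he0 _).le] at h4
    have h5 := mul_le_mul_of_nonneg_left (hR.norm_approx_le m y) (he0 m).le
    have h6 := mul_le_mul_of_nonneg_left (hR.norm_approx_le n y) (he0 n).le
    nlinarith
  have hdiff : ∀ n m, ∀ t ∈ Icc 0 T, ‖RR (Z n t) - RR (Z m t)‖ ≤ 4 * T * M * (e n + e m) := by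
    intro n m t ht
    set G : ℝ → E := fun s => (R - 1) (regInv R n (RR (Z m s))) - (R - 1) (regInv R m (RR (Z m s)))
      with hG
    have hGc : Continuous G := by
      have := hcU m
      simp only [hG]; fun_prop
    have hD : ∀ t ∈ Icc 0 T, RR (Z n t) - RR (Z m t)
        = 0 + (R - 1) (regInv R n (∫ s in (0 : ℝ)..t, (RR (Z n s) - RR (Z m s))))
          + ∫ s in (0 : ℝ)..t, G s := by
      intro t _
      have i1 := (hcU n).intervalIntegrable (μ := volume) 0 t
      have i2 := (hcU m).intervalIntegrable (μ := volume) 0 t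
      have e1 : ∫ s in (0 : ℝ)..t, G s = (R - 1) (regInv R n (∫ s in (0 : ℝ)..t, RR (Z m s)))
          - (R - 1) (regInv R m (∫ s in (0 : ℝ)..t, RR (Z m s))) :=
        (((R - 1).comp (regInv R n)) - ((R - 1).comp (regInv R m))).intervalIntegral_comp_comm i2
      rw [intervalIntegral.integral_sub i1 i2, e1, hUeq n t, hUeq m t, map_sub, map_sub]
      abel
    have h1 := norm_le_of_bounded_ode hR n (U := fun t => RR (Z n t) - RR (Z m t))
      ((hcU n).sub (hcU m)) (hGc.intervalIntegrable 0 T)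
      hD ht
    have h2 : ∫ s in (0 : ℝ)..T, ‖G s‖ ≤ ∫ _s in (0 : ℝ)..T, 2 * (e n + e m) * M :=
      intervalIntegral.integral_mono_on hT (hGc.norm.intervalIntegrable _ _)
        (by simp) fun s hs => (hcons n m _).trans (by
          have := hZb m s hs; have := he0 n; have := he0 m; gcongr)
    rw [intervalIntegral.integral_const, smul_eq_mul, sub_zero] at h2
    rw [norm_zero, zero_add] at h1
    linarith
  refine exists_isMild_of_approx hT (x := fun _ => R (R z)) (F := fun _ s => R (R (g s)))
    hcU ?_ tendsto_const_nhds (fun _ _ => tendsto_const_nhds) fun t ht => ?_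
  · rw [Metric.uniformCauchySeqOn_iff]
    intro ε hε
    have hl : Tendsto (fun n => 4 * T * M * e n) atTop (𝓝 0) := by simpa using hel.const_mul _
    obtain ⟨N, hN⟩ := Metric.tendsto_atTop.1 hl (ε / 2) (by positivity)
    refine ⟨N, fun n hn m hm t ht => ?_⟩
    have h1 := hN n hn
    have h2 := hN m hm
    rw [Real.dist_0_eq_abs] at h1 h2
    replace h1 := (le_abs_self _).trans_lt h1
    replace h2 := (le_abs_self _).trans_lt h2
    have h3 := hdiff n m t ht
    rw [dist_eq_norm]
    linarith
  · -- the defect in the resolvent equation is `e n • (R ^ 2) (…)`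
    have hdef : ∀ n, (∫ s in (0 : ℝ)..t, RR (Z n s)) - R ((∫ s in (0 : ℝ)..t, RR (Z n s))
        - RR (Z n t) + R (R z) + ∫ s in (0 : ℝ)..t, R (R (g s)))
        = e n • (R (R z) + (∫ s in (0 : ℝ)..t, R (R (g s))) - RR (Z n t)) := by
      intro n
      set V := ∫ s in (0 : ℝ)..t, RR (Z n s)
      set Y := ∫ s in (0 : ℝ)..t, R (R (g s)) with hY
      have h1 : RR (Z n t) = R (R z) + (R - 1) (regInv R n V) + Y := hUeq n t
      have h2 := hR.apply_regInv n V
      have h3 : (R - 1) (regInv R n V) = R (regInv R n V) - regInv R n V := rfl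
      have h4 : R (V - RR (Z n t) + R (R z) + Y)
          = R V - R (R (regInv R n V)) + R (regInv R n V) := by
        rw [h1, h3]; simp only [map_add, map_sub]; abel
      rw [h4, h1, h3, h2, map_sub, map_smul, h2, smul_sub]
      simp only [he, smul_sub, smul_add]
      abel
    have hb : ∀ n, ‖e n • (R (R z) + (∫ s in (0 : ℝ)..t, R (R (g s))) - RR (Z n t))‖
        ≤ e n * (‖R (R z) + (∫ s in (0 : ℝ)..t, R (R (g s)))‖ + M) := by
      intro n
      rw [norm_smul, Real.norm_of_nonneg (he0 n).le]
      refine mul_le_mul_of_nonneg_left ((norm_sub_le _ _).trans ?_) (he0 n).le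
      gcongr
      exact (hR.norm_le _).trans ((hR.norm_le _).trans (hZb n t ht))
    simp only [hdef]
    refine squeeze_zero_norm hb ?_
    simpa using hel.mul_const _

/-- Existence for arbitrary data, approximated by data in the range of `R ^ 2`. -/
theorem exists_isMild (hR : IsDissipativeResolvent R) {T : ℝ} (hT : 0 ≤ T) (x : E) {F : ℝ → E}
    (hF : Integrable F) :
    ∃ U : ℝ → E, Continuous U ∧ IsMild R T x F U := by
  set P : ℕ → E →L[ℝ] E := fun n => R.comp (regInv R n) with hP
  have hPn : ∀ n y, ‖P n y‖ ≤ ‖y‖ := fun n y => hR.norm_approx_le n y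
  have hPP : ∀ n y, P n (P n y) = R (R (regInv R n (regInv R n y))) := fun n y => by
    simp only [hP, ContinuousLinearMap.comp_apply, hR.comm n]
  have hPl : ∀ y, Tendsto (fun n => P n (P n y)) atTop (𝓝 y) := by
    intro y
    have h1 := hR.tendsto_approx y
    have h2 : Tendsto (fun n => P n (P n y - y)) atTop (𝓝 0) := by
      refine squeeze_zero_norm (fun n => hPn n _) ?_
      have := (h1.sub_const y).norm
      rwa [sub_self, norm_zero] at this
    have h3 := h2.add h1
    rw [zero_add] at h3
    refine h3.congr fun n => ?_
    rw [map_sub]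
    change P n (P n y) - P n y + P n y = _
    abel
  have hex := fun n : ℕ => exists_isMild_of_sq hR hT (regInv R n (regInv R n x))
    (((regInv R n).comp (regInv R n)).integrable_comp hF)
  choose U hUc hUm using hex
  have hUm' : ∀ n, IsMild R T (P n (P n x)) (fun s => P n (P n (F s))) (U n) := by
    intro n
    have := hUm n
    simp only [ContinuousLinearMap.comp_apply] at this
    simpa only [hPP] using this
  have hFi : ∀ n, Integrable fun s => P n (P n (F s)) := fun n =>
    ((P n).comp (P n)).integrable_comp hF
  have hFl := tendsto_integral_norm_sub (P := fun n => (P n).comp (P n))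
    (fun n y => (hPn n _).trans (hPn n y)) hPl (hF.intervalIntegrable (a := 0) (b := T))
  simp only [ContinuousLinearMap.comp_apply] at hFl
  have hPF : ∀ n, Integrable fun s => P n (P n (F s)) - F s := fun n => (hFi n).sub hF
  have hxl : Tendsto (fun n => ‖P n (P n x) - x‖) atTop (𝓝 0) := by
    simpa using ((hPl x).sub_const x).norm
  refine exists_isMild_of_approx (F := fun n s => P n (P n (F s))) hT hUc ?_ (hPl x)
    (fun t ht => ?_) fun t ht => ?_
  · rw [Metric.uniformCauchySeqOn_iff]
    intro ε hε
    have hl := hxl.add (hFl.const_mul 2)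
    simp only [mul_zero, add_zero] at hl
    obtain ⟨N, hN⟩ := Metric.tendsto_atTop.1 hl (ε / 2) (by positivity)
    refine ⟨N, fun n hn m hm t ht => ?_⟩
    have h1 := hN n hn
    have h2 := hN m hm
    rw [Real.dist_0_eq_abs] at h1 h2
    replace h1 := (le_abs_self _).trans_lt h1
    replace h2 := (le_abs_self _).trans_lt h2
    have h3 := ((hUm' n).sub (hUc n) (hUc m) (hFi n).intervalIntegrable
      (hFi m).intervalIntegrable (hUm' m)).norm_le hR ((hUc n).sub (hUc m))
      ((hFi n).sub (hFi m)).intervalIntegrable ht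
    change ‖U n t - U m t‖ ≤ ‖P n (P n x) - P m (P m x)‖
      + 2 * ∫ s in (0 : ℝ)..T, ‖P n (P n (F s)) - P m (P m (F s))‖ at h3
    have h4 : ‖P n (P n x) - P m (P m x)‖ ≤ ‖P n (P n x) - x‖ + ‖P m (P m x) - x‖ := by
      have := norm_sub_le (P n (P n x) - x) (P m (P m x) - x)
      rwa [sub_sub_sub_cancel_right] at this
    have h5 : ∫ s in (0 : ℝ)..T, ‖P n (P n (F s)) - P m (P m (F s))‖
        ≤ ∫ s in (0 : ℝ)..T, (‖P n (P n (F s)) - F s‖ + ‖P m (P m (F s)) - F s‖) := by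
      refine intervalIntegral.integral_mono_on hT ((hFi n).sub (hFi m)).norm.intervalIntegrable
        ((hPF n).norm.add (hPF m).norm).intervalIntegrable fun s _ => ?_
      have := norm_sub_le (P n (P n (F s)) - F s) (P m (P m (F s)) - F s)
      rwa [sub_sub_sub_cancel_right] at this
    rw [intervalIntegral.integral_add (hPF n).norm.intervalIntegrable
      (hPF m).norm.intervalIntegrable] at h5
    rw [dist_eq_norm]
    linarith
  · rw [tendsto_iff_norm_sub_tendsto_zero]
    refine squeeze_zero (fun _ => norm_nonneg _) (fun n => ?_) hFl
    rw [← intervalIntegral.integral_sub (hFi n).intervalIntegrable hF.intervalIntegrable]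
    refine (intervalIntegral.norm_integral_le_integral_norm ht.1).trans ?_
    exact intervalIntegral.integral_mono_interval le_rfl ht.1 ht.2
      (Eventually.of_forall fun _ => norm_nonneg _) (hPF n).norm.intervalIntegrable
  · have : ∀ n, (∫ s in (0 : ℝ)..t, U n s) - R ((∫ s in (0 : ℝ)..t, U n s) - U n t + P n (P n x)
        + ∫ s in (0 : ℝ)..t, P n (P n (F s))) = 0 := fun n => sub_eq_zero.2 (hUm' n t ht)
    simp only [this]
    exact tendsto_const_nhds

end Existence

/-! ### Smoothing along a weighted energy -/

section Smoothing

theorem norm_toLp_sq {α K : Type*} [MeasurableSpace α] {μ : Measure α} [NormedAddCommGroup K]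
    {f : α → K} (hf : MemLp f 2 μ) : ‖hf.toLp f‖ ^ 2 = ∫ t, ‖f t‖ ^ 2 ∂μ := by
  have h1 := hf.eLpNorm_eq_integral_rpow_norm two_ne_zero ENNReal.ofNat_ne_top
  have h0 : 0 ≤ ∫ t, ‖f t‖ ^ 2 ∂μ := integral_nonneg fun _ => sq_nonneg _
  rw [Lp.norm_toLp, h1]
  simp only [ENNReal.toReal_ofNat, Real.rpow_ofNat]
  rw [ENNReal.toReal_ofReal (Real.rpow_nonneg h0 _), ← Real.rpow_natCast, ← Real.rpow_mul h0]
  norm_num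

theorem norm_Lp_sq {α K : Type*} [MeasurableSpace α] {μ : Measure α} [NormedAddCommGroup K]
    (f : Lp K 2 μ) : ‖f‖ ^ 2 = ∫ t, ‖f t‖ ^ 2 ∂μ := by
  have := norm_toLp_sq (Lp.memLp f)
  rwa [Lp.toLp_coeFn] at this

variable {E : Type*} [NormedAddCommGroup E] [InnerProductSpace ℝ E] [CompleteSpace E]

/-- Smoothing: if the dissipation along a positive symmetric form `b` controls `‖S y‖²`, where
`S = D R` for some unbounded `D`, then `D U` makes sense in `L²(0,T;K)` for every mild solution. -/
theorem IsMild.exists_smoothing {K : Type*} [NormedAddCommGroup K] [NormedSpace ℝ K]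
    [CompleteSpace K] {R : E →L[ℝ] E} (hR : IsDissipativeResolvent R) {T : ℝ} (hT : 0 ≤ T)
    {x : E} {F U : ℝ → E} (hU : Continuous U) (hF : IntervalIntegrable F volume 0 T)
    (h : IsMild R T x F U) (b : E →L[ℝ] E →L[ℝ] ℝ) (hsymm : ∀ y z, b y z = b z y)
    (hpos : ∀ y, 0 ≤ b y y)
    (S : E →L[ℝ] K) {c : ℝ} (hc : 0 < c) (hb : ∀ y, b (R y - y) (R y) ≤ -(c * ‖S y‖ ^ 2)) :
    ∃ g : ℝ → K, MemLp g 2 (volume.restrict (Ioo 0 T)) ∧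
      (∃ φ : ℕ → ℕ, StrictMono φ ∧ ∀ᵐ t ∂(volume.restrict (Ioo 0 T)),
        Tendsto (fun n => S (regInv R (φ n) (U t))) atTop (𝓝 (g t))) ∧
      2 * c * ∫ t in Ioo 0 T, ‖g t‖ ^ 2 ≤ b x x + 2 * ∫ s in (0 : ℝ)..T, b (F s) (U s) := by
  have hTm : T ∈ Icc 0 T := ⟨hT, le_rfl⟩
  set μ : Measure ℝ := volume.restrict (Ioo 0 T) with hμ
  obtain ⟨CU, hCU⟩ := isCompact_Icc.exists_bound_of_continuousOn hU.continuousOn (s := Icc 0 T)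
  have hCU0 : 0 ≤ CU := (norm_nonneg _).trans (hCU T hTm)
  have hGc : ∀ n, Continuous fun t => S (regInv R n (U t)) := fun n => by fun_prop
  have hGm : ∀ n, MemLp (fun t => S (regInv R n (U t))) 2 μ := by
    intro n
    obtain ⟨C, hC⟩ := isCompact_Icc.exists_bound_of_continuousOn (hGc n).continuousOn
      (s := Icc 0 T)
    refine MemLp.of_bound (hGc n).aestronglyMeasurable C ?_
    exact (ae_restrict_iff' measurableSet_Ioo).2
      (Eventually.of_forall fun t ht => hC t (Ioo_subset_Icc_self ht))
  have hint : ∀ f : ℝ → ℝ, ∫ t in (0 : ℝ)..T, f t = ∫ t, f t ∂μ := fun f => by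
    rw [intervalIntegral.integral_of_le hT, integral_Ioc_eq_integral_Ioo]
  set G : ℕ → Lp K 2 μ := fun n => (hGm n).toLp _ with hG
  set a : ℕ → ℝ := fun n => ‖R (regInv R n x) - x‖ with ha
  set f : ℕ → ℝ := fun n => ∫ s in (0 : ℝ)..T, ‖R (regInv R n (F s)) - F s‖ with hf
  have hal : Tendsto a atTop (𝓝 0) := by
    simpa using ((hR.tendsto_approx x).sub_const x).norm
  have hfl : Tendsto f atTop (𝓝 0) :=
    tendsto_integral_norm_sub (P := fun n => R.comp (regInv R n))
      (fun n y => hR.norm_approx_le n y) hR.tendsto_approx hF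
  have hPF : ∀ n, IntervalIntegrable (fun s => R (regInv R n (F s))) volume 0 T := fun n =>
    ⟨(R.comp (regInv R n)).integrable_comp hF.1, (R.comp (regInv R n)).integrable_comp hF.2⟩
  -- the energy inequality regularised by the difference of two regularisations
  have hdist : ∀ n m, 2 * c * dist (G n) (G m) ^ 2
      ≤ ‖b‖ * ((a n + a m) ^ 2 + 4 * CU * (f n + f m)) := by
    intro n m
    set Q : E →L[ℝ] E := regInv R n - regInv R m with hQ
    have hRQ : ∀ y, R (Q y) = Q (R y) := fun y => by
      simp only [hQ, sub_apply, map_sub, hR.comm]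
    have key := h.energy_regularized hRQ hU hF b hsymm S hb hTm
    have e1 : dist (G n) (G m) ^ 2 = ∫ s in (0 : ℝ)..T, ‖S (Q (U s))‖ ^ 2 := by
      rw [dist_eq_norm, hG]
      simp only
      rw [← MemLp.toLp_sub, norm_toLp_sq, hint]
      simp only [Pi.sub_apply, ← map_sub]
      rfl
    rw [intervalIntegral.integral_const_mul, ← e1] at key
    have p0 := hpos (R (Q (U T)))
    have e2 : ‖R (Q x)‖ ≤ a n + a m := by
      have := norm_sub_le (R (regInv R n x) - x) (R (regInv R m x) - x)
      rw [sub_sub_sub_cancel_right] at this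
      simpa only [hQ, sub_apply, map_sub] using this
    have e3 : b (R (Q x)) (R (Q x)) ≤ ‖b‖ * (a n + a m) ^ 2 := by
      refine ((le_abs_self _).trans (b.le_opNorm₂ _ _)).trans ?_
      rw [mul_assoc, ← sq]
      gcongr
    have i3 : IntervalIntegrable (fun s => R (Q (F s))) volume 0 T :=
      ⟨(R.comp Q).integrable_comp hF.1, (R.comp Q).integrable_comp hF.2⟩
    have i4 : IntervalIntegrable (fun s => ‖R (regInv R n (F s)) - F s‖) volume 0 T :=
      ((hPF n).sub hF).norm
    have i5 : IntervalIntegrable (fun s => ‖R (regInv R m (F s)) - F s‖) volume 0 T :=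
      ((hPF m).sub hF).norm
    have e4 : ∫ s in (0 : ℝ)..T, b (R (Q (F s))) (R (Q (U s)))
        ≤ ∫ s in (0 : ℝ)..T, ‖b‖ * (2 * CU) *
          (‖R (regInv R n (F s)) - F s‖ + ‖R (regInv R m (F s)) - F s‖) := by
      refine intervalIntegral.integral_mono_on hT
        (intervalIntegrable_clm_apply b hT i3 (V := fun s => R (Q (U s))) (by fun_prop))
        ((i4.add i5).const_mul _) fun s hs => ?_
      refine ((le_abs_self _).trans (b.le_opNorm₂ _ _)).trans ?_
      have q1 : ‖R (Q (F s))‖ ≤ ‖R (regInv R n (F s)) - F s‖ + ‖R (regInv R m (F s)) - F s‖ := by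
        have := norm_sub_le (R (regInv R n (F s)) - F s) (R (regInv R m (F s)) - F s)
        rw [sub_sub_sub_cancel_right] at this
        simpa only [hQ, sub_apply, map_sub] using this
      have q2 : ‖R (Q (U s))‖ ≤ 2 * CU := by
        have := norm_sub_le (R (regInv R n (U s))) (R (regInv R m (U s)))
        have := hR.norm_approx_le n (U s)
        have := hR.norm_approx_le m (U s)
        have := hCU s hs
        simp only [hQ, sub_apply, map_sub]
        linarith
      calc _ ≤ ‖b‖ * (‖R (regInv R n (F s)) - F s‖ + ‖R (regInv R m (F s)) - F s‖) * (2 * CU) := by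
            gcongr
        _ = _ := by ring
    rw [intervalIntegral.integral_const_mul, intervalIntegral.integral_add i4 i5] at e4
    have e5 : (∫ s in (0 : ℝ)..T, ‖R (regInv R n (F s)) - F s‖)
      + ∫ s in (0 : ℝ)..T, ‖R (regInv R m (F s)) - F s‖ = f n + f m := rfl
    rw [e5] at e4
    linarith
  have hCS : CauchySeq G := by
    rw [cauchySeq_iff_tendsto_dist_atTop_0]
    have l1 : Tendsto (fun p : ℕ × ℕ => a p.1 + a p.2) atTop (𝓝 0) := by
      rw [← prod_atTop_atTop_eq]
      simpa using (hal.comp tendsto_fst).add (hal.comp tendsto_snd)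
    have l2 : Tendsto (fun p : ℕ × ℕ => f p.1 + f p.2) atTop (𝓝 0) := by
      rw [← prod_atTop_atTop_eq]
      simpa using (hfl.comp tendsto_fst).add (hfl.comp tendsto_snd)
    have l3 : Tendsto (fun p : ℕ × ℕ => √(‖b‖ * ((a p.1 + a p.2) ^ 2
        + 4 * CU * (f p.1 + f p.2)) / (2 * c))) atTop (𝓝 0) := by
      have := ((((l1.pow 2).add (l2.const_mul (4 * CU))).const_mul ‖b‖).div_const (2 * c)).sqrt
      simpa using this
    refine squeeze_zero (fun _ => dist_nonneg) (fun p => ?_) l3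
    refine Real.le_sqrt_of_sq_le ?_
    rw [le_div_iff₀ (by positivity)]
    linarith [hdist p.1 p.2]
  obtain ⟨g, hg⟩ := cauchySeq_tendsto_of_complete hCS
  refine ⟨g, Lp.memLp g, ?_, ?_⟩
  · obtain ⟨φ, hφ, hae⟩ := (tendstoInMeasure_of_tendsto_Lp hg).exists_seq_tendsto_ae
    refine ⟨φ, hφ, ?_⟩
    have hco : ∀ᵐ t ∂μ, ∀ n, G n t = S (regInv R n (U t)) :=
      ae_all_iff.2 fun n => (hGm n).coeFn_toLp
    filter_upwards [hae, hco] with t h1 h2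
    simpa only [h2] using h1
  · rw [← norm_Lp_sq]
    have l1 : Tendsto (fun n => 2 * c * ‖G n‖ ^ 2) atTop (𝓝 (2 * c * ‖g‖ ^ 2)) :=
      (hg.norm.pow 2).const_mul _
    have l2 : Tendsto (fun n => b (R (regInv R n x)) (R (regInv R n x))) atTop (𝓝 (b x x)) :=
      (b.isBoundedBilinearMap.continuous.tendsto (x, x)).comp
        ((hR.tendsto_approx x).prodMk_nhds (hR.tendsto_approx x))
    have l3 := tendsto_integral_bilin_approx hR hT hU hF b
    refine le_of_tendsto_of_tendsto' l1 (l2.add (l3.const_mul 2)) fun n => ?_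
    have key := h.energy_regularized (hR.comm n) hU hF b hsymm S hb hTm
    have p0 := hpos (R (regInv R n (U T)))
    rw [intervalIntegral.integral_const_mul, hint] at key
    rw [hG]
    simp only
    rw [norm_toLp_sq]
    linarith

end Smoothing

/-! ### One-dimensional Sobolev functions -/

section Sobolev
variable {a b : ℝ}

theorem L2.integrable (g : L2 a b) : Integrable g (volume.restrict (Ioo a b)) :=
  (Lp.memLp g).integrable (by norm_num)

theorem L2.intervalIntegrable (hab : a ≤ b) (g : L2 a b) : IntervalIntegrable g volume a b := by
  rw [intervalIntegrable_iff_integrableOn_Ioo_of_le hab]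
  exact L2.integrable g

/-- An a.e. equality on the open interval passes to interval integrals. -/
theorem intervalIntegral_congr_Ioo {E : Type*} [NormedAddCommGroup E] [NormedSpace ℝ E]
    {f g : ℝ → E} (h : ∀ᵐ x ∂(volume.restrict (Ioo a b)), f x = g x) {c x : ℝ}
    (hc : c ∈ Icc a b) (hx : x ∈ Icc a b) : ∫ y in c..x, f y = ∫ y in c..x, g y := by
  apply intervalIntegral.integral_congr_ae
  rw [ae_restrict_iff' measurableSet_Ioo] at h
  have hne : ∀ᵐ x : ℝ, x ≠ b := by simp [ae_iff, measure_singleton]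
  filter_upwards [h, hne] with y hy hyb hy'
  apply hy
  rcases le_total c x with hcx | hcx
  · rw [uIoc_of_le hcx] at hy'
    exact ⟨hc.1.trans_lt hy'.1, lt_of_le_of_ne (hy'.2.trans hx.2) hyb⟩
  · rw [uIoc_of_ge hcx] at hy'
    exact ⟨hx.1.trans_lt hy'.1, lt_of_le_of_ne (hy'.2.trans hc.2) hyb⟩

theorem IsH1Rep.continuousOn (hab : a ≤ b) {F : ℝ → ℝ} {f g : L2 a b} (h : IsH1Rep a b F f g) :
    ContinuousOn F (Icc a b) :=
  continuousOn_of_eq_primitive hab (L2.intervalIntegrable hab g) h.2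

theorem IsH1Rep.unique (hab : a < b) {F F' : ℝ → ℝ} {f g g' : L2 a b} (h : IsH1Rep a b F f g)
    (h' : IsH1Rep a b F' f g') : EqOn F F' (Icc a b) ∧ g = g' := by
  have hae : F =ᵐ[volume.restrict (Icc a b)] F' := by
    have : F =ᵐ[volume.restrict (Ioo a b)] F' := by
      filter_upwards [h.1, h'.1] with x h1 h2 using h1.symm.trans h2
    rwa [Measure.restrict_congr_set Ioo_ae_eq_Icc] at this
  have hE : EqOn F F' (Icc a b) :=
    Measure.eqOn_Icc_of_ae_eq volume hab.ne hae (h.continuousOn hab.le) (h'.continuousOn hab.le)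
  refine ⟨hE, ?_⟩
  have i1 := L2.intervalIntegrable hab.le g
  have i2 := L2.intervalIntegrable hab.le g'
  have hz := ae_eq_zero_of_primitive_eq_zero hab.le (i1.sub i2) fun t ht => by
    have j1 := intervalIntegrable_sub i1 hab.le ⟨le_rfl, hab.le⟩ ht
    have j2 := intervalIntegrable_sub i2 hab.le ⟨le_rfl, hab.le⟩ ht
    rw [intervalIntegral.integral_sub j1 j2]
    have e1 := h.2 t ht
    have e2 := h'.2 t ht
    have e3 := hE ht
    have e4 := hE (⟨le_rfl, hab.le⟩ : a ∈ Icc a b)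
    linarith
  refine Lp.ext ?_
  filter_upwards [hz] with x hx using sub_eq_zero.1 hx

theorem MemH1.isH1Rep {f : L2 a b} (hf : MemH1 f) : IsH1Rep a b (contRep f) f (wderiv f) := by
  unfold contRep wderiv
  rw [dif_pos hf, dif_pos hf]
  exact hf.choose_spec.choose_spec

theorem IsH1Rep.memH1 {F : ℝ → ℝ} {f g : L2 a b} (h : IsH1Rep a b F f g) : MemH1 f := ⟨F, g, h⟩

theorem IsH1Rep.wderiv_eq (hab : a < b) {F : ℝ → ℝ} {f g : L2 a b} (h : IsH1Rep a b F f g) :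
    wderiv f = g := (h.memH1.isH1Rep.unique hab h).2

theorem IsH1Rep.contRep_eq (hab : a < b) {F : ℝ → ℝ} {f g : L2 a b} (h : IsH1Rep a b F f g) :
    EqOn (contRep f) F (Icc a b) := (h.memH1.isH1Rep.unique hab h).1

theorem IsH1Rep.add (hab : a ≤ b) {F F' : ℝ → ℝ} {f f' g g' : L2 a b} (h : IsH1Rep a b F f g)
    (h' : IsH1Rep a b F' f' g') :
    IsH1Rep a b (fun x => F x + F' x) (f + f') (g + g') := by
  refine ⟨?_, fun x hx => ?_⟩
  · filter_upwards [h.1, h'.1, Lp.coeFn_add f f'] with x h1 h2 h3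
    rw [h3, Pi.add_apply, h1, h2]
  · have e : ∫ y in a..x, (g + g' : L2 a b) y = ∫ y in a..x, (g y + g' y) :=
      intervalIntegral_congr_Ioo (Lp.coeFn_add g g') ⟨le_rfl, hab⟩ hx
    rw [e, intervalIntegral.integral_add
      (intervalIntegrable_sub (L2.intervalIntegrable hab g) hab ⟨le_rfl, hab⟩ hx)
      (intervalIntegrable_sub (L2.intervalIntegrable hab g') hab ⟨le_rfl, hab⟩ hx)]
    have e1 := h.2 x hx
    have e2 := h'.2 x hx
    dsimp only
    linarith

theorem IsH1Rep.smul (hab : a ≤ b) (c : ℝ) {F : ℝ → ℝ} {f g : L2 a b} (h : IsH1Rep a b F f g) :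
    IsH1Rep a b (fun x => c * F x) (c • f) (c • g) := by
  refine ⟨?_, fun x hx => ?_⟩
  · filter_upwards [h.1, Lp.coeFn_smul c f] with x h1 h3
    rw [h3, Pi.smul_apply, h1, smul_eq_mul]
  · have e : ∫ y in a..x, (c • g : L2 a b) y = ∫ y in a..x, c * g y :=
      intervalIntegral_congr_Ioo (Lp.coeFn_smul c g) ⟨le_rfl, hab⟩ hx
    rw [e, intervalIntegral.integral_const_mul]
    dsimp only
    rw [h.2 x hx]
    ring

theorem MemH1.add (hab : a ≤ b) {f f' : L2 a b} (h : MemH1 f) (h' : MemH1 f') : MemH1 (f + f') :=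
  (h.isH1Rep.add hab h'.isH1Rep).memH1

theorem MemH1.smul (hab : a ≤ b) (c : ℝ) {f : L2 a b} (h : MemH1 f) : MemH1 (c • f) :=
  (h.isH1Rep.smul hab c).memH1

theorem wderiv_add (hab : a < b) {f f' : L2 a b} (h : MemH1 f) (h' : MemH1 f') :
    wderiv (f + f') = wderiv f + wderiv f' := (h.isH1Rep.add hab.le h'.isH1Rep).wderiv_eq hab

theorem wderiv_smul (hab : a < b) (c : ℝ) {f : L2 a b} (h : MemH1 f) :
    wderiv (c • f) = c • wderiv f := (h.isH1Rep.smul hab.le c).wderiv_eq hab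

theorem contRep_add (hab : a < b) {f f' : L2 a b} (h : MemH1 f) (h' : MemH1 f') {x : ℝ}
    (hx : x ∈ Icc a b) : contRep (f + f') x = contRep f x + contRep f' x :=
  (h.isH1Rep.add hab.le h'.isH1Rep).contRep_eq hab hx

theorem contRep_smul (hab : a < b) (c : ℝ) {f : L2 a b} (h : MemH1 f) {x : ℝ}
    (hx : x ∈ Icc a b) : contRep (c • f) x = c * contRep f x :=
  (h.isH1Rep.smul hab.le c).contRep_eq hab hx

theorem MemH1.sub (hab : a ≤ b) {f f' : L2 a b} (h : MemH1 f) (h' : MemH1 f') :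
    MemH1 (f - f') := by
  have := h.add hab (h'.smul hab (-1))
  rwa [neg_one_smul, ← sub_eq_add_neg] at this

theorem wderiv_sub (hab : a < b) {f f' : L2 a b} (h : MemH1 f) (h' : MemH1 f') :
    wderiv (f - f') = wderiv f - wderiv f' := by
  have := wderiv_add hab h (h'.smul hab.le (-1))
  rwa [wderiv_smul hab _ h', neg_one_smul, neg_one_smul, ← sub_eq_add_neg, ← sub_eq_add_neg]
    at this

theorem MemH3.add (hab : a < b) {f f' : L2 a b} (h : MemH3 f) (h' : MemH3 f') :
    MemH3 (f + f') := by
  refine ⟨h.1.add hab.le h'.1, ?_, ?_⟩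
  · rw [wderiv_add hab h.1 h'.1]; exact h.2.1.add hab.le h'.2.1
  · rw [wderiv_add hab h.1 h'.1, wderiv_add hab h.2.1 h'.2.1]; exact h.2.2.add hab.le h'.2.2

theorem MemH3.smul (hab : a < b) (c : ℝ) {f : L2 a b} (h : MemH3 f) : MemH3 (c • f) := by
  refine ⟨h.1.smul hab.le c, ?_, ?_⟩
  · rw [wderiv_smul hab c h.1]; exact h.2.1.smul hab.le c
  · rw [wderiv_smul hab c h.1, wderiv_smul hab c h.2.1]; exact h.2.2.smul hab.le c

theorem wderiv3_add (hab : a < b) {f f' : L2 a b} (h : MemH3 f) (h' : MemH3 f') :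
    wderiv (wderiv (wderiv (f + f')))
      = wderiv (wderiv (wderiv f)) + wderiv (wderiv (wderiv f')) := by
  rw [wderiv_add hab h.1 h'.1, wderiv_add hab h.2.1 h'.2.1, wderiv_add hab h.2.2 h'.2.2]

theorem wderiv3_smul (hab : a < b) (c : ℝ) {f : L2 a b} (h : MemH3 f) :
    wderiv (wderiv (wderiv (c • f))) = c • wderiv (wderiv (wderiv f)) := by
  rw [wderiv_smul hab c h.1, wderiv_smul hab c h.2.1, wderiv_smul hab c h.2.2]

/-! ### The primitive and multiplication operators -/

theorem memLp_of_continuousOn (p : ℝ≥0∞) {F : ℝ → ℝ} (hF : ContinuousOn F (Icc a b)) :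
    MemLp F p (volume.restrict (Ioo a b)) := by
  obtain ⟨C, hC⟩ := isCompact_Icc.exists_bound_of_continuousOn hF
  refine MemLp.of_bound ((hF.mono Ioo_subset_Icc_self).aestronglyMeasurable measurableSet_Ioo) C ?_
  exact (ae_restrict_iff' measurableSet_Ioo).2
    (Eventually.of_forall fun t ht => hC t (Ioo_subset_Icc_self ht))

theorem L2.exists_integral_norm_le (a b : ℝ) :
    ∃ C : ℝ, 0 ≤ C ∧ ∀ g : L2 a b, ∫ x in Ioo a b, ‖g x‖ ≤ C * ‖g‖ := by
  set μ := (volume : Measure ℝ).restrict (Ioo a b) with hμ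
  refine ⟨(μ univ ^ (1 / (1 : ℝ≥0∞).toReal - 1 / (2 : ℝ≥0∞).toReal)).toReal,
    ENNReal.toReal_nonneg, fun g => ?_⟩
  have h := eLpNorm_le_eLpNorm_mul_rpow_measure_univ (μ := μ) (p := 1) (q := 2) (by norm_num)
    (Lp.aestronglyMeasurable g)
  rw [integral_norm_eq_lintegral_enorm (Lp.aestronglyMeasurable g),
    ← eLpNorm_one_eq_lintegral_enorm, Lp.norm_def, mul_comm, ← ENNReal.toReal_mul]
  refine ENNReal.toReal_mono (ENNReal.mul_ne_top (Lp.eLpNorm_ne_top g) ?_) h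
  exact ENNReal.rpow_ne_top_of_nonneg (by norm_num) (measure_ne_top _ _)

theorem continuousOn_primitive (hab : a ≤ b) (g : L2 a b) :
    ContinuousOn (fun x => ∫ y in a..x, g y) (Icc a b) :=
  continuousOn_of_eq_primitive hab (L2.intervalIntegrable hab g) fun x _ => by simp

/-- The primitive `x ↦ ∫ₐˣ g`, as an essentially bounded function. -/
def primInf (hab : a ≤ b) : L2 a b →L[ℝ] Lp ℝ ∞ (volume.restrict (Ioo a b)) :=
  LinearMap.mkContinuousOfExistsBound
    { toFun := fun g => (memLp_of_continuousOn ∞ (continuousOn_primitive hab g)).toLp _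
      map_add' := fun g g' => by
        rw [← MemLp.toLp_add]
        refine MemLp.toLp_congr _ _ ((ae_restrict_iff' measurableSet_Ioo).2
          (Eventually.of_forall fun x hx => ?_))
        have hx' := Ioo_subset_Icc_self hx
        rw [Pi.add_apply, ← intervalIntegral.integral_add
          (intervalIntegrable_sub (L2.intervalIntegrable hab g) hab ⟨le_rfl, hab⟩ hx')
          (intervalIntegrable_sub (L2.intervalIntegrable hab g') hab ⟨le_rfl, hab⟩ hx')]
        exact intervalIntegral_congr_Ioo (Lp.coeFn_add g g') ⟨le_rfl, hab⟩ hx'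
      map_smul' := fun c g => by
        rw [RingHom.id_apply, ← MemLp.toLp_const_smul]
        refine MemLp.toLp_congr _ _ ((ae_restrict_iff' measurableSet_Ioo).2
          (Eventually.of_forall fun x hx => ?_))
        rw [Pi.smul_apply, ← intervalIntegral.integral_smul]
        exact intervalIntegral_congr_Ioo (Lp.coeFn_smul c g) ⟨le_rfl, hab⟩
          (Ioo_subset_Icc_self hx) }
    (by
      obtain ⟨C, hC0, hC⟩ := L2.exists_integral_norm_le a b
      refine ⟨C, fun g => ?_⟩
      refine Lp.norm_le_of_ae_bound (by positivity) ?_ |>.trans (b := (measureUnivNNReal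
        (volume.restrict (Ioo a b)) : ℝ) ^ (∞ : ℝ≥0∞).toReal⁻¹ * (C * ‖g‖)) ?_
      · filter_upwards [(memLp_of_continuousOn ∞ (continuousOn_primitive hab g)).coeFn_toLp,
          ae_restrict_mem measurableSet_Ioo] with x hx hx'
        change ‖(memLp_of_continuousOn ∞ (continuousOn_primitive hab g)).toLp _ x‖ ≤ _
        rw [hx]
        refine (intervalIntegral.norm_integral_le_integral_norm hx'.1.le).trans ?_
        refine le_trans ?_ (hC g)
        rw [← integral_Ioc_eq_integral_Ioo, ← intervalIntegral.integral_of_le hab]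
        exact intervalIntegral.integral_mono_interval le_rfl hx'.1.le hx'.2.le
          (Eventually.of_forall fun _ => norm_nonneg _) (L2.intervalIntegrable hab g).norm
      · simp)

theorem coeFn_primInf (hab : a ≤ b) (g : L2 a b) :
    ∀ᵐ x ∂(volume.restrict (Ioo a b)), primInf hab g x = ∫ y in a..x, g y :=
  MemLp.coeFn_toLp (memLp_of_continuousOn ∞ (continuousOn_primitive hab g))

/-- Pointwise multiplication `L^∞ × L² → L²`. -/
def mulL : Lp ℝ ∞ (volume.restrict (Ioo a b)) →L[ℝ] L2 a b →L[ℝ] L2 a b :=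
  (ContinuousLinearMap.mul ℝ ℝ).holderL (volume.restrict (Ioo a b)) ∞ 2 2

theorem coeFn_mulL (f : Lp ℝ ∞ (volume.restrict (Ioo a b))) (g : L2 a b) :
    ∀ᵐ x ∂(volume.restrict (Ioo a b)), mulL f g x = f x * g x :=
  (ContinuousLinearMap.mul ℝ ℝ).coeFn_holder f g

variable (a b) in
/-- The constant function `1`. -/
def oneL : L2 a b := (memLp_of_continuousOn 2 (continuousOn_const (c := (1 : ℝ)))).toLp _

theorem coeFn_oneL : ∀ᵐ x ∂(volume.restrict (Ioo a b)), oneL a b x = 1 :=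
  MemLp.coeFn_toLp _

/-- The primitive `x ↦ ∫ₐˣ g`, as an operator of `L²`. -/
def prim (hab : a ≤ b) : L2 a b →L[ℝ] L2 a b := (mulL.flip (oneL a b)).comp (primInf hab)

theorem coeFn_prim (hab : a ≤ b) (g : L2 a b) :
    ∀ᵐ x ∂(volume.restrict (Ioo a b)), prim hab g x = ∫ y in a..x, g y := by
  filter_upwards [coeFn_mulL (primInf hab g) (oneL a b), coeFn_primInf hab g, coeFn_oneL]
    with x h1 h2 h3
  change mulL (primInf hab g) (oneL a b) x = _
  rw [h1, h2, h3, mul_one]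

variable (a b) in
/-- The mean value. -/
def mean : L2 a b →L[ℝ] ℝ := (b - a)⁻¹ • innerForm (L2 a b) (oneL a b)

theorem oneL_inner (g : L2 a b) : ⟪oneL a b, g⟫ = ∫ x in Ioo a b, g x := by
  rw [L2.inner_def]
  refine integral_congr_ae ?_
  filter_upwards [coeFn_oneL (a := a) (b := b)] with x hx
  rw [hx]; simp

theorem mean_oneL (hab : a < b) : mean a b (oneL a b) = 1 := by
  change (b - a)⁻¹ * ⟪oneL a b, oneL a b⟫ = 1
  rw [oneL_inner, integral_congr_ae coeFn_oneL]
  simp [hab.le, (sub_pos.2 hab).ne']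

/-- For `f ∈ H¹(a,b)` with weak derivative `g`, the value at `a` of the continuous representative,
written as the mean of `f - ∫ₐ g` so as to be bounded on all of `L² × L²`. -/
def cst (hab : a ≤ b) : L2 a b × L2 a b →L[ℝ] ℝ :=
  (mean a b).comp (ContinuousLinearMap.fst ℝ _ _ - (prim hab).comp (ContinuousLinearMap.snd ℝ _ _))

theorem isH1Rep_of_eq (hab : a ≤ b) {f g : L2 a b} {c : ℝ} (h : f = c • oneL a b + prim hab g) :
    IsH1Rep a b (fun x => c + ∫ y in a..x, g y) f g := by
  refine ⟨?_, fun x _ => by simp⟩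
  filter_upwards [coeFn_prim hab g, coeFn_oneL (a := a) (b := b),
    Lp.coeFn_add (c • oneL a b) (prim hab g), Lp.coeFn_smul c (oneL a b)] with x h1 h2 h3 h4
  rw [h, h3, Pi.add_apply, h4, Pi.smul_apply, h1, h2, smul_eq_mul, mul_one]

theorem IsH1Rep.eq_add_prim (hab : a ≤ b) {F : ℝ → ℝ} {f g : L2 a b} (h : IsH1Rep a b F f g) :
    f = F a • oneL a b + prim hab g := by
  refine Lp.ext ?_
  filter_upwards [coeFn_prim hab g, coeFn_oneL (a := a) (b := b),
    Lp.coeFn_add (F a • oneL a b) (prim hab g), Lp.coeFn_smul (F a) (oneL a b), h.1,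
    ae_restrict_mem measurableSet_Ioo] with x h1 h2 h3 h4 h5 h6
  rw [h3, Pi.add_apply, h4, Pi.smul_apply, h1, h2, smul_eq_mul, mul_one, h5,
    h.2 x (Ioo_subset_Icc_self h6)]

theorem IsH1Rep.cst_eq (hab : a < b) {F : ℝ → ℝ} {f g : L2 a b} (h : IsH1Rep a b F f g) :
    cst hab.le (f, g) = F a := by
  have h1 := h.eq_add_prim hab.le
  change mean a b (f - prim hab.le g) = _
  rw [h1, add_sub_cancel_right, map_smul, mean_oneL hab, smul_eq_mul, mul_one]

/-- The graph of the weak derivative, in closed form. -/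
theorem memH1_wderiv_iff (hab : a < b) {f g : L2 a b} :
    (MemH1 f ∧ wderiv f = g) ↔ f = cst hab.le (f, g) • oneL a b + prim hab.le g := by
  constructor
  · rintro ⟨h, rfl⟩
    rw [h.isH1Rep.cst_eq hab]
    exact h.isH1Rep.eq_add_prim hab.le
  · intro h
    have := isH1Rep_of_eq hab.le h
    exact ⟨this.memH1, this.wderiv_eq hab⟩

theorem isClosed_graph_wderiv (hab : a < b) :
    IsClosed {p : L2 a b × L2 a b | MemH1 p.1 ∧ wderiv p.1 = p.2} := by
  simp only [memH1_wderiv_iff hab]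
  refine isClosed_eq continuous_fst ?_
  fun_prop

/-- The bilinear map `((f, f'), k) ↦ f k`, bounded on the graph of the weak derivative since
`H¹ ⊆ L^∞`. -/
def mulH1 (hab : a ≤ b) : L2 a b × L2 a b →L[ℝ] L2 a b →L[ℝ] L2 a b :=
  (cst hab).smulRight (ContinuousLinearMap.id ℝ (L2 a b))
    + (mulL.comp (primInf hab)).comp (ContinuousLinearMap.snd ℝ _ _)

theorem IsH1Rep.coeFn_mulH1 (hab : a < b) {F : ℝ → ℝ} {f g : L2 a b} (h : IsH1Rep a b F f g)
    (k : L2 a b) :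
    ∀ᵐ x ∂(volume.restrict (Ioo a b)), mulH1 hab.le (f, g) k x = F x * k x := by
  have e : mulH1 hab.le (f, g) k = F a • k + mulL (primInf hab.le g) k := by
    rw [← h.cst_eq hab]; rfl
  rw [e]
  filter_upwards [Lp.coeFn_add (F a • k) (mulL (primInf hab.le g) k), Lp.coeFn_smul (F a) k,
    coeFn_mulL (primInf hab.le g) k, coeFn_primInf hab.le g, ae_restrict_mem measurableSet_Ioo]
    with x h1 h2 h3 h4 h5
  rw [h1, Pi.add_apply, h2, h3, h4, h.2 x (Ioo_subset_Icc_self h5), Pi.smul_apply, smul_eq_mul]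
  ring

end Sobolev

/-! ### Integration by parts -/

section ByParts

/-- Integrated product rule for real primitives of integrable functions. -/
theorem mul_primitive {a c : ℝ} (hac : a ≤ c) {G U K V : ℝ → ℝ}
    (hG : IntervalIntegrable G volume a c) (hK : IntervalIntegrable K volume a c)
    (hU : ∀ t ∈ Icc a c, U t = U a + ∫ s in a..t, G s)
    (hV : ∀ t ∈ Icc a c, V t = V a + ∫ s in a..t, K s) :
    ∀ t ∈ Icc a c, U t * V t = U a * V a + ∫ s in a..t, (G s * V s + U s * K s) := by
  intro t ht
  exact bilin_primitive (ContinuousLinearMap.mul ℝ ℝ) ht.1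
    (intervalIntegrable_sub hG hac ⟨le_rfl, hac⟩ ht)
    (intervalIntegrable_sub hK hac ⟨le_rfl, hac⟩ ht)
    (fun s hs => hU s ⟨hs.1, hs.2.trans ht.2⟩) (fun s hs => hV s ⟨hs.1, hs.2.trans ht.2⟩)

/-- Integration by parts in `∫ p y y'''` for an affine weight `p x = c + d x`. -/
theorem integral_affine_mul_third {L : ℝ} (hL : 0 ≤ L) (c d : ℝ) {y₀ y₁ y₂ y₃ : ℝ → ℝ}
    (hc₁ : ContinuousOn y₁ (Icc 0 L)) (hc₂ : ContinuousOn y₂ (Icc 0 L))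
    (hi : IntervalIntegrable y₃ volume 0 L)
    (h₀ : ∀ x ∈ Icc 0 L, y₀ x = y₀ 0 + ∫ s in (0 : ℝ)..x, y₁ s)
    (h₁ : ∀ x ∈ Icc 0 L, y₁ x = y₁ 0 + ∫ s in (0 : ℝ)..x, y₂ s)
    (h₂ : ∀ x ∈ Icc 0 L, y₂ x = y₂ 0 + ∫ s in (0 : ℝ)..x, y₃ s)
    (hl : y₀ 0 = 0) (hr : y₀ L = 0) :
    ∫ x in (0 : ℝ)..L, (c + d * x) * y₀ x * y₃ x
      = -(1 / 2) * ((c + d * L) * y₁ L ^ 2 - c * y₁ 0 ^ 2)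
        + 3 / 2 * d * ∫ x in (0 : ℝ)..L, y₁ x ^ 2 := by
  have hLm : L ∈ Icc 0 L := ⟨hL, le_rfl⟩
  have hu : uIcc 0 L = Icc 0 L := uIcc_of_le hL
  have i₁ : IntervalIntegrable y₁ volume 0 L := (hu ▸ hc₁).intervalIntegrable
  have i₂ : IntervalIntegrable y₂ volume 0 L := (hu ▸ hc₂).intervalIntegrable
  have hc₀ : ContinuousOn y₀ (Icc 0 L) := continuousOn_of_eq_primitive hL i₁ h₀
  have hp : ∀ x ∈ Icc 0 L, (fun x => c + d * x) x
      = (fun x => c + d * x) 0 + ∫ _s in (0 : ℝ)..x, d := fun x _ => by simp; ring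
  have hcp : ContinuousOn (fun x => c + d * x) (Icc 0 L) := by fun_prop
  have id : IntervalIntegrable (fun _ : ℝ => d) volume 0 L := intervalIntegrable_const
  -- derivative of `p y₀` and of `p y₁`
  have j₀ : IntervalIntegrable (fun s => d * y₀ s + (c + d * s) * y₁ s) volume 0 L :=
    (hu ▸ (continuousOn_const.mul hc₀).add (hcp.mul hc₁)).intervalIntegrable
  have j₁ : IntervalIntegrable (fun s => d * y₁ s + (c + d * s) * y₂ s) volume 0 L :=
    (hu ▸ (continuousOn_const.mul hc₁).add (hcp.mul hc₂)).intervalIntegrable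
  have a₀ := mul_primitive hL id i₁ hp h₀
  have a₁ := mul_primitive hL id i₂ hp h₁
  have A := mul_primitive hL j₀ hi (U := fun x => (c + d * x) * y₀ x) a₀ h₂ L hLm
  have B := mul_primitive hL i₁ i₂ h₀ h₁ L hLm
  have C := mul_primitive hL j₁ i₂ (U := fun x => (c + d * x) * y₁ x) a₁ h₁ L hLm
  have k1 : IntervalIntegrable (fun x => (c + d * x) * y₀ x * y₃ x) volume 0 L := by
    have := hi.continuousOn_mul (hu ▸ (hcp.mul hc₀))
    exact this
  have k2 : IntervalIntegrable (fun x => y₀ x * y₂ x) volume 0 L :=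
    (hu ▸ hc₀.mul hc₂).intervalIntegrable
  have k3 : IntervalIntegrable (fun x => (c + d * x) * y₁ x * y₂ x) volume 0 L :=
    (hu ▸ (hcp.mul hc₁).mul hc₂).intervalIntegrable
  have k4 : IntervalIntegrable (fun x => y₁ x ^ 2) volume 0 L :=
    (hu ▸ hc₁.pow 2).intervalIntegrable
  have eA : ∫ s in (0 : ℝ)..L, ((d * y₀ s + (c + d * s) * y₁ s) * y₂ s
      + (c + d * s) * y₀ s * y₃ s) = d * (∫ s in (0 : ℝ)..L, y₀ s * y₂ s)
        + (∫ s in (0 : ℝ)..L, (c + d * s) * y₁ s * y₂ s)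
        + ∫ s in (0 : ℝ)..L, (c + d * s) * y₀ s * y₃ s := by
    rw [← intervalIntegral.integral_const_mul, ← intervalIntegral.integral_add (k2.const_mul d) k3,
      ← intervalIntegral.integral_add ((k2.const_mul d).add k3) k1]
    congr 1; ext s; ring
  have eB : ∫ s in (0 : ℝ)..L, (y₁ s * y₁ s + y₀ s * y₂ s)
      = (∫ s in (0 : ℝ)..L, y₁ s ^ 2) + ∫ s in (0 : ℝ)..L, y₀ s * y₂ s := by
    rw [← intervalIntegral.integral_add k4 k2]
    congr 1; ext s; ring
  have eC : ∫ s in (0 : ℝ)..L, ((d * y₁ s + (c + d * s) * y₂ s) * y₁ s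
      + (c + d * s) * y₁ s * y₂ s) = d * (∫ s in (0 : ℝ)..L, y₁ s ^ 2)
        + 2 * ∫ s in (0 : ℝ)..L, (c + d * s) * y₁ s * y₂ s := by
    rw [← intervalIntegral.integral_const_mul, ← intervalIntegral.integral_const_mul,
      ← intervalIntegral.integral_add (k4.const_mul d) (k3.const_mul 2)]
    congr 1; ext s; ring
  rw [eA, hl, hr] at A
  rw [eB, hl, hr] at B
  rw [eC] at C
  linear_combination -A + d * B + (1 / 2) * C

end ByParts

/-! ### The stationary boundary value problems -/

section ThirdOrder

/-- Existence for the linear third order equation `y''' = μ y + F` with Cauchy data at `p`. -/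
theorem exists_third_order (μ p c₀ c₁ c₂ : ℝ) {F : ℝ → ℝ} (hF : Integrable F) :
    ∃ y₀ y₁ y₂ : ℝ → ℝ, Continuous y₀ ∧ Continuous y₁ ∧ Continuous y₂ ∧
      (∀ x, y₀ x = c₀ + ∫ s in p..x, y₁ s) ∧ (∀ x, y₁ x = c₁ + ∫ s in p..x, y₂ s) ∧
      ∀ x, y₂ x = c₂ + ∫ s in p..x, (μ * y₀ s + F s) := by
  set B : ℝ × ℝ × ℝ →L[ℝ] ℝ × ℝ × ℝ :=
    ((ContinuousLinearMap.fst ℝ ℝ ℝ).comp (ContinuousLinearMap.snd ℝ ℝ (ℝ × ℝ))).prod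
      (((ContinuousLinearMap.snd ℝ ℝ ℝ).comp (ContinuousLinearMap.snd ℝ ℝ (ℝ × ℝ))).prod
        (μ • ContinuousLinearMap.fst ℝ ℝ (ℝ × ℝ))) with hB
  set J : ℝ →L[ℝ] ℝ × ℝ × ℝ :=
    (ContinuousLinearMap.inr ℝ ℝ (ℝ × ℝ)).comp (ContinuousLinearMap.inr ℝ ℝ ℝ) with hJ
  obtain ⟨U, hUc, hU⟩ := exists_bounded_ode B p (c₀, c₁, c₂) (J.integrable_comp hF)
  have hi : ∀ x, IntervalIntegrable U volume p x := fun x => hUc.intervalIntegrable _ _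
  have e0 : ∀ x, (∫ s in p..x, U s).1 = ∫ s in p..x, (U s).1 := fun x =>
    ((ContinuousLinearMap.fst ℝ ℝ (ℝ × ℝ)).intervalIntegral_comp_comm (hi x)).symm
  have e1 : ∀ x, (∫ s in p..x, U s).2.1 = ∫ s in p..x, (U s).2.1 := fun x =>
    (((ContinuousLinearMap.fst ℝ ℝ ℝ).comp
      (ContinuousLinearMap.snd ℝ ℝ (ℝ × ℝ))).intervalIntegral_comp_comm (hi x)).symm
  have e2 : ∀ x, (∫ s in p..x, U s).2.2 = ∫ s in p..x, (U s).2.2 := fun x =>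
    (((ContinuousLinearMap.snd ℝ ℝ ℝ).comp
      (ContinuousLinearMap.snd ℝ ℝ (ℝ × ℝ))).intervalIntegral_comp_comm (hi x)).symm
  have eJ : ∀ x, ∫ s in p..x, J (F s) = J (∫ s in p..x, F s) := fun x =>
    J.intervalIntegral_comp_comm hF.intervalIntegrable
  refine ⟨fun x => (U x).1, fun x => (U x).2.1, fun x => (U x).2.2, by fun_prop, by fun_prop,
    by fun_prop, fun x => ?_, fun x => ?_, fun x => ?_⟩
  · have := congrArg Prod.fst (hU x)
    rw [eJ] at this
    simpa [hB, hJ, e1] using this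
  · have := congrArg (fun q => q.2.1) (hU x)
    rw [eJ] at this
    simpa [hB, hJ, e2] using this
  · have := congrArg (fun q => q.2.2) (hU x)
    rw [eJ] at this
    have hc : Continuous fun s => μ * (U s).1 := by fun_prop
    simp only
    rw [intervalIntegral.integral_add (hc.intervalIntegrable _ _) hF.intervalIntegrable,
      intervalIntegral.integral_const_mul, ← e0, ← add_assoc]
    simpa [hB, hJ] using this

theorem eq_add_integral_of_base {y w : ℝ → ℝ} {p c : ℝ}
    (hw : ∀ s t, IntervalIntegrable w volume s t)
    (h : ∀ x, y x = c + ∫ s in p..x, w s) (x : ℝ) : y x = y 0 + ∫ s in (0 : ℝ)..x, w s := by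
  rw [h x, h 0, add_assoc, intervalIntegral.integral_add_adjacent_intervals (hw _ _) (hw _ _)]

/-- A continuous function all of whose integrals over subintervals of `[0,L]` based at `0` vanish
is zero on `[0,L]`. -/
theorem eq_zero_of_primitive {L : ℝ} (hL : 0 < L) {y : ℝ → ℝ} (hy : Continuous y)
    (h : ∀ x ∈ Icc 0 L, ∫ s in (0 : ℝ)..x, y s = 0) : ∀ x ∈ Icc 0 L, y x = 0 := by
  have h1 := ae_eq_zero_of_primitive_eq_zero hL.le (hy.intervalIntegrable 0 L) h
  have h2 : y =ᵐ[volume.restrict (Icc 0 L)] fun _ => 0 := by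
    rwa [Measure.restrict_congr_set Ioo_ae_eq_Icc.symm]
  exact Measure.eqOn_Icc_of_ae_eq volume hL.ne h2 hy.continuousOn continuousOn_const

/-- Shooting is nondegenerate: by the energy identity, a solution of `y''' = μ y` with `y`, `y'`
vanishing at `p` and `y'' p = 1` does not vanish at the other end `q`, provided that
`μ (q - p) > 0`. -/
theorem shooting_ne_zero {L μ p q : ℝ} (hL : 0 < L)
    (hpq : p = 0 ∧ q = L ∧ 0 < μ ∨ p = L ∧ q = 0 ∧ μ < 0) {y₀ y₁ y₂ : ℝ → ℝ}
    (hc₀ : Continuous y₀) (hc₁ : Continuous y₁) (hc₂ : Continuous y₂)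
    (h₀ : ∀ x, y₀ x = 0 + ∫ s in p..x, y₁ s) (h₁ : ∀ x, y₁ x = 0 + ∫ s in p..x, y₂ s)
    (h₂ : ∀ x, y₂ x = 1 + ∫ s in p..x, (μ * y₀ s + 0)) : y₀ q ≠ 0 := by
  intro hq
  have hp₀ : y₀ p = 0 := by simpa using h₀ p
  have hp₁ : y₁ p = 0 := by simpa using h₁ p
  have hp₂ : y₂ p = 1 := by simpa using h₂ p
  have g₀ := eq_add_integral_of_base (fun s t => hc₁.intervalIntegrable s t) h₀
  have g₁ := eq_add_integral_of_base (fun s t => hc₂.intervalIntegrable s t) h₁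
  have c₃ : Continuous fun s => μ * y₀ s + 0 := by fun_prop
  have g₂ := eq_add_integral_of_base (fun s t => c₃.intervalIntegrable s t) h₂
  have hl : y₀ 0 = 0 := by
    rcases hpq with ⟨h, h', _⟩ | ⟨h, h', _⟩
    exacts [h ▸ hp₀, h' ▸ hq]
  have hr : y₀ L = 0 := by
    rcases hpq with ⟨h, h', _⟩ | ⟨h, h', _⟩
    exacts [h' ▸ hq, h ▸ hp₀]
  have key := integral_affine_mul_third hL.le 1 0 hc₁.continuousOn hc₂.continuousOn
    (c₃.intervalIntegrable 0 L) (fun x _ => g₀ x) (fun x _ => g₁ x) (fun x _ => g₂ x) hl hr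
  have e1 : ∫ x in (0 : ℝ)..L, (1 + 0 * x) * y₀ x * (μ * y₀ x + 0)
      = μ * ∫ x in (0 : ℝ)..L, y₀ x ^ 2 := by
    rw [← intervalIntegral.integral_const_mul]; congr 1; ext x; ring
  rw [e1] at key
  have hnn : 0 ≤ ∫ x in (0 : ℝ)..L, y₀ x ^ 2 :=
    intervalIntegral.integral_nonneg hL.le fun _ _ => sq_nonneg _
  have hz : ∫ x in (0 : ℝ)..L, y₀ x ^ 2 = 0 := by
    rcases hpq with ⟨h, h', hμ⟩ | ⟨h, h', hμ⟩
    · rw [h] at hp₁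
      rw [hp₁] at key
      nlinarith [sq_nonneg (y₁ L)]
    · rw [h] at hp₁
      rw [hp₁] at key
      nlinarith [sq_nonneg (y₁ 0)]
  have hy₀ : ∀ x ∈ Icc 0 L, y₀ x = 0 := by
    intro x hx
    have hzz := eq_zero_of_primitive hL (hc₀.pow 2) (fun t ht => ?_) x hx
    · exact pow_eq_zero_iff two_ne_zero |>.1 hzz
    · refine le_antisymm ?_ (intervalIntegral.integral_nonneg ht.1 fun _ _ => sq_nonneg _)
      refine le_of_le_of_eq ?_ hz
      exact intervalIntegral.integral_mono_interval le_rfl ht.1 ht.2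
        (Eventually.of_forall fun _ => sq_nonneg _) ((hc₀.pow 2).intervalIntegrable _ _)
  have hy₁ : ∀ x ∈ Icc 0 L, y₁ x = 0 := eq_zero_of_primitive hL hc₁ fun t ht => by
    have := g₀ t; rw [hy₀ t ht, hl] at this; linarith
  have hy₂ : ∀ x ∈ Icc 0 L, y₂ x = 0 := eq_zero_of_primitive hL hc₂ fun t ht => by
    have := g₁ t; rw [hy₁ t ht, hy₁ 0 ⟨le_rfl, hL.le⟩] at this; linarith
  have hpm : p ∈ Icc 0 L := by
    rcases hpq with ⟨h, _⟩ | ⟨h, _⟩ <;> rw [h]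
    exacts [⟨le_rfl, hL.le⟩, ⟨hL.le, le_rfl⟩]
  rw [hy₂ p hpm] at hp₂
  exact zero_ne_one hp₂

/-- A continuous function, as an element of `L²`. -/
def contL {a b : ℝ} {F : ℝ → ℝ} (hF : Continuous F) : L2 a b :=
  (memLp_of_continuousOn 2 hF.continuousOn).toLp F

theorem coeFn_contL {a b : ℝ} {F : ℝ → ℝ} (hF : Continuous F) :
    ∀ᵐ x ∂(volume.restrict (Ioo a b)), (contL hF : L2 a b) x = F x :=
  MemLp.coeFn_toLp _

theorem isH1Rep_contL {b : ℝ} (hb : 0 ≤ b) {F : ℝ → ℝ} (hF : Continuous F) {G : ℝ → ℝ}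
    {g : L2 0 b} (hg : ∀ᵐ x ∂(volume.restrict (Ioo 0 b)), g x = G x)
    (h : ∀ x, F x = F 0 + ∫ s in (0 : ℝ)..x, G s) : IsH1Rep 0 b F (contL hF) g := by
  refine ⟨coeFn_contL hF, fun x hx => ?_⟩
  rw [intervalIntegral_congr_Ioo hg ⟨le_rfl, hb⟩ hx]
  exact h x

theorem integrable_indicator_L2 {a b : ℝ} (f : L2 a b) :
    Integrable ((Ioo a b).indicator f) :=
  (integrable_indicator_iff measurableSet_Ioo).2 (L2.integrable f)

theorem ae_indicator_L2 {a b : ℝ} (f : L2 a b) :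
    ∀ᵐ x ∂(volume.restrict (Ioo a b)), (Ioo a b).indicator f x = f x := by
  filter_upwards [ae_restrict_mem measurableSet_Ioo] with x hx
  exact indicator_of_mem hx _

/-- Solvability of `u''' = μ (u - f)`, `u p = 0`, `u' p = c`, `u q = 0`. -/
theorem exists_third_order_bvp {L μ p q : ℝ} (hL : 0 < L)
    (hpq : p = 0 ∧ q = L ∧ 0 < μ ∨ p = L ∧ q = 0 ∧ μ < 0) (f : L2 0 L) (c : ℝ) :
    ∃ u : L2 0 L, MemH3 u ∧ wderiv (wderiv (wderiv u)) = μ • (u - f) ∧ contRep u p = 0 ∧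
      contRep u q = 0 ∧ contRep (wderiv u) p = c := by
  set F : ℝ → ℝ := fun x => -μ * (Ioo 0 L).indicator f x with hFdef
  have hF : Integrable F := (integrable_indicator_L2 f).const_mul (-μ)
  obtain ⟨a₀, a₁, a₂, ha₀, ha₁, ha₂, ea₀, ea₁, ea₂⟩ := exists_third_order μ p 0 c 0 hF
  obtain ⟨b₀, b₁, b₂, hb₀, hb₁, hb₂, eb₀, eb₁, eb₂⟩ :=
    exists_third_order μ p 0 0 1 (F := fun _ => 0) (integrable_zero ℝ ℝ volume)
  have hne := shooting_ne_zero hL hpq hb₀ hb₁ hb₂ eb₀ eb₁ eb₂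
  -- the multiple of the homogeneous solution that corrects the value at `q`
  set d : ℝ := -(a₀ q) / b₀ q with hd
  have hy₀ : Continuous fun x => a₀ x + d * b₀ x := by fun_prop
  have hy₁ : Continuous fun x => a₁ x + d * b₁ x := by fun_prop
  have hy₂ : Continuous fun x => a₂ x + d * b₂ x := by fun_prop
  have ci : ∀ {w : ℝ → ℝ}, Continuous w → ∀ s t, IntervalIntegrable w volume s t :=
    fun hw s t => hw.intervalIntegrable s t
  have i₃ : ∀ s t, IntervalIntegrable (fun x => μ * a₀ x + F x) volume s t := fun s t =>
    (ci (continuous_const.mul ha₀) s t).add hF.intervalIntegrable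
  have i₃' : ∀ s t, IntervalIntegrable (fun x => μ * b₀ x + 0) volume s t := fun s t =>
    ci (by fun_prop) s t
  have lin : ∀ {A A' B B' : ℝ → ℝ} {e e' : ℝ}, (∀ s t, IntervalIntegrable A' volume s t) →
      (∀ s t, IntervalIntegrable B' volume s t) → (∀ x, A x = e + ∫ s in p..x, A' s) →
      (∀ x, B x = e' + ∫ s in p..x, B' s) → ∀ x, (fun x => A x + d * B x) x =
        (fun x => A x + d * B x) 0 + ∫ s in (0 : ℝ)..x, (A' s + d * B' s) := by
    intro A A' B B' e e' hA' hB' hA hB x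
    rw [intervalIntegral.integral_add (hA' _ _) ((hB' _ _).const_mul d),
      intervalIntegral.integral_const_mul]
    have h1 := eq_add_integral_of_base hA' hA x
    have h2 := eq_add_integral_of_base hB' hB x
    simp only
    rw [h1, h2]; ring
  set u : L2 0 L := contL hy₀ with hu
  have r₀ : IsH1Rep 0 L _ u (contL hy₁) := isH1Rep_contL hL.le hy₀ (coeFn_contL hy₁)
    (lin (ci ha₁) (ci hb₁) ea₀ eb₀)
  have r₁ : IsH1Rep 0 L _ (contL hy₁ : L2 0 L) (contL hy₂) :=
    isH1Rep_contL hL.le hy₁ (coeFn_contL hy₂) (lin (ci ha₂) (ci hb₂) ea₁ eb₁)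
  have r₂ : IsH1Rep 0 L (fun x => a₂ x + d * b₂ x) (contL hy₂ : L2 0 L) (μ • (u - f)) := by
    refine isH1Rep_contL hL.le hy₂ ?_ (lin i₃ i₃' ea₂ eb₂)
    filter_upwards [Lp.coeFn_smul μ (u - f), Lp.coeFn_sub u f, coeFn_contL (a := 0) (b := L) hy₀,
      ae_indicator_L2 f] with x h1 h2 h3 h4
    rw [h1, Pi.smul_apply, h2, Pi.sub_apply, h3, smul_eq_mul]
    simp only [hFdef, h4]
    ring
  have w₀ := r₀.wderiv_eq hL
  have w₁ := r₁.wderiv_eq hL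
  have w₂ := r₂.wderiv_eq hL
  have hpm : p ∈ Icc 0 L := by
    rcases hpq with ⟨h, _⟩ | ⟨h, _⟩ <;> rw [h]
    exacts [⟨le_rfl, hL.le⟩, ⟨hL.le, le_rfl⟩]
  have hqm : q ∈ Icc 0 L := by
    rcases hpq with ⟨_, h, _⟩ | ⟨_, h, _⟩ <;> rw [h]
    exacts [⟨hL.le, le_rfl⟩, ⟨le_rfl, hL.le⟩]
  refine ⟨u, ⟨r₀.memH1, ?_, ?_⟩, ?_, ?_, ?_, ?_⟩
  · rw [w₀]; exact r₁.memH1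
  · rw [w₀, w₁]; exact r₂.memH1
  · rw [w₀, w₁, w₂]
  · rw [r₀.contRep_eq hL hpm]; simp [ea₀ p, eb₀ p]
  · rw [r₀.contRep_eq hL hqm]; simp only [hd]; field_simp; ring
  · rw [w₀, r₁.contRep_eq hL hpm]; simp [ea₁ p, eb₁ p]

/-- Solvability of the transport equation `z' = h (k - z)`, `z 0 = c`. -/
theorem exists_transport (h c : ℝ) (k : L2 0 1) :
    ∃ z : L2 0 1, MemH1 z ∧ wderiv z = h • (k - z) ∧ contRep z 0 = c := by
  obtain ⟨y, hy, hy'⟩ := exists_bounded_ode ((-h) • ContinuousLinearMap.id ℝ ℝ) 0 c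
    ((integrable_indicator_L2 k).const_mul h)
  have i1 := fun x => hy.intervalIntegrable (μ := volume) 0 x
  have i2 := fun x => ((integrable_indicator_L2 k).const_mul h).intervalIntegrable (a := 0) (b := x)
  have hy0 : y 0 = c := by simpa using hy' 0
  have hp : ∀ x, y x = y 0
      + ∫ s in (0 : ℝ)..x, (-h * y s + h * (Ioo (0 : ℝ) 1).indicator k s) := by
    intro x
    rw [intervalIntegral.integral_add ((i1 x).const_mul _) (i2 x),
      intervalIntegral.integral_const_mul, hy0, hy' x, ← add_assoc]
    simp
  have r : IsH1Rep 0 1 y (contL hy) (h • (k - contL hy)) := by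
    refine isH1Rep_contL zero_le_one hy ?_ hp
    filter_upwards [Lp.coeFn_smul h (k - contL hy), Lp.coeFn_sub k (contL hy),
      coeFn_contL (a := 0) (b := 1) hy, ae_indicator_L2 k] with x h1 h2 h3 h4
    rw [h1, Pi.smul_apply, h2, Pi.sub_apply, h3, smul_eq_mul, h4]
    ring
  exact ⟨contL hy, r.memH1, r.wderiv_eq one_pos,
    (r.contRep_eq one_pos ⟨le_rfl, zero_le_one⟩).trans hy0⟩

end ThirdOrder

/-! ### Multiplier identities -/

section Weights

/-- Multiplication by the affine weight `c + d x`. -/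
def wOp {L : ℝ} (hL : 0 ≤ L) (c d : ℝ) : L2 0 L →L[ℝ] L2 0 L :=
  c • ContinuousLinearMap.id ℝ _ + d • mulL (primInf hL (oneL 0 L))

theorem coeFn_wOp {L : ℝ} (hL : 0 ≤ L) (c d : ℝ) (f : L2 0 L) :
    ∀ᵐ x ∂(volume.restrict (Ioo 0 L)), wOp hL c d f x = (c + d * x) * f x := by
  change ∀ᵐ x ∂(volume.restrict (Ioo 0 L)),
    (c • f + d • mulL (primInf hL (oneL 0 L)) f : L2 0 L) x = _
  filter_upwards [Lp.coeFn_add (c • f) (d • mulL (primInf hL (oneL 0 L)) f), Lp.coeFn_smul c f,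
    Lp.coeFn_smul d (mulL (primInf hL (oneL 0 L)) f), coeFn_mulL (primInf hL (oneL 0 L)) f,
    coeFn_primInf hL (oneL 0 L), ae_restrict_mem measurableSet_Ioo] with x h1 h2 h3 h4 h5 h6
  have e : ∫ y in (0 : ℝ)..x, oneL 0 L y = x := by
    rw [intervalIntegral_congr_Ioo coeFn_oneL ⟨le_rfl, hL⟩ (Ioo_subset_Icc_self h6)]
    simp
  rw [h1, Pi.add_apply, h2, h3, Pi.smul_apply, Pi.smul_apply, h4, h5, e, smul_eq_mul, smul_eq_mul]
  ring

theorem inner_wOp {L : ℝ} (hL : 0 ≤ L) (c d : ℝ) (f g : L2 0 L) :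
    ⟪wOp hL c d f, g⟫ = ∫ x in Ioo 0 L, (c + d * x) * f x * g x := by
  rw [L2.inner_def]
  refine integral_congr_ae ?_
  filter_upwards [coeFn_wOp hL c d f] with x hx
  rw [hx]; simp [mul_comm]

theorem inner_wOp_comm {L : ℝ} (hL : 0 ≤ L) (c d : ℝ) (f g : L2 0 L) :
    ⟪wOp hL c d f, g⟫ = ⟪wOp hL c d g, f⟫ := by
  rw [inner_wOp, inner_wOp]
  congr 1; ext x; ring

theorem inner_wOp_self_nonneg {L : ℝ} (hL : 0 ≤ L) {c d : ℝ}
    (h : ∀ x ∈ Ioo 0 L, 0 ≤ c + d * x) (f : L2 0 L) : 0 ≤ ⟪wOp hL c d f, f⟫ := by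
  rw [inner_wOp]
  refine setIntegral_nonneg measurableSet_Ioo fun x hx => ?_
  rw [mul_assoc]
  exact mul_nonneg (h x hx) (mul_self_nonneg _)

theorem setIntegral_Ioo_eq {a b : ℝ} (hab : a ≤ b) (f : ℝ → ℝ) :
    ∫ x in Ioo a b, f x = ∫ x in a..b, f x := by
  rw [intervalIntegral.integral_of_le hab, integral_Ioc_eq_integral_Ioo]

theorem MemH1.eq_primitive {L : ℝ} (hL : 0 ≤ L) {f : L2 0 L} (hf : MemH1 f) {G : ℝ → ℝ}
    (hG : ∀ᵐ x ∂(volume.restrict (Ioo 0 L)), wderiv f x = G x) :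
    ∀ x ∈ Icc 0 L, contRep f x = contRep f 0 + ∫ s in (0 : ℝ)..x, G s := fun x hx => by
  rw [← intervalIntegral_congr_Ioo hG ⟨le_rfl, hL⟩ hx]
  exact hf.isH1Rep.2 x hx

/-- The multiplier identity for the third derivative: for `d > 0` it yields a positive multiple of
`‖uₓ‖²`. -/
theorem inner_wOp_third {L : ℝ} (hL : 0 < L) (c d : ℝ) {u : L2 0 L} (hu : MemH3 u)
    (hl : contRep u 0 = 0) (hr : contRep u L = 0) :
    ⟪wOp hL.le c d (wderiv (wderiv (wderiv u))), u⟫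
      = -(1 / 2) * ((c + d * L) * contRep (wderiv u) L ^ 2 - c * contRep (wderiv u) 0 ^ 2)
        + 3 / 2 * d * ‖wderiv u‖ ^ 2 := by
  have key := integral_affine_mul_third hL.le c d (hu.2.1.isH1Rep.continuousOn hL.le)
    (hu.2.2.isH1Rep.continuousOn hL.le) (L2.intervalIntegrable hL.le _)
    (hu.1.eq_primitive hL.le hu.2.1.isH1Rep.1) (hu.2.1.eq_primitive hL.le hu.2.2.isH1Rep.1)
    (hu.2.2.eq_primitive hL.le (Eventually.of_forall fun _ => rfl)) hl hr
  rw [inner_wOp_comm, inner_wOp, norm_Lp_sq]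
  have e1 : ∫ x in Ioo 0 L, (c + d * x) * u x * wderiv (wderiv (wderiv u)) x
      = ∫ x in (0 : ℝ)..L, (c + d * x) * contRep u x * wderiv (wderiv (wderiv u)) x := by
    rw [← setIntegral_Ioo_eq hL.le]
    refine integral_congr_ae ?_
    filter_upwards [hu.1.isH1Rep.1] with x hx
    rw [hx]
  have e2 : ∫ x in Ioo 0 L, ‖wderiv u x‖ ^ 2 = ∫ x in (0 : ℝ)..L, contRep (wderiv u) x ^ 2 := by
    rw [← setIntegral_Ioo_eq hL.le]
    refine integral_congr_ae ?_
    filter_upwards [hu.2.1.isH1Rep.1] with x hx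
    rw [hx, Real.norm_eq_abs, sq_abs]
  rw [e1, e2, key]

theorem inner_wderiv_self {z : L2 0 1} (hz : MemH1 z) :
    ⟪wderiv z, z⟫ = 1 / 2 * (contRep z 1 ^ 2 - contRep z 0 ^ 2) := by
  have hc := hz.isH1Rep.continuousOn zero_le_one
  have i := L2.intervalIntegrable zero_le_one (wderiv z)
  have key := mul_primitive zero_le_one i i hz.isH1Rep.2 hz.isH1Rep.2 1 ⟨zero_le_one, le_rfl⟩
  have e1 : ⟪wderiv z, z⟫ = ∫ x in (0 : ℝ)..1, wderiv z x * contRep z x := by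
    rw [L2.inner_def, ← setIntegral_Ioo_eq zero_le_one]
    refine integral_congr_ae ?_
    filter_upwards [hz.isH1Rep.1] with x hx
    rw [hx]; simp [mul_comm]
  have e2 : ∫ x in (0 : ℝ)..1, (wderiv z x * contRep z x + contRep z x * wderiv z x)
      = 2 * ∫ x in (0 : ℝ)..1, wderiv z x * contRep z x := by
    rw [← intervalIntegral.integral_const_mul]
    congr 1; ext x; ring
  rw [e2] at key
  rw [e1]
  linarith

end Weights

/-! ### Dissipativity of the operator -/

section Operator
variable {L h α β : ℝ}

/-- The triple `(u, v, z)` as an element of `H`. -/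
def mkH (u v : L2 0 L) (z : L2 0 1) : H L := WithLp.toLp 2 (WithLp.toLp 2 (u, v), z)

variable (L) in
/-- Inclusion of a source `(f₁, f₂)` as `(f₁, f₂, 0)`. -/
def inclX : X0 L →L[ℝ] H L :=
  (WithLp.prodContinuousLinearEquiv 2 ℝ (X0 L) (L2 0 1)).symm.toContinuousLinearMap.comp
    (ContinuousLinearMap.inl ℝ (X0 L) (L2 0 1))

theorem inclX_apply (w : X0 L) : inclX L w = WithLp.toLp 2 (w, (0 : L2 0 1)) := rfl

variable (L) in
/-- The rescaling `(u, v, z) ↦ (u, v, s z)`; for `s = √(β h)` it turns the weighted norm of `H`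
into the Hilbert norm carried by the type. -/
def scaleZ (s : ℝ) : H L →L[ℝ] H L :=
  (WithLp.prodContinuousLinearEquiv 2 ℝ (X0 L) (L2 0 1)).symm.toContinuousLinearMap.comp
    ((WithLp.fstL 2 ℝ (X0 L) (L2 0 1)).prod (s • WithLp.sndL 2 ℝ (X0 L) (L2 0 1)))

@[simp] theorem scaleZ_fst (s : ℝ) (U : H L) : (scaleZ L s U).fst = U.fst := rfl
@[simp] theorem scaleZ_snd (s : ℝ) (U : H L) : (scaleZ L s U).snd = s • U.snd := rfl

theorem H_ext {U V : H L} (h1 : U.fst.fst = V.fst.fst) (h2 : U.fst.snd = V.fst.snd)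
    (h3 : U.snd = V.snd) : U = V :=
  WithLp.ofLp_injective 2 (Prod.ext (WithLp.ofLp_injective 2 (Prod.ext h1 h2)) h3)

theorem scaleZ_scaleZ {s t : ℝ} (hst : s * t = 1) (U : H L) : scaleZ L s (scaleZ L t U) = U := by
  refine H_ext rfl rfl ?_
  rw [scaleZ_snd, scaleZ_snd, smul_smul, hst, one_smul]

theorem scaleZ_inclX (s : ℝ) (w : X0 L) : scaleZ L s (inclX L w) = inclX L w :=
  H_ext rfl rfl (by rw [scaleZ_snd]; exact smul_zero s)

theorem norm_scaleZ (hβh : 0 ≤ β * h) (U : H L) :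
    ‖scaleZ L (√(β * h)) U‖ = hNorm h β U := by
  rw [WithLp.prod_norm_eq_of_L2, hNorm, scaleZ_fst, scaleZ_snd, norm_smul, mul_pow,
    Real.norm_of_nonneg (Real.sqrt_nonneg _), Real.sq_sqrt hβh]

/-- Both spatial derivatives of a pair. -/
def xderiv (w : X0 L) : X0 L := WithLp.toLp 2 (wderiv w.fst, wderiv w.snd)

theorem domA_add (hL : 0 < L) {U V : H L} (hU : U ∈ domA L α β) (hV : V ∈ domA L α β) :
    U + V ∈ domA L α β := by
  have m0 : (0 : ℝ) ∈ Icc 0 L := ⟨le_rfl, hL.le⟩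
  have mL : L ∈ Icc 0 L := ⟨hL.le, le_rfl⟩
  have n0 : (0 : ℝ) ∈ Icc (0 : ℝ) 1 := ⟨le_rfl, zero_le_one⟩
  have n1 : (1 : ℝ) ∈ Icc (0 : ℝ) 1 := ⟨zero_le_one, le_rfl⟩
  change MemDom L α β (U.fst.fst + V.fst.fst) (U.fst.snd + V.fst.snd) (U.snd + V.snd)
  refine ⟨hU.u_H3.add hL hV.u_H3, hU.v_H3.add hL hV.v_H3, hU.z_H1.add zero_le_one hV.z_H1,
    ?_, ?_, ?_, ?_, ?_, ?_, ?_⟩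
  · rw [contRep_add hL hU.u_H3.1 hV.u_H3.1 m0, hU.u_left, hV.u_left, add_zero]
  · rw [contRep_add hL hU.u_H3.1 hV.u_H3.1 mL, hU.u_right, hV.u_right, add_zero]
  · rw [contRep_add hL hU.v_H3.1 hV.v_H3.1 m0, hU.v_left, hV.v_left, add_zero]
  · rw [contRep_add hL hU.v_H3.1 hV.v_H3.1 mL, hU.v_right, hV.v_right, add_zero]
  · rw [wderiv_add hL hU.u_H3.1 hV.u_H3.1, contRep_add hL hU.u_H3.2.1 hV.u_H3.2.1 m0,
      hU.ux_left, hV.ux_left, add_zero]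
  · rw [wderiv_add hL hU.u_H3.1 hV.u_H3.1, contRep_add hL hU.u_H3.2.1 hV.u_H3.2.1 mL,
      contRep_add one_pos hU.z_H1 hV.z_H1 n0, hU.z_left, hV.z_left]
  · rw [wderiv_add hL hU.u_H3.1 hV.u_H3.1, contRep_add hL hU.u_H3.2.1 hV.u_H3.2.1 mL,
      wderiv_add hL hU.v_H3.1 hV.v_H3.1, contRep_add hL hU.v_H3.2.1 hV.v_H3.2.1 mL,
      contRep_add one_pos hU.z_H1 hV.z_H1 n1, hU.vx_right, hV.vx_right]
    ring

theorem domA_smul (hL : 0 < L) (c : ℝ) {U : H L} (hU : U ∈ domA L α β) :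
    c • U ∈ domA L α β := by
  have m0 : (0 : ℝ) ∈ Icc 0 L := ⟨le_rfl, hL.le⟩
  have mL : L ∈ Icc 0 L := ⟨hL.le, le_rfl⟩
  have n0 : (0 : ℝ) ∈ Icc (0 : ℝ) 1 := ⟨le_rfl, zero_le_one⟩
  have n1 : (1 : ℝ) ∈ Icc (0 : ℝ) 1 := ⟨zero_le_one, le_rfl⟩
  change MemDom L α β (c • U.fst.fst) (c • U.fst.snd) (c • U.snd)
  refine ⟨hU.u_H3.smul hL c, hU.v_H3.smul hL c, hU.z_H1.smul zero_le_one c,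
    ?_, ?_, ?_, ?_, ?_, ?_, ?_⟩
  · rw [contRep_smul hL c hU.u_H3.1 m0, hU.u_left, mul_zero]
  · rw [contRep_smul hL c hU.u_H3.1 mL, hU.u_right, mul_zero]
  · rw [contRep_smul hL c hU.v_H3.1 m0, hU.v_left, mul_zero]
  · rw [contRep_smul hL c hU.v_H3.1 mL, hU.v_right, mul_zero]
  · rw [wderiv_smul hL c hU.u_H3.1, contRep_smul hL c hU.u_H3.2.1 m0, hU.ux_left, mul_zero]
  · rw [wderiv_smul hL c hU.u_H3.1, contRep_smul hL c hU.u_H3.2.1 mL,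
      contRep_smul one_pos c hU.z_H1 n0, hU.z_left]
  · rw [wderiv_smul hL c hU.u_H3.1, contRep_smul hL c hU.u_H3.2.1 mL,
      wderiv_smul hL c hU.v_H3.1, contRep_smul hL c hU.v_H3.2.1 mL,
      contRep_smul one_pos c hU.z_H1 n1, hU.vx_right]
    ring

theorem opA_add (hL : 0 < L) {U V : H L} (hU : U ∈ domA L α β) (hV : V ∈ domA L α β) :
    opA L h (U + V) = opA L h U + opA L h V := by
  refine H_ext ?_ ?_ ?_
  · change (1 / 2 : ℝ) • wderiv (wderiv (wderiv (U.fst.fst + V.fst.fst)))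
      = (1 / 2 : ℝ) • wderiv (wderiv (wderiv U.fst.fst))
        + (1 / 2 : ℝ) • wderiv (wderiv (wderiv V.fst.fst))
    rw [wderiv3_add hL hU.u_H3 hV.u_H3, smul_add]
  · change -wderiv (wderiv (wderiv (U.fst.snd + V.fst.snd)))
      = -wderiv (wderiv (wderiv U.fst.snd)) + -wderiv (wderiv (wderiv V.fst.snd))
    rw [wderiv3_add hL hU.v_H3 hV.v_H3, neg_add]
  · change -((1 / h) • wderiv (U.snd + V.snd))
      = -((1 / h) • wderiv U.snd) + -((1 / h) • wderiv V.snd)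
    rw [wderiv_add one_pos hU.z_H1 hV.z_H1, smul_add, neg_add]

theorem opA_smul (hL : 0 < L) (c : ℝ) {U : H L} (hU : U ∈ domA L α β) :
    opA L h (c • U) = c • opA L h U := by
  refine H_ext ?_ ?_ ?_
  · change (1 / 2 : ℝ) • wderiv (wderiv (wderiv (c • U.fst.fst)))
      = c • ((1 / 2 : ℝ) • wderiv (wderiv (wderiv U.fst.fst)))
    rw [wderiv3_smul hL c hU.u_H3, smul_comm]
  · change -wderiv (wderiv (wderiv (c • U.fst.snd))) = c • -wderiv (wderiv (wderiv U.fst.snd))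
    rw [wderiv3_smul hL c hU.v_H3, smul_neg]
  · change -((1 / h) • wderiv (c • U.snd)) = c • -((1 / h) • wderiv U.snd)
    rw [wderiv_smul one_pos c hU.z_H1, smul_neg, smul_comm]

/-- The symmetric form on `H` (after rescaling of `z`) with weights `M + lam (L - x)` on `u`,
`M + lam x` on `v` and `M` on `z`. -/
def wForm (hL : 0 ≤ L) (lam M : ℝ) : H L →L[ℝ] H L →L[ℝ] ℝ :=
  (innerForm (L2 0 L)).bilinearComp
      ((wOp hL (M + lam * L) (-lam)).comp ((WithLp.fstL 2 ℝ _ _).comp (WithLp.fstL 2 ℝ _ _)))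
      ((WithLp.fstL 2 ℝ _ _).comp (WithLp.fstL 2 ℝ _ _))
    + (innerForm (L2 0 L)).bilinearComp
      ((wOp hL M lam).comp ((WithLp.sndL 2 ℝ _ _).comp (WithLp.fstL 2 ℝ _ _)))
      ((WithLp.sndL 2 ℝ _ _).comp (WithLp.fstL 2 ℝ _ _))
    + M • (innerForm (L2 0 1)).bilinearComp (WithLp.sndL 2 ℝ _ _) (WithLp.sndL 2 ℝ _ _)

theorem wForm_apply (hL : 0 ≤ L) (lam M : ℝ) (U V : H L) :
    wForm hL lam M U V = ⟪wOp hL (M + lam * L) (-lam) U.fst.fst, V.fst.fst⟫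
      + ⟪wOp hL M lam U.fst.snd, V.fst.snd⟫ + M * ⟪U.snd, V.snd⟫ := rfl

theorem wForm_comm (hL : 0 ≤ L) (lam M : ℝ) (U V : H L) :
    wForm hL lam M U V = wForm hL lam M V U := by
  rw [wForm_apply, wForm_apply, inner_wOp_comm hL _ _ U.fst.fst, inner_wOp_comm hL _ _ U.fst.snd,
    real_inner_comm V.snd U.snd]

theorem wForm_self_nonneg (hL : 0 ≤ L) {lam M : ℝ} (hlam : 0 ≤ lam) (hM : 0 ≤ M) (U : H L) :
    0 ≤ wForm hL lam M U U := by
  rw [wForm_apply]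
  refine add_nonneg (add_nonneg (inner_wOp_self_nonneg hL (fun x hx => ?_) _)
    (inner_wOp_self_nonneg hL (fun x hx => ?_) _)) (mul_nonneg hM real_inner_self_nonneg)
  · nlinarith [hx.2, hx.1]
  · nlinarith [hx.2, hx.1]

theorem wOp_one_zero (hL : 0 ≤ L) (f : L2 0 L) (c d : ℝ) (hc : c = 1) (hd : d = 0) :
    wOp hL c d f = f := by
  subst hc hd
  change (1 : ℝ) • f + (0 : ℝ) • _ = f
  rw [one_smul, zero_smul, add_zero]

theorem wForm_zero_one (hL : 0 ≤ L) (U V : H L) : wForm hL 0 1 U V = ⟪U, V⟫ := by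
  rw [wForm_apply, wOp_one_zero hL _ _ _ (by ring) (by ring),
    wOp_one_zero hL _ _ _ rfl rfl, one_mul]
  rfl

/-- The dissipation inequality for the weighted forms: the boundary terms at `x = L` and `ρ = 1`
are absorbed thanks to the smallness of `α` and `β`, and for `lam > 0` the interior terms give the
Kato smoothing effect. -/
theorem wForm_opA_le (hL : 0 < L) (hh : 0 < h) (hβ : 0 < β) {lam M : ℝ} (hlam : 0 ≤ lam)
    (hM : 0 ≤ M) (h1 : lam * (L * α ^ 2) ≤ M * (1 / 4 - α ^ 2 - β / 2))
    (h2 : lam * (L * β ^ 2) ≤ M * (β / 2 - β ^ 2)) {X : H L} (hX : X ∈ domA L α β) :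
    wForm hL.le lam M (scaleZ L (√(β * h)) (opA L h X)) (scaleZ L (√(β * h)) X)
      ≤ -(3 / 4 * lam * ‖xderiv X.fst‖ ^ 2) := by
  have hs : √(β * h) * √(β * h) = β * h := Real.mul_self_sqrt (by positivity)
  have hu : ⟪wOp hL.le (M + lam * L) (-lam) ((1 / 2 : ℝ) • wderiv (wderiv (wderiv X.fst.fst))),
      X.fst.fst⟫ = 1 / 2 * (-(1 / 2) * (M * contRep (wderiv X.fst.fst) L ^ 2)
        - 3 / 2 * lam * ‖wderiv X.fst.fst‖ ^ 2) := by
    rw [map_smul, real_inner_smul_left, inner_wOp_third hL _ _ hX.u_H3 hX.u_left hX.u_right,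
      hX.ux_left]
    ring
  have hv : ⟪wOp hL.le M lam (-wderiv (wderiv (wderiv X.fst.snd))), X.fst.snd⟫
      = -(-(1 / 2) * ((M + lam * L) * contRep (wderiv X.fst.snd) L ^ 2
        - M * contRep (wderiv X.fst.snd) 0 ^ 2) + 3 / 2 * lam * ‖wderiv X.fst.snd‖ ^ 2) := by
    rw [map_neg, inner_neg_left, inner_wOp_third hL _ _ hX.v_H3 hX.v_left hX.v_right]
  have hz : ⟪√(β * h) • -((1 / h) • wderiv X.snd), √(β * h) • X.snd⟫
      = -(β / 2 * (contRep X.snd 1 ^ 2 - contRep (wderiv X.fst.fst) L ^ 2)) := by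
    rw [real_inner_smul_left, real_inner_smul_right, inner_neg_left, real_inner_smul_left,
      inner_wderiv_self hX.z_H1, hX.z_left, ← mul_assoc, hs]
    field_simp
  have hx : ‖xderiv X.fst‖ ^ 2 = ‖wderiv X.fst.fst‖ ^ 2 + ‖wderiv X.fst.snd‖ ^ 2 :=
    WithLp.prod_norm_sq_eq_of_L2 _
  have e : wForm hL.le lam M (scaleZ L (√(β * h)) (opA L h X)) (scaleZ L (√(β * h)) X)
    = ⟪wOp hL.le (M + lam * L) (-lam) ((1 / 2 : ℝ) • wderiv (wderiv (wderiv X.fst.fst))),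
      X.fst.fst⟫ + ⟪wOp hL.le M lam (-wderiv (wderiv (wderiv X.fst.snd))), X.fst.snd⟫
      + M * ⟪√(β * h) • -((1 / h) • wderiv X.snd), √(β * h) • X.snd⟫ := rfl
  rw [e, hu, hv, hz, hx, hX.vx_right]
  set a := contRep (wderiv X.fst.fst) L
  set b := contRep X.snd 1
  set v0 := contRep (wderiv X.fst.snd) 0
  set p := ‖wderiv X.fst.fst‖ ^ 2
  set q := ‖wderiv X.fst.snd‖ ^ 2
  have hq : 0 ≤ q := sq_nonneg _
  have k0 : (α * a + β * b) ^ 2 ≤ 2 * (α ^ 2 * a ^ 2) + 2 * (β ^ 2 * b ^ 2) := by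
    nlinarith [sq_nonneg (α * a - β * b)]
  have k1 : (M + lam * L) * (α * a + β * b) ^ 2
      ≤ (M + lam * L) * (2 * (α ^ 2 * a ^ 2) + 2 * (β ^ 2 * b ^ 2)) :=
    mul_le_mul_of_nonneg_left k0 (by positivity)
  have k2 := mul_le_mul_of_nonneg_right h1 (sq_nonneg a)
  have k3 := mul_le_mul_of_nonneg_right h2 (sq_nonneg b)
  have k4 : 0 ≤ M * v0 ^ 2 := by positivity
  have k5 : 0 ≤ lam * q := mul_nonneg hlam hq
  nlinarith

end Operator

/-! ### The resolvent -/

section ResolventConstruction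
variable {L h α β : ℝ}

theorem exists_sub_opA_eq (hL : 0 < L) (hh : 0 < h) (Y : H L) :
    ∃ X ∈ domA L α β, X - opA L h X = Y := by
  -- the boundary conditions are triangular: solve for `u`, then `z`, then `v`
  obtain ⟨u, hu, hu3, hu0, huL, hux⟩ := exists_third_order_bvp (μ := 2) (p := 0) (q := L) hL
    (Or.inl ⟨rfl, rfl, two_pos⟩) Y.fst.fst 0
  obtain ⟨z, hz, hzd, hz0⟩ := exists_transport h (contRep (wderiv u) L) Y.snd
  obtain ⟨v, hv, hv3, hvL, hv0, hvx⟩ := exists_third_order_bvp (μ := -1) (p := L) (q := 0) hL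
    (Or.inr ⟨rfl, rfl, by norm_num⟩) Y.fst.snd (α * contRep (wderiv u) L + β * contRep z 1)
  refine ⟨mkH u v z, ⟨hu, hv, hz, hu0, huL, hv0, hvL, hux, hz0, hvx⟩, H_ext ?_ ?_ ?_⟩
  · change u - (1 / 2 : ℝ) • wderiv (wderiv (wderiv u)) = Y.fst.fst
    rw [hu3, smul_smul]; norm_num
  · change v - -wderiv (wderiv (wderiv v)) = Y.fst.snd
    rw [hv3]; norm_num
  · change z - -((1 / h) • wderiv z) = Y.snd
    rw [hzd, smul_smul, one_div, inv_mul_cancel₀ hh.ne']; simp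

/-- `R` is the resolvent of `A`, read in the coordinates of `scaleZ`; `S` is the spatial derivative
composed with it; and `b` is a positive form along which the dissipation of `A` controls the
spatial derivatives. -/
structure IsHSResolvent (L h α β : ℝ) (R : H L →L[ℝ] H L) (S : H L →L[ℝ] X0 L)
    (b : H L →L[ℝ] H L →L[ℝ] ℝ) (c : ℝ) : Prop where
  diss : IsDissipativeResolvent R
  iff : ∀ V Y : H L, (V ∈ domA L α β ∧ opA L h V = Y) ↔
    scaleZ L (√(β * h)) V = R (scaleZ L (√(β * h)) V - scaleZ L (√(β * h)) Y)
  deriv : ∀ y, ∃ X ∈ domA L α β, R y = scaleZ L (√(β * h)) X ∧ S y = xderiv X.fst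
  pos : 0 < c
  symm : ∀ y z, b y z = b z y
  nonneg : ∀ y, 0 ≤ b y y
  le : ∀ y, b (R y - y) (R y) ≤ -(c * ‖S y‖ ^ 2)

theorem xderiv_add_of_mem (hL : 0 < L) {U V : H L} (hU : U ∈ domA L α β) (hV : V ∈ domA L α β) :
    xderiv (U + V).fst = xderiv U.fst + xderiv V.fst :=
  WithLp.ofLp_injective 2
    (Prod.ext (wderiv_add hL hU.u_H3.1 hV.u_H3.1) (wderiv_add hL hU.v_H3.1 hV.v_H3.1))

theorem xderiv_smul_of_mem (hL : 0 < L) (k : ℝ) {U : H L} (hU : U ∈ domA L α β) :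
    xderiv (k • U).fst = k • xderiv U.fst :=
  WithLp.ofLp_injective 2
    (Prod.ext (wderiv_smul hL k hU.u_H3.1) (wderiv_smul hL k hU.v_H3.1))

theorem inner_opA_nonpos (hL : 0 < L) (hh : 0 < h) (hβ : 0 < β)
    (hcond : 2 * α ^ 2 + 3 / 2 * β < 1 / 2) {X : H L} (hX : X ∈ domA L α β) :
    ⟪scaleZ L (√(β * h)) (opA L h X), scaleZ L (√(β * h)) X⟫ ≤ 0 := by
  have h1 : β < 1 / 3 := by nlinarith [sq_nonneg α]
  have := wForm_opA_le (lam := 0) (M := 1) hL hh hβ le_rfl zero_le_one (by linarith)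
    (by nlinarith) hX
  rwa [wForm_zero_one, mul_zero, zero_mul, neg_zero] at this

/-- The inverse of `1 - A`, as a linear map. -/
theorem exists_linear_resolvent (hL : 0 < L) (hh : 0 < h) (hβ : 0 < β)
    (hcond : 2 * α ^ 2 + 3 / 2 * β < 1 / 2) :
    ∃ R₀ : H L →ₗ[ℝ] H L, (∀ Y, R₀ Y ∈ domA L α β) ∧ (∀ Y, R₀ Y - opA L h (R₀ Y) = Y) ∧
      ∀ X ∈ domA L α β, R₀ (X - opA L h X) = X := by
  have hs0 : 0 < √(β * h) := Real.sqrt_pos.2 (by positivity)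
  have hinj : ∀ X ∈ domA L α β, X - opA L h X = 0 → X = 0 := by
    intro X hX h0
    have h1 := inner_opA_nonpos hL hh hβ hcond hX
    rw [← sub_eq_zero.1 h0, real_inner_self_eq_norm_sq] at h1
    have h2 : scaleZ L (√(β * h)) X = 0 := by
      have : ‖scaleZ L (√(β * h)) X‖ = 0 := by nlinarith [norm_nonneg (scaleZ L (√(β * h)) X)]
      exact norm_eq_zero.1 this
    rw [← scaleZ_scaleZ (inv_mul_cancel₀ hs0.ne') X, h2, map_zero]
  choose R₀ hR₀d hR₀ using fun Y : H L => exists_sub_opA_eq (α := α) (β := β) (h := h) hL hh Y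
  have huniq : ∀ X ∈ domA L α β, R₀ (X - opA L h X) = X := by
    intro X hX
    set X' := R₀ (X - opA L h X) with hX'
    have hd := hR₀d (X - opA L h X)
    have he := hR₀ (X - opA L h X)
    have hm := domA_smul hL (-1) hX
    have h1 := hinj (X' + (-1 : ℝ) • X) (domA_add hL hd hm) (by
      rw [opA_add hL hd hm, opA_smul hL _ hX]
      rw [← hX'] at he
      calc _ = (X' - opA L h X') - (X - opA L h X) := by rw [neg_one_smul, neg_one_smul]; abel
        _ = 0 := by rw [he, sub_self])
    rw [neg_one_smul, ← sub_eq_add_neg] at h1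
    exact sub_eq_zero.1 h1
  refine ⟨⟨⟨R₀, fun Y Y' => ?_⟩, fun k Y => ?_⟩, hR₀d, hR₀, huniq⟩
  · have h1 := huniq _ (domA_add hL (hR₀d Y) (hR₀d Y'))
    rw [opA_add hL (hR₀d Y) (hR₀d Y'), add_sub_add_comm, hR₀, hR₀] at h1
    exact h1
  · have h1 := huniq _ (domA_smul hL k (hR₀d Y))
    rw [opA_smul hL k (hR₀d Y), ← smul_sub, hR₀] at h1
    exact h1

theorem exists_isHSResolvent (hL : 0 < L) (hh : 0 < h) (hβ : 0 < β)
    (hcond : 2 * α ^ 2 + 3 / 2 * β < 1 / 2) :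
    ∃ R S b c, IsHSResolvent L h α β R S b c := by
  obtain ⟨R₀, hR₀d, hR₀, huniq⟩ := exists_linear_resolvent (α := α) hL hh hβ hcond
  have hdiss := fun X (hX : X ∈ domA L α β) => inner_opA_nonpos hL hh hβ hcond hX
  obtain ⟨s, hs⟩ : ∃ s, s = √(β * h) := ⟨_, rfl⟩
  have hs0 : 0 < s := by rw [hs]; exact Real.sqrt_pos.2 (by positivity)
  have hss : s⁻¹ * s = 1 := inv_mul_cancel₀ hs0.ne'
  have hss' : s * s⁻¹ = 1 := mul_inv_cancel₀ hs0.ne'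
  have hk1 : 0 < 1 / 4 - α ^ 2 - β / 2 := by nlinarith
  have hk2 : 0 < β / 2 - β ^ 2 := by
    have : β < 1 / 3 := by nlinarith [sq_nonneg α]
    nlinarith
  -- the total mass `M` is chosen so large that the boundary terms created by the weights `L - x`
  -- and `x` are absorbed by the strict dissipation at the boundary
  obtain ⟨M, hM0, hMa, hMb⟩ : ∃ M : ℝ, 0 ≤ M ∧
      1 * (L * α ^ 2) ≤ M * (1 / 4 - α ^ 2 - β / 2) ∧ 1 * (L * β ^ 2) ≤ M * (β / 2 - β ^ 2) := by
    have hM1 : 0 ≤ L * α ^ 2 / (1 / 4 - α ^ 2 - β / 2) := by positivity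
    have hM2 : 0 ≤ L * β ^ 2 / (β / 2 - β ^ 2) := by positivity
    refine ⟨L * α ^ 2 / (1 / 4 - α ^ 2 - β / 2) + L * β ^ 2 / (β / 2 - β ^ 2),
      add_nonneg hM1 hM2, ?_, ?_⟩
    · rw [add_mul, div_mul_cancel₀ _ hk1.ne', one_mul]
      have := mul_nonneg hM2 hk1.le; linarith
    · rw [add_mul, div_mul_cancel₀ (L * β ^ 2) hk2.ne', one_mul]
      have := mul_nonneg hM1 hk2.le; linarith
  obtain ⟨b, hb⟩ : ∃ b, b = wForm hL.le 1 M := ⟨_, rfl⟩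
  have hbdiss : ∀ X ∈ domA L α β, b (scaleZ L s (opA L h X)) (scaleZ L s X)
      ≤ -(3 / 4 * ‖xderiv X.fst‖ ^ 2) := by
    intro X hX
    have := wForm_opA_le (lam := 1) hL hh hβ zero_le_one hM0 hMa hMb hX
    rw [mul_one] at this
    rw [hs, hb]
    exact this
  rw [← hs] at hdiss
  obtain ⟨Rl, hRl⟩ : ∃ Rl : H L →ₗ[ℝ] H L, ∀ y, Rl y = scaleZ L s (R₀ (scaleZ L s⁻¹ y)) :=
    ⟨(scaleZ L s).toLinearMap.comp (R₀.comp (scaleZ L s⁻¹).toLinearMap), fun _ => rfl⟩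
  have hRy : ∀ y, Rl y - y = scaleZ L s (opA L h (R₀ (scaleZ L s⁻¹ y))) := by
    intro y
    have h1 := congrArg (scaleZ L s) (hR₀ (scaleZ L s⁻¹ y))
    rw [scaleZ_scaleZ hss', map_sub, ← hRl] at h1
    exact (eq_sub_of_add_eq' (sub_eq_iff_eq_add.1 h1).symm).symm
  have hfirm : ∀ y, ‖Rl y‖ ^ 2 ≤ ⟪Rl y, y⟫ := by
    intro y
    have h2 := hdiss _ (hR₀d (scaleZ L s⁻¹ y))
    rw [← hRy, ← hRl, inner_sub_left, real_inner_self_eq_norm_sq, real_inner_comm] at h2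
    linarith
  have hbound : ∀ y, ‖Rl y‖ ≤ 1 * ‖y‖ := by
    intro y
    have h1 := (hfirm y).trans (real_inner_le_norm _ _)
    by_contra! h2
    nlinarith [norm_nonneg y, norm_nonneg (Rl y)]
  obtain ⟨R, hR⟩ : ∃ R : H L →L[ℝ] H L, ∀ y, R y = Rl y :=
    ⟨Rl.mkContinuous 1 hbound, fun _ => rfl⟩
  obtain ⟨Sl, hSl⟩ : ∃ Sl : H L →ₗ[ℝ] X0 L, ∀ y, Sl y = xderiv (R₀ (scaleZ L s⁻¹ y)).fst := by
    refine ⟨⟨⟨fun y => xderiv (R₀ (scaleZ L s⁻¹ y)).fst, fun y y' => ?_⟩, fun k y => ?_⟩,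
      fun _ => rfl⟩
    · rw [map_add, map_add]; exact xderiv_add_of_mem hL (hR₀d _) (hR₀d _)
    · simp only [map_smul]; exact xderiv_smul_of_mem hL k (hR₀d _)
  have hSle : ∀ y, b (R y - y) (R y) ≤ -(3 / 4 * ‖Sl y‖ ^ 2) := by
    intro y
    rw [hR, hRy, hRl, hSl]
    exact hbdiss _ (hR₀d _)
  have hSb : ∀ y, ‖Sl y‖ ≤ √(8 / 3 * ‖b‖) * ‖y‖ := by
    intro y
    have h1 := hSle y
    have h2 := b.le_opNorm₂ (R y - y) (R y)
    have h4 : ‖R y‖ ≤ ‖y‖ := by rw [hR]; simpa using hbound y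
    have h3 : ‖R y - y‖ ≤ 2 * ‖y‖ := by
      have := norm_sub_le (R y) y
      linarith
    have h5 : ‖b‖ * ‖R y - y‖ * ‖R y‖ ≤ ‖b‖ * (2 * ‖y‖) * ‖y‖ := by gcongr
    have h6 := neg_abs_le (b (R y - y) (R y))
    rw [← Real.norm_eq_abs] at h6
    refine (pow_le_pow_iff_left₀ (norm_nonneg _) (by positivity) two_ne_zero).1 ?_
    rw [mul_pow, Real.sq_sqrt (by positivity)]
    nlinarith
  refine ⟨R, Sl.mkContinuous _ hSb, b, 3 / 4, ⟨⟨fun y => by rw [hR]; exact hfirm y, ?_⟩, ?_,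
    fun y => ⟨_, hR₀d (scaleZ L s⁻¹ y), ?_, hSl y⟩, by norm_num, ?_, ?_, hSle⟩⟩
  · intro y y' hyy
    have h1 := congrArg (scaleZ L s⁻¹) hyy
    rw [hR, hR, hRl, hRl, scaleZ_scaleZ hss, scaleZ_scaleZ hss] at h1
    have h2 := hR₀ (scaleZ L s⁻¹ y)
    rw [h1, hR₀] at h2
    rw [← scaleZ_scaleZ hss' y, ← h2, scaleZ_scaleZ hss']
  · intro V Y
    rw [hR, hRl, ← map_sub, ← hs, scaleZ_scaleZ hss]
    constructor
    · rintro ⟨hV, rfl⟩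
      rw [huniq V hV]
    · intro he
      have h1 := congrArg (scaleZ L s⁻¹) he
      rw [scaleZ_scaleZ hss, scaleZ_scaleZ hss] at h1
      have h2 := hR₀d (V - Y)
      have h3 := hR₀ (V - Y)
      rw [← h1] at h2 h3
      exact ⟨h2, sub_right_injective h3⟩
  · rw [hR, hRl, hs]
  · rw [hb]; exact wForm_comm hL.le 1 M
  · rw [hb]; exact wForm_self_nonneg hL.le zero_le_one hM0

end ResolventConstruction

/-! ### The nonlinearity -/

section Nonlinearity
variable {L : ℝ}

theorem toL2_eq {a b : ℝ} {g : ℝ → ℝ} (k : L2 a b)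
    (h : ∀ᵐ x ∂(volume.restrict (Ioo a b)), k x = g x) : toL2 a b g = k := by
  have hg : MemLp g 2 (volume.restrict (Ioo a b)) := (memLp_congr_ae h).1 (Lp.memLp k)
  unfold toL2
  rw [dif_pos hg]
  refine Lp.ext ?_
  filter_upwards [hg.coeFn_toLp, h] with x h1 h2
  rw [h1, h2]

/-- The nonlinearity as a bounded bilinear map of pairs `(w, wₓ)`. -/
def nl (hL : 0 ≤ L) : X0 L × X0 L →L[ℝ] X0 L × X0 L →L[ℝ] X0 L :=
  let pu := WithLp.fstL 2 ℝ (L2 0 L) (L2 0 L)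
  let pv := WithLp.sndL 2 ℝ (L2 0 L) (L2 0 L)
  let f := ContinuousLinearMap.fst ℝ (X0 L) (X0 L)
  let g := ContinuousLinearMap.snd ℝ (X0 L) (X0 L)
  let J := (WithLp.prodContinuousLinearEquiv 2 ℝ (L2 0 L) (L2 0 L)).symm.toContinuousLinearMap
  let mu := (mulH1 hL).bilinearComp ((pu.comp f).prod (pu.comp g)) (pu.comp g)
  let mv := (mulH1 hL).bilinearComp ((pv.comp f).prod (pv.comp g)) (pv.comp g)
  let muv := (mulH1 hL).bilinearComp ((pu.comp f).prod (pu.comp g)) (pv.comp g)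
  (ContinuousLinearMap.compL ℝ _ _ _ (J.comp (ContinuousLinearMap.inl ℝ _ _))).comp
      ((3 : ℝ) • mu + (3 : ℝ) • mv)
    + (ContinuousLinearMap.compL ℝ _ _ _ (J.comp (ContinuousLinearMap.inr ℝ _ _))).comp
      ((-3 : ℝ) • muv)

theorem nl_fst (hL : 0 ≤ L) (p q : X0 L × X0 L) : (nl hL p q).fst
    = (3 : ℝ) • mulH1 hL (p.1.fst, p.2.fst) q.2.fst
      + (3 : ℝ) • mulH1 hL (p.1.snd, p.2.snd) q.2.snd :=
  add_zero ((3 : ℝ) • mulH1 hL (p.1.fst, p.2.fst) q.2.fst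
      + (3 : ℝ) • mulH1 hL (p.1.snd, p.2.snd) q.2.snd)

theorem nl_snd (hL : 0 ≤ L) (p q : X0 L × X0 L) : (nl hL p q).snd
    = (-3 : ℝ) • mulH1 hL (p.1.fst, p.2.fst) q.2.snd :=
  zero_add ((-3 : ℝ) • mulH1 hL (p.1.fst, p.2.fst) q.2.snd)

theorem nonlin_eq (hL : 0 < L) {w : X0 L} (hu : MemH1 w.fst) (hv : MemH1 w.snd) :
    nonlin w = nl hL.le (w, xderiv w) (w, xderiv w) := by
  have hmu := hu.isH1Rep.coeFn_mulH1 hL (wderiv w.fst)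
  have hmv := hv.isH1Rep.coeFn_mulH1 hL (wderiv w.snd)
  have hmuv := hu.isH1Rep.coeFn_mulH1 hL (wderiv w.snd)
  refine WithLp.ofLp_injective 2 (Prod.ext ?_ ?_)
  · refine (toL2_eq _ ?_).trans (nl_fst hL.le _ _).symm
    change ∀ᵐ x ∂(volume.restrict (Ioo 0 L)),
      ((3 : ℝ) • mulH1 hL.le (w.fst, wderiv w.fst) (wderiv w.fst)
        + (3 : ℝ) • mulH1 hL.le (w.snd, wderiv w.snd) (wderiv w.snd) : L2 0 L) x = _
    filter_upwards [hmu, hmv, hu.isH1Rep.1, hv.isH1Rep.1,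
      Lp.coeFn_add ((3 : ℝ) • mulH1 hL.le (w.fst, wderiv w.fst) (wderiv w.fst))
        ((3 : ℝ) • mulH1 hL.le (w.snd, wderiv w.snd) (wderiv w.snd)),
      Lp.coeFn_smul (3 : ℝ) (mulH1 hL.le (w.fst, wderiv w.fst) (wderiv w.fst)),
      Lp.coeFn_smul (3 : ℝ) (mulH1 hL.le (w.snd, wderiv w.snd) (wderiv w.snd))]
      with x h1 h2 h3 h4 h5 h6 h7
    rw [h5, Pi.add_apply, h6, h7, Pi.smul_apply, Pi.smul_apply, h1, h2, h3, h4, smul_eq_mul,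
      smul_eq_mul]
    ring
  · refine (toL2_eq _ ?_).trans (nl_snd hL.le _ _).symm
    change ∀ᵐ x ∂(volume.restrict (Ioo 0 L)),
      ((-3 : ℝ) • mulH1 hL.le (w.fst, wderiv w.fst) (wderiv w.snd) : L2 0 L) x = _
    filter_upwards [hmuv, hu.isH1Rep.1,
      Lp.coeFn_smul (-3 : ℝ) (mulH1 hL.le (w.fst, wderiv w.fst) (wderiv w.snd))] with x h1 h2 h3
    rw [h3, Pi.smul_apply, h1, h2, smul_eq_mul]
    ring

theorem norm_nl_sub_le (hL : 0 ≤ L) (p q : X0 L × X0 L) :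
    ‖nl hL p p - nl hL q q‖ ≤ ‖nl hL‖ * ((‖p‖ + ‖q‖) * ‖p - q‖) := by
  have e : nl hL p p - nl hL q q = nl hL (p - q) p + nl hL q (p - q) := by
    simp only [map_sub, sub_apply]; abel
  rw [e]
  refine (norm_add_le _ _).trans ?_
  have h1 := (nl hL).le_opNorm₂ (p - q) p
  have h2 := (nl hL).le_opNorm₂ q (p - q)
  calc _ ≤ _ := add_le_add h1 h2
    _ = _ := by ring

/-- The graph of the spatial derivative on pairs in `H¹`. -/
def graphH1 (L : ℝ) : Set (X0 L × X0 L) :=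
  {p | (MemH1 p.1.fst ∧ MemH1 p.1.snd) ∧ xderiv p.1 = p.2}

/-- The graph of the spatial derivative on pairs in `H¹` whose first component vanishes at both
end points. -/
def graphH10 (L : ℝ) : Set (X0 L × X0 L) :=
  {p | p ∈ graphH1 L ∧ contRep p.1.fst 0 = 0 ∧ contRep p.1.fst L = 0}

theorem continuous_pair_fst :
    Continuous fun p : X0 L × X0 L => (p.1.fst, p.2.fst) :=
  ((WithLp.fstL 2 ℝ (L2 0 L) (L2 0 L)).continuous.comp continuous_fst).prodMk
    ((WithLp.fstL 2 ℝ (L2 0 L) (L2 0 L)).continuous.comp continuous_snd)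

theorem continuous_pair_snd :
    Continuous fun p : X0 L × X0 L => (p.1.snd, p.2.snd) :=
  ((WithLp.sndL 2 ℝ (L2 0 L) (L2 0 L)).continuous.comp continuous_fst).prodMk
    ((WithLp.sndL 2 ℝ (L2 0 L) (L2 0 L)).continuous.comp continuous_snd)

theorem mem_graphH1_iff {p : X0 L × X0 L} : p ∈ graphH1 L ↔
    (MemH1 p.1.fst ∧ wderiv p.1.fst = p.2.fst) ∧ (MemH1 p.1.snd ∧ wderiv p.1.snd = p.2.snd) := by
  constructor
  · rintro ⟨⟨h1, h2⟩, h3⟩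
    exact ⟨⟨h1, by rw [← h3]; rfl⟩, ⟨h2, by rw [← h3]; rfl⟩⟩
  · rintro ⟨⟨h1, h2⟩, h3, h4⟩
    exact ⟨⟨h1, h3⟩, WithLp.ofLp_injective 2 (Prod.ext h2 h4)⟩

theorem isClosed_graphH1 (hL : 0 < L) : IsClosed (graphH1 L) := by
  have h1 := (isClosed_graph_wderiv hL).preimage (continuous_pair_fst (L := L))
  have h2 := (isClosed_graph_wderiv hL).preimage (continuous_pair_snd (L := L))
  convert h1.inter h2 using 1
  ext p
  exact mem_graphH1_iff

theorem contRep_right (hL : 0 < L) {f : L2 0 L} (hf : MemH1 f) :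
    contRep f L = contRep f 0 + ⟪oneL 0 L, wderiv f⟫ := by
  rw [oneL_inner, setIntegral_Ioo_eq hL.le]
  exact hf.isH1Rep.2 L ⟨hL.le, le_rfl⟩

/-- The boundary values are the integration constant and `∫ u_x`, both continuous on the graph. -/
theorem isClosed_graphH10 (hL : 0 < L) : IsClosed (graphH10 L) := by
  have e : graphH10 L = graphH1 L ∩ ({p | cst hL.le (p.1.fst, p.2.fst) = 0}
      ∩ {p | ⟪oneL 0 L, p.2.fst⟫ = 0}) := by
    ext p
    constructor
    · rintro ⟨h1, h2, h3⟩
      obtain ⟨⟨h4, h5⟩, -⟩ := mem_graphH1_iff.1 h1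
      have h6 := contRep_right hL h4
      have h7 := h4.isH1Rep.cst_eq hL
      refine ⟨h1, ?_, ?_⟩
      · change cst hL.le (p.1.fst, p.2.fst) = 0
        rw [← h5, h7, h2]
      · change ⟪oneL 0 L, p.2.fst⟫ = 0
        rw [← h5]; linarith
    · rintro ⟨h1, h2, h3⟩
      obtain ⟨⟨h4, h5⟩, -⟩ := mem_graphH1_iff.1 h1
      have h6 := contRep_right hL h4
      have h7 := h4.isH1Rep.cst_eq hL
      change cst hL.le (p.1.fst, p.2.fst) = 0 at h2
      change ⟪oneL 0 L, p.2.fst⟫ = 0 at h3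
      rw [← h5, h7] at h2
      rw [← h5] at h3
      exact ⟨h1, h2, by rw [h6, h2, h3, add_zero]⟩
  rw [e]
  refine (isClosed_graphH1 hL).inter (IsClosed.inter ?_ ?_)
  · exact isClosed_eq ((cst hL.le).continuous.comp continuous_pair_fst) continuous_const
  · refine isClosed_eq (((innerForm (L2 0 L)) (oneL 0 L)).continuous.comp
      (continuous_snd.comp continuous_pair_fst)) continuous_const

/-- The nonlinearity does no work: `⟪N(w), w⟫ = ∫ (u³)ₓ = 0` when `u` vanishes at both ends. -/
theorem inner_nonlin_self (hL : 0 < L) {w : X0 L} (hu : MemH1 w.fst) (hv : MemH1 w.snd)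
    (hl : contRep w.fst 0 = 0) (hr : contRep w.fst L = 0) : ⟪nonlin w, w⟫ = 0 := by
  rw [nonlin_eq hL hu hv]
  set p : X0 L × X0 L := (w, xderiv w) with hp
  have e : ⟪nl hL.le p p, w⟫ = ⟪(nl hL.le p p).fst, w.fst⟫ + ⟪(nl hL.le p p).snd, w.snd⟫ := rfl
  set mu := mulH1 hL.le (w.fst, wderiv w.fst) (wderiv w.fst) with hmu
  set mv := mulH1 hL.le (w.snd, wderiv w.snd) (wderiv w.snd) with hmv
  set muv := mulH1 hL.le (w.fst, wderiv w.fst) (wderiv w.snd) with hmuv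
  have e1 : (nl hL.le p p).fst = (3 : ℝ) • mu + (3 : ℝ) • mv := nl_fst hL.le p p
  have e2 : (nl hL.le p p).snd = (-3 : ℝ) • muv := nl_snd hL.le p p
  have am := hu.isH1Rep.coeFn_mulH1 hL (wderiv w.fst)
  have av := hv.isH1Rep.coeFn_mulH1 hL (wderiv w.snd)
  have auv := hu.isH1Rep.coeFn_mulH1 hL (wderiv w.snd)
  have hcancel : ⟪mv, w.fst⟫ = ⟪muv, w.snd⟫ := by
    rw [L2.inner_def, L2.inner_def]
    refine integral_congr_ae ?_
    filter_upwards [av, auv, hu.isH1Rep.1, hv.isH1Rep.1] with x h1 h2 h3 h4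
    rw [hmv, hmuv, h1, h2, h3, h4]
    simp; ring
  have i := L2.intervalIntegrable hL.le (wderiv w.fst)
  have hc := hu.isH1Rep.continuousOn hL.le
  have hsq := mul_primitive hL.le i i hu.isH1Rep.2 hu.isH1Rep.2
  have i1 : IntervalIntegrable (fun s => wderiv w.fst s * contRep w.fst s) volume 0 L :=
    i.mul_continuousOn (by rwa [uIcc_of_le hL.le])
  have i2 : IntervalIntegrable (fun s => contRep w.fst s * wderiv w.fst s) volume 0 L :=
    i.continuousOn_mul (by rwa [uIcc_of_le hL.le])
  have hcube := mul_primitive hL.le (i1.add i2) i hsq hu.isH1Rep.2 L ⟨hL.le, le_rfl⟩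
  rw [hl, hr] at hcube
  have hz : ⟪mu, w.fst⟫ = 0 := by
    have h1 : ⟪mu, w.fst⟫ = ∫ x in (0 : ℝ)..L, contRep w.fst x ^ 2 * wderiv w.fst x := by
      rw [L2.inner_def, ← setIntegral_Ioo_eq hL.le]
      refine integral_congr_ae ?_
      filter_upwards [am, hu.isH1Rep.1] with x h1 h3
      rw [hmu, h1, h3]
      simp; ring
    have h2 : ∫ x in (0 : ℝ)..L, ((wderiv w.fst x * contRep w.fst x
        + contRep w.fst x * wderiv w.fst x) * contRep w.fst x
        + contRep w.fst x * contRep w.fst x * wderiv w.fst x)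
        = 3 * ∫ x in (0 : ℝ)..L, contRep w.fst x ^ 2 * wderiv w.fst x := by
      rw [← intervalIntegral.integral_const_mul]
      congr 1; ext x; ring
    rw [h2] at hcube
    rw [h1]
    linarith
  rw [e, e1, e2, inner_add_left, real_inner_smul_left, real_inner_smul_left, real_inner_smul_left,
    hz, hcancel]
  ring

end Nonlinearity

/-! ### Mild solutions in terms of the resolvent -/

section Link
variable {L T h α β : ℝ}

theorem path_eq_IccExtend {E : Type*} [TopologicalSpace E] [Zero E] (hT : 0 ≤ T)
    (w : C(Icc (0 : ℝ) T, E)) {s : ℝ} (hs : s ∈ Icc 0 T) : path w s = IccExtend hT w s := by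
  unfold path
  rw [dif_pos hs, IccExtend_of_mem hT _ hs]

theorem path_of_mem {E : Type*} [TopologicalSpace E] [Zero E]
    (w : C(Icc (0 : ℝ) T, E)) {s : ℝ} (hs : s ∈ Icc 0 T) : path w s = w ⟨s, hs⟩ := dif_pos hs

/-- The mild formulation in terms of the generator agrees with the one in terms of its resolvent,
for any function extending the path. -/
theorem isMildSolution_iff {R : H L →L[ℝ] H L} {S : H L →L[ℝ] X0 L}
    {b : H L →L[ℝ] H L →L[ℝ] ℝ} {c : ℝ} (hR : IsHSResolvent L h α β R S b c) (U₀ : H L)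
    (f : ℝ → X0 L) (U : C(Icc (0 : ℝ) T, H L)) {W : ℝ → H L} (hW : Continuous W)
    (hWU : ∀ t : Icc (0 : ℝ) T, W t = U t) {f' : ℝ → X0 L} (hff : ∀ t ∈ Icc 0 T, f t = f' t) :
    IsMildSolution L T h α β U₀ f U ↔ IntegrableOn f' (Ioc 0 T) ∧
      IsMild R T (scaleZ L (√(β * h)) U₀) (fun s => inclX L (f' s))
        (fun s => scaleZ L (√(β * h)) (W s)) := by
  have hfi : IntegrableOn f (Ioc 0 T) ↔ IntegrableOn f' (Ioc 0 T) :=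
    integrableOn_congr_fun (fun s hs => hff s (Ioc_subset_Icc_self hs)) measurableSet_Ioc
  unfold IsMildSolution
  rw [hfi]
  refine and_congr_right fun hf => ?_
  have key : ∀ t : Icc (0 : ℝ) T, ((∫ s in (0 : ℝ)..t, path U s) ∈ domA L α β ∧
        U t = U₀ + opA L h (∫ s in (0 : ℝ)..t, path U s)
          + WithLp.toLp 2 ((∫ s in (0 : ℝ)..t, f s), (0 : L2 0 1))) ↔
      ∫ s in (0 : ℝ)..t, scaleZ L (√(β * h)) (W s)
        = R ((∫ s in (0 : ℝ)..t, scaleZ L (√(β * h)) (W s)) - scaleZ L (√(β * h)) (W t)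
          + scaleZ L (√(β * h)) U₀ + ∫ s in (0 : ℝ)..t, inclX L (f' s)) := by
    rintro ⟨t, ht⟩
    have e1 : ∫ s in (0 : ℝ)..t, path U s = ∫ s in (0 : ℝ)..t, W s := by
      refine intervalIntegral.integral_congr fun s hs => ?_
      rw [uIcc_of_le ht.1] at hs
      have hs' : s ∈ Icc 0 T := ⟨hs.1, hs.2.trans ht.2⟩
      rw [path_of_mem U hs', ← hWU ⟨s, hs'⟩]
    have e2 : ∫ s in (0 : ℝ)..t, f s = ∫ s in (0 : ℝ)..t, f' s := by
      refine intervalIntegral.integral_congr fun s hs => ?_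
      rw [uIcc_of_le ht.1] at hs
      exact hff s ⟨hs.1, hs.2.trans ht.2⟩
    have hft : IntervalIntegrable f' volume 0 t :=
      (intervalIntegrable_iff_integrableOn_Ioc_of_le ht.1).2
        (hf.mono_set (Ioc_subset_Ioc_right ht.2))
    have e3 : ∫ s in (0 : ℝ)..t, scaleZ L (√(β * h)) (W s)
        = scaleZ L (√(β * h)) (∫ s in (0 : ℝ)..t, W s) :=
      (scaleZ L _).intervalIntegral_comp_comm (hW.intervalIntegrable _ _)
    have e4 : ∫ s in (0 : ℝ)..t, inclX L (f' s) = inclX L (∫ s in (0 : ℝ)..t, f' s) :=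
      (inclX L).intervalIntegral_comp_comm hft
    simp only
    rw [e1, e2, e3, e4, ← inclX_apply, ← hWU ⟨t, ht⟩]
    simp only
    set V := ∫ s in (0 : ℝ)..t, W s
    set I := ∫ s in (0 : ℝ)..t, f' s
    have e5 : scaleZ L (√(β * h)) V - scaleZ L (√(β * h)) (W t) + scaleZ L (√(β * h)) U₀
        + inclX L I = scaleZ L (√(β * h)) V - scaleZ L (√(β * h)) (W t - U₀ - inclX L I) := by
      simp only [map_sub, scaleZ_inclX]; abel
    rw [e5, ← hR.iff]
    refine and_congr_right fun _ => ?_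
    constructor
    · intro h1; rw [h1]; abel
    · intro h1; rw [h1]; abel
  constructor
  · intro h1 t ht
    exact (key ⟨t, ht⟩).1 (h1 ⟨t, ht⟩)
  · intro h1 t
    exact (key t).2 (h1 t t.2)

end Link

/-! ### The space `𝓑` and estimates of the nonlinearity -/

section SpaceB
variable {L T : ℝ}

/-- Membership in `L²(0,T;[H¹(0,L)]²)`. -/
def IsHOnePath (T : ℝ) (p : ℝ → X0 L) : Prop :=
  (∀ᵐ t ∂(volume.restrict (Ioo 0 T)), MemH1 (p t).fst ∧ MemH1 (p t).snd) ∧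
    MemLp (fun t => xderiv (p t)) 2 (volume.restrict (Ioo 0 T))

theorem mem_spaceB_iff {w : C(Icc (0 : ℝ) T, X0 L)} : w ∈ spaceB L T ↔ IsHOnePath T (path w) := by
  refine and_congr_right fun _ => ?_
  constructor
  · rintro ⟨h1, h2⟩
    let J := (WithLp.prodContinuousLinearEquiv 2 ℝ (L2 0 L) (L2 0 L)).symm.toContinuousLinearMap
    have h3 := (J.comp (ContinuousLinearMap.inl ℝ _ _)).comp_memLp' h1
    have h4 := (J.comp (ContinuousLinearMap.inr ℝ _ _)).comp_memLp' h2
    refine (memLp_congr_ae (ae_of_all _ fun t => ?_)).1 (h3.add h4)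
    exact WithLp.ofLp_injective 2 (Prod.ext (add_zero _) (zero_add _))
  · intro h1
    exact ⟨(WithLp.fstL 2 ℝ (L2 0 L) (L2 0 L)).comp_memLp' h1,
      (WithLp.sndL 2 ℝ (L2 0 L) (L2 0 L)).comp_memLp' h1⟩

theorem norm_xderiv_sq (w : X0 L) :
    ‖xderiv w‖ ^ 2 = ‖wderiv w.fst‖ ^ 2 + ‖wderiv w.snd‖ ^ 2 :=
  WithLp.prod_norm_sq_eq_of_L2 _

theorem bNorm_eq (w : C(Icc (0 : ℝ) T, X0 L)) :
    bNorm w = ‖w‖ + √(∫ t in Ioo 0 T, ‖xderiv (path w t)‖ ^ 2) := by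
  simp only [bNorm, norm_xderiv_sq]

theorem norm_le_bNorm (w : C(Icc (0 : ℝ) T, X0 L)) : ‖w‖ ≤ bNorm w :=
  le_add_of_nonneg_right (Real.sqrt_nonneg _)

theorem bNorm_nonneg (w : C(Icc (0 : ℝ) T, X0 L)) : 0 ≤ bNorm w :=
  (norm_nonneg w).trans (norm_le_bNorm w)

theorem norm_path_le (w : C(Icc (0 : ℝ) T, X0 L)) (t : ℝ) : ‖path w t‖ ≤ ‖w‖ := by
  unfold path
  split_ifs with h
  · exact w.norm_coe_le_norm _
  · simp

theorem path_sub (w w' : C(Icc (0 : ℝ) T, X0 L)) (t : ℝ) :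
    path (w - w') t = path w t - path w' t := by
  unfold path
  split_ifs with h
  · rfl
  · simp

theorem path_ae_eq (hT : 0 ≤ T) (w : C(Icc (0 : ℝ) T, X0 L)) :
    path w =ᵐ[volume.restrict (Ioo 0 T)] IccExtend hT w :=
  (ae_restrict_iff' measurableSet_Ioo).2 (Eventually.of_forall fun _ ht =>
    path_eq_IccExtend hT w (Ioo_subset_Icc_self ht))

theorem memLp_path (hT : 0 ≤ T) (w : C(Icc (0 : ℝ) T, X0 L)) (p : ℝ≥0∞) :
    MemLp (path w) p (volume.restrict (Ioo 0 T)) := by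
  refine MemLp.of_bound ?_ ‖w‖ (ae_of_all _ (norm_path_le w))
  exact (w.continuous.Icc_extend' (h := hT)).aestronglyMeasurable.congr (path_ae_eq hT w).symm

theorem xderiv_sub (hL : 0 < L) {p q : X0 L} (hp : MemH1 p.fst ∧ MemH1 p.snd)
    (hq : MemH1 q.fst ∧ MemH1 q.snd) : xderiv (p - q) = xderiv p - xderiv q :=
  WithLp.ofLp_injective 2 (Prod.ext (wderiv_sub hL hp.1 hq.1) (wderiv_sub hL hp.2 hq.2))

theorem IsHOnePath.sub (hL : 0 < L) {p q : ℝ → X0 L} (hp : IsHOnePath T p)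
    (hq : IsHOnePath T q) : IsHOnePath T (fun t => p t - q t) := by
  refine ⟨?_, ?_⟩
  · filter_upwards [hp.1, hq.1] with t h1 h2
    exact ⟨h1.1.sub hL.le h2.1, h1.2.sub hL.le h2.2⟩
  · refine (memLp_congr_ae ?_).2 (hp.2.sub hq.2)
    filter_upwards [hp.1, hq.1] with t h1 h2
    exact xderiv_sub hL h1 h2

theorem sub_mem_spaceB (hL : 0 < L) {w w' : C(Icc (0 : ℝ) T, X0 L)} (hw : w ∈ spaceB L T)
    (hw' : w' ∈ spaceB L T) : w - w' ∈ spaceB L T := by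
  rw [mem_spaceB_iff] at *
  have := hw.sub hL hw'
  simpa only [← path_sub] using this

/-- A path together with its spatial derivative. -/
def pairPath (w : C(Icc (0 : ℝ) T, X0 L)) (t : ℝ) : X0 L × X0 L := (path w t, xderiv (path w t))

theorem memLp_pairPath (hT : 0 ≤ T) {w : C(Icc (0 : ℝ) T, X0 L)} (hw : w ∈ spaceB L T) :
    MemLp (pairPath w) 2 (volume.restrict (Ioo 0 T)) :=
  memLp_prod_iff.2 ⟨memLp_path hT w 2, (mem_spaceB_iff.1 hw).2⟩

theorem integral_norm_pairPath_sq_le (hT : 0 ≤ T) {w : C(Icc (0 : ℝ) T, X0 L)}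
    (hw : w ∈ spaceB L T) :
    √(∫ t in Ioo 0 T, ‖pairPath w t‖ ^ 2) ≤ √(T + 1) * bNorm w := by
  have h1 : Integrable (fun t => ‖path w t‖ ^ 2) (volume.restrict (Ioo 0 T)) :=
    (memLp_path hT w 2).integrable_norm_pow two_ne_zero
  have h2 : Integrable (fun t => ‖xderiv (path w t)‖ ^ 2) (volume.restrict (Ioo 0 T)) :=
    (mem_spaceB_iff.1 hw).2.integrable_norm_pow two_ne_zero
  have h3 : ∫ t in Ioo 0 T, ‖pairPath w t‖ ^ 2
      ≤ ∫ t in Ioo 0 T, (‖path w t‖ ^ 2 + ‖xderiv (path w t)‖ ^ 2) := by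
    refine integral_mono ((memLp_pairPath hT hw).integrable_norm_pow two_ne_zero) (h1.add h2)
      fun t => ?_
    change ‖(path w t, xderiv (path w t))‖ ^ 2 ≤ _
    rw [Prod.norm_def]
    rcases max_cases ‖path w t‖ ‖xderiv (path w t)‖ with ⟨h, -⟩ | ⟨h, -⟩ <;> simp only [h]
    · exact le_add_of_nonneg_right (sq_nonneg _)
    · exact le_add_of_nonneg_left (sq_nonneg _)
  have h4 : ∫ t in Ioo 0 T, ‖path w t‖ ^ 2 ≤ T * ‖w‖ ^ 2 := by
    have := integral_mono h1 (integrable_const (‖w‖ ^ 2))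
      fun t => pow_le_pow_left₀ (norm_nonneg _) (norm_path_le w t) 2
    simpa [hT] using this
  rw [integral_add h1 h2] at h3
  have h5 := Real.sq_sqrt (integral_nonneg (μ := volume.restrict (Ioo 0 T))
    fun t => sq_nonneg ‖xderiv (path w t)‖)
  rw [← Real.sqrt_sq (bNorm_nonneg w), ← Real.sqrt_mul (by positivity)]
  refine Real.sqrt_le_sqrt (h3.trans ?_)
  rw [bNorm_eq]
  set s := √(∫ t in Ioo 0 T, ‖xderiv (path w t)‖ ^ 2) with hs
  have hs0 : 0 ≤ s := Real.sqrt_nonneg _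
  rw [← h5]
  have := norm_nonneg w
  nlinarith [mul_nonneg hs0 this, mul_nonneg hT (sq_nonneg s), mul_nonneg hT (mul_nonneg hs0 this)]

theorem integral_norm_mul_norm_le {Ω E G : Type*} [MeasurableSpace Ω] {μ : Measure Ω}
    [NormedAddCommGroup E] [NormedAddCommGroup G] {f : Ω → E} {g : Ω → G} (hf : MemLp f 2 μ)
    (hg : MemLp g 2 μ) :
    ∫ t, ‖f t‖ * ‖g t‖ ∂μ ≤ √(∫ t, ‖f t‖ ^ 2 ∂μ) * √(∫ t, ‖g t‖ ^ 2 ∂μ) := by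
  have h22 : Real.HolderConjugate 2 2 := Real.HolderConjugate.two_two
  have := integral_mul_norm_le_Lp_mul_Lq (μ := μ) (f := fun t => ‖f t‖) (g := fun t => ‖g t‖) h22
    (by simpa using hf.norm) (by simpa using hg.norm)
  simpa [Real.sqrt_eq_rpow] using this

theorem nonlin_path_ae_eq (hL : 0 < L) {w : C(Icc (0 : ℝ) T, X0 L)} (hw : w ∈ spaceB L T) :
    (fun t => nonlin (path w t)) =ᵐ[volume.restrict (Ioo 0 T)]
      fun t => nl hL.le (pairPath w t) (pairPath w t) := by
  filter_upwards [hw.1] with t ht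
  exact nonlin_eq hL ht.1 ht.2

theorem norm_nl_sub_pairPath_integrable (hL : 0 < L) (hT : 0 ≤ T)
    {w w' : C(Icc (0 : ℝ) T, X0 L)} (hw : w ∈ spaceB L T) (hw' : w' ∈ spaceB L T) :
    Integrable (fun t => ‖nl hL.le‖ * (‖pairPath w t‖ * ‖pairPath (w - w') t‖
      + ‖pairPath w' t‖ * ‖pairPath (w - w') t‖)) (volume.restrict (Ioo 0 T)) := by
  have h1 := (memLp_pairPath hT hw).norm
  have h2 := (memLp_pairPath hT hw').norm
  have h3 := (memLp_pairPath hT (sub_mem_spaceB hL hw hw')).norm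
  exact ((h1.integrable_mul h3).add (h2.integrable_mul h3)).const_mul _

theorem norm_nonlin_sub_le (hL : 0 < L) {w w' : C(Icc (0 : ℝ) T, X0 L)} (hw : w ∈ spaceB L T)
    (hw' : w' ∈ spaceB L T) : ∀ᵐ t ∂(volume.restrict (Ioo 0 T)),
      ‖nonlin (path w t) - nonlin (path w' t)‖ ≤ ‖nl hL.le‖ * (‖pairPath w t‖ *
        ‖pairPath (w - w') t‖ + ‖pairPath w' t‖ * ‖pairPath (w - w') t‖) := by
  filter_upwards [hw.1, hw'.1] with t h1 h2
  rw [nonlin_eq hL h1.1 h1.2, nonlin_eq hL h2.1 h2.2]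
  have e : pairPath (w - w') t = pairPath w t - pairPath w' t := by
    refine Prod.ext (path_sub w w' t) ?_
    change xderiv (path (w - w') t) = _
    rw [path_sub]
    exact xderiv_sub hL h1 h2
  rw [e, ← add_mul]
  exact norm_nl_sub_le hL.le (pairPath w t) (pairPath w' t)

theorem memH1_zero (hL : 0 < L) : MemH1 (0 : L2 0 L) :=
  ((memH1_wderiv_iff (g := 0) hL).2 (by rw [Prod.mk_zero_zero]; simp)).1

theorem xderiv_zero (hL : 0 < L) : xderiv (0 : X0 L) = 0 := by
  have hw : wderiv (0 : L2 0 L) = 0 := by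
    have := wderiv_smul hL 0 (memH1_zero hL)
    simpa using this
  exact WithLp.ofLp_injective 2 (Prod.ext hw hw)

theorem nonlin_zero (hL : 0 < L) : nonlin (0 : X0 L) = 0 := by
  have hz : MemH1 (0 : X0 L).fst := memH1_zero hL
  have hz' : MemH1 (0 : X0 L).snd := memH1_zero hL
  rw [nonlin_eq hL hz hz', xderiv_zero hL, Prod.mk_zero_zero, map_zero]

theorem path_zero : path (0 : C(Icc (0 : ℝ) T, X0 L)) = fun _ => 0 := by
  ext1 t; unfold path; split_ifs <;> rfl

theorem zero_mem_spaceB (hL : 0 < L) : (0 : C(Icc (0 : ℝ) T, X0 L)) ∈ spaceB L T := by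
  rw [mem_spaceB_iff, path_zero]
  refine ⟨ae_of_all _ fun t => ⟨memH1_zero hL, memH1_zero hL⟩, ?_⟩
  simp [xderiv_zero hL]

theorem bNorm_zero (hL : 0 < L) : bNorm (0 : C(Icc (0 : ℝ) T, X0 L)) = 0 := by
  rw [bNorm_eq, path_zero]
  simp [xderiv_zero hL]

theorem integrableOn_nonlin (hL : 0 < L) (hT : 0 ≤ T) {w : C(Icc (0 : ℝ) T, X0 L)}
    (hw : w ∈ spaceB L T) : IntegrableOn (fun t => nonlin (path w t)) (Ioc 0 T) := by
  rw [integrableOn_Ioc_iff_integrableOn_Ioo]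
  refine Integrable.congr ?_ (nonlin_path_ae_eq hL hw).symm
  have h1 := memLp_pairPath hT hw
  have hc : Continuous fun p : X0 L × X0 L => nl hL.le p p := by fun_prop
  refine ((h1.norm.integrable_mul h1.norm).const_mul ‖nl hL.le‖).mono'
    (hc.comp_aestronglyMeasurable h1.1) (ae_of_all _ fun t => ?_)
  refine ((nl hL.le).le_opNorm₂ _ _).trans (le_of_eq ?_)
  rw [Pi.mul_apply, mul_assoc]

/-- The nonlinearity is Lipschitz from balls of `𝓑` to `L¹(0,T;X₀)`. -/
theorem integral_norm_nonlin_sub_le (hL : 0 < L) (hT : 0 ≤ T) {w w' : C(Icc (0 : ℝ) T, X0 L)}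
    (hw : w ∈ spaceB L T) (hw' : w' ∈ spaceB L T) :
    ∫ t in (0 : ℝ)..T, ‖nonlin (path w t) - nonlin (path w' t)‖
      ≤ ‖nl hL.le‖ * (T + 1) * ((bNorm w + bNorm w') * bNorm (w - w')) := by
  rw [← setIntegral_Ioo_eq hT]
  have hd := sub_mem_spaceB hL hw hw'
  refine (integral_mono_of_nonneg (ae_of_all _ fun _ => norm_nonneg _)
    (norm_nl_sub_pairPath_integrable hL hT hw hw') (norm_nonlin_sub_le hL hw hw')).trans ?_
  have h1 := (memLp_pairPath hT hw)
  have h2 := (memLp_pairPath hT hw')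
  have h3 := (memLp_pairPath hT hd)
  have e := integral_add (h1.norm.integrable_mul h3.norm) (h2.norm.integrable_mul h3.norm)
  simp only [Pi.mul_apply] at e
  rw [integral_const_mul, e, mul_assoc]
  refine mul_le_mul_of_nonneg_left ?_ (nl hL.le).opNorm_nonneg
  have i1 := integral_norm_pairPath_sq_le hT hw
  have i2 := integral_norm_pairPath_sq_le hT hw'
  have i3 := integral_norm_pairPath_sq_le hT hd
  have hs : √(T + 1) * √(T + 1) = T + 1 := Real.mul_self_sqrt (by linarith)
  refine (add_le_add (integral_norm_mul_norm_le h1 h3) (integral_norm_mul_norm_le h2 h3)).trans ?_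
  refine (add_le_add (mul_le_mul i1 i3 (Real.sqrt_nonneg _) ((Real.sqrt_nonneg _).trans i1))
    (mul_le_mul i2 i3 (Real.sqrt_nonneg _) ((Real.sqrt_nonneg _).trans i2))).trans
    (le_of_eq ?_)
  linear_combination ((bNorm w + bNorm w') * bNorm (w - w')) * hs

end SpaceB

/-! ### The source problem -/

section Source
variable {L T h α β : ℝ} {R : H L →L[ℝ] H L} {S : H L →L[ℝ] X0 L}
  {b : H L →L[ℝ] H L →L[ℝ] ℝ} {c : ℝ}

/-- Solutions of the source problem in terms of the resolvent. The source only matters on `[0,T]`,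
and the full state `V` is extended to `ℝ` and read in the coordinates of `scaleZ`. -/
theorem isSourceSolution_iff (hR : IsHSResolvent L h α β R S b c) (hβh : 0 < β * h) (hT : 0 ≤ T)
    (U₀ : H L) {f f' : ℝ → X0 L} (hff : ∀ t ∈ Icc 0 T, f t = f' t)
    (w : C(Icc (0 : ℝ) T, X0 L)) :
    IsSourceSolution L T h α β U₀ f w ↔ IntegrableOn f' (Ioc 0 T) ∧ ∃ V : ℝ → H L, Continuous V ∧
      IsMild R T (scaleZ L (√(β * h)) U₀) (fun s => inclX L (f' s)) V ∧
        ∀ t : Icc (0 : ℝ) T, (V t).fst = w t := by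
  have hs : √(β * h) * (√(β * h))⁻¹ = 1 := mul_inv_cancel₀ (Real.sqrt_pos.2 hβh).ne'
  constructor
  · rintro ⟨U, hU, hUw⟩
    have h1 := (isMildSolution_iff hR U₀ f U (W := IccExtend hT U) (U.continuous.Icc_extend')
      (fun t => IccExtend_val hT U t) hff).1 hU
    refine ⟨h1.1, _, (scaleZ L _).continuous.comp U.continuous.Icc_extend', h1.2, fun t => ?_⟩
    rw [Function.comp_apply, IccExtend_val, scaleZ_fst, hUw]
  · rintro ⟨hf, V, hV, hm, hVw⟩
    refine ⟨⟨fun t => scaleZ L (√(β * h))⁻¹ (V t), by fun_prop⟩, ?_, hVw⟩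
    refine (isMildSolution_iff hR U₀ f _ (W := fun t => scaleZ L (√(β * h))⁻¹ (V t)) (by fun_prop)
      (fun t => rfl) hff).2 ⟨hf, ?_⟩
    simpa only [scaleZ_scaleZ hs] using hm

theorem intervalIntegrable_inclX (hT : 0 ≤ T) {f : ℝ → X0 L} (hf : IntegrableOn f (Ioc 0 T)) :
    IntervalIntegrable (fun s => inclX L (f s)) volume 0 T :=
  (intervalIntegrable_iff_integrableOn_Ioc_of_le hT).2 ((inclX L).integrable_comp hf)

theorem norm_inclX (w : X0 L) : ‖inclX L w‖ = ‖w‖ := by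
  rw [inclX_apply, ← sq_eq_sq₀ (norm_nonneg _) (norm_nonneg _), WithLp.prod_norm_sq_eq_of_L2]
  simp

theorem norm_fst_le (U : H L) : ‖U.fst‖ ≤ ‖U‖ := WithLp.norm_fst_le _ U

/-- Kato smoothing: a mild solution lies in `L²(0,T;[H¹]²)`, with a bound, and its first component
vanishes at both end points for almost every time. -/
theorem IsHSResolvent.smoothing (hR : IsHSResolvent L h α β R S b c) (hL : 0 < L) (hT : 0 ≤ T)
    {x : H L} {f : ℝ → X0 L} (hf : IntegrableOn f (Ioc 0 T)) {V : ℝ → H L} (hV : Continuous V)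
    (hm : IsMild R T x (fun s => inclX L (f s)) V) :
    (∀ᵐ t ∂(volume.restrict (Ioo 0 T)), ((V t).fst, xderiv (V t).fst) ∈ graphH10 L) ∧
      IsHOnePath T (fun t => (V t).fst) ∧
      √(∫ t in Ioo 0 T, ‖xderiv (V t).fst‖ ^ 2)
        ≤ √(‖b‖ / c) * (‖x‖ + 2 * ∫ s in (0 : ℝ)..T, ‖f s‖) := by
  have hF := intervalIntegrable_inclX hT hf
  obtain ⟨g, hg, ⟨φ, hφ, hlim⟩, hle⟩ := hm.exists_smoothing hR.diss hT hV hF b hR.symm hR.nonneg S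
    hR.pos hR.le
  have hae : ∀ᵐ t ∂(volume.restrict (Ioo 0 T)), ((V t).fst, g t) ∈ graphH10 L := by
    filter_upwards [hlim] with t ht
    have h1 : Tendsto (fun n => (R (regInv R (φ n) (V t))).fst) atTop (𝓝 (V t).fst) :=
      ((WithLp.fstL 2 ℝ (X0 L) (L2 0 1)).continuous.tendsto (V t)).comp
        ((hR.diss.tendsto_approx (V t)).comp hφ.tendsto_atTop)
    refine (isClosed_graphH10 hL).mem_of_tendsto (h1.prodMk_nhds ht)
      (Eventually.of_forall fun n => ?_)
    obtain ⟨X, hX, e1, e2⟩ := hR.deriv (regInv R (φ n) (V t))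
    rw [e1, e2]
    exact ⟨⟨⟨hX.u_H3.1, hX.v_H3.1⟩, rfl⟩, hX.u_left, hX.u_right⟩
  have hge : ∀ᵐ t ∂(volume.restrict (Ioo 0 T)), xderiv (V t).fst = g t := by
    filter_upwards [hae] with t ht using ht.1.2
  refine ⟨?_, ⟨?_, (memLp_congr_ae hge).2 hg⟩, ?_⟩
  · filter_upwards [hae, hge] with t h1 h2
    rwa [h2]
  · filter_upwards [hae] with t ht using ht.1.1
  set I := ∫ s in (0 : ℝ)..T, ‖f s‖ with hI
  have hfi : IntervalIntegrable (fun s => ‖f s‖) volume 0 T :=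
    ((intervalIntegrable_iff_integrableOn_Ioc_of_le hT).2 hf).norm
  have hI0 : 0 ≤ I := intervalIntegral.integral_nonneg hT fun _ _ => norm_nonneg _
  have hVn : ∀ t ∈ Icc 0 T, ‖V t‖ ≤ ‖x‖ + 2 * I := by
    intro t ht
    have := hm.norm_le hR.diss hV hF ht
    simpa only [norm_inclX] using this
  have e : ∫ t in Ioo 0 T, ‖xderiv (V t).fst‖ ^ 2 = ∫ t in Ioo 0 T, ‖g t‖ ^ 2 := by
    refine integral_congr_ae ?_
    filter_upwards [hge] with t ht
    rw [ht]
  have hbx : b x x ≤ ‖b‖ * ‖x‖ ^ 2 := by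
    have := (le_abs_self _).trans (b.le_opNorm₂ x x)
    rwa [mul_assoc, ← sq] at this
  have hbF : ∫ s in (0 : ℝ)..T, b (inclX L (f s)) (V s) ≤ ‖b‖ * (‖x‖ + 2 * I) * I := by
    rw [hI, ← intervalIntegral.integral_const_mul, ← hI]
    refine intervalIntegral.integral_mono_on hT
      (intervalIntegrable_clm_apply b hT hF hV.continuousOn)
      (hfi.const_mul _) fun s hs => ?_
    refine ((le_abs_self _).trans (b.le_opNorm₂ _ _)).trans ?_
    rw [norm_inclX, mul_assoc ‖b‖, mul_assoc ‖b‖, mul_comm ‖f s‖]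
    exact mul_le_mul_of_nonneg_left (mul_le_mul_of_nonneg_right (hVn s hs) (norm_nonneg _))
      b.opNorm_nonneg
  have hb0 : 0 ≤ ‖b‖ := b.opNorm_nonneg
  have hx0 := norm_nonneg x
  rw [e, ← Real.sqrt_sq (by positivity : 0 ≤ ‖x‖ + 2 * I), ← Real.sqrt_mul (by
    have := hR.pos; positivity)]
  refine Real.sqrt_le_sqrt ?_
  rw [div_mul_eq_mul_div, le_div_iff₀ hR.pos]
  have h0 : 0 ≤ ∫ t in Ioo 0 T, ‖g t‖ ^ 2 := integral_nonneg fun _ => sq_nonneg _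
  have h3 : ‖b‖ * ‖x‖ ^ 2 + 2 * (‖b‖ * (‖x‖ + 2 * I) * I) ≤ ‖b‖ * (‖x‖ + 2 * I) ^ 2 := by
    nlinarith [mul_nonneg hb0 (mul_nonneg hx0 hI0)]
  nlinarith [mul_nonneg hR.pos.le h0]

theorem exists_isSourceSolution (hR : IsHSResolvent L h α β R S b c) (hβh : 0 < β * h)
    (hT : 0 ≤ T) (U₀ : H L) {f : ℝ → X0 L} (hf : IntegrableOn f (Ioc 0 T)) :
    ∃ w, IsSourceSolution L T h α β U₀ f w := by
  have hF : Integrable ((Ioc 0 T).indicator fun s => inclX L (f s)) :=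
    IntegrableOn.integrable_indicator ((inclX L).integrable_comp hf) measurableSet_Ioc
  obtain ⟨V, hV, hm⟩ := exists_isMild hR.diss hT (scaleZ L (√(β * h)) U₀) hF
  refine ⟨⟨fun t => (V t).fst, (WithLp.fstL 2 ℝ (X0 L) (L2 0 1)).continuous.comp
    (hV.comp continuous_subtype_val)⟩,
    (isSourceSolution_iff hR hβh hT U₀ (fun _ _ => rfl) _).2 ⟨hf, V, hV, ?_, fun _ => rfl⟩⟩
  intro t ht
  refine (hm t ht).trans ?_
  congr 2
  refine intervalIntegral.integral_congr_ae (ae_of_all _ fun s hs => ?_)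
  rw [uIoc_of_le ht.1] at hs
  exact indicator_of_mem (show s ∈ Ioc 0 T from ⟨hs.1, hs.2.trans ht.2⟩) _

theorem IsSourceSolution.sub (hR : IsHSResolvent L h α β R S b c) (hβh : 0 < β * h)
    (hT : 0 ≤ T) {U₀ U₀' : H L} {f f' : ℝ → X0 L} {w w' : C(Icc (0 : ℝ) T, X0 L)}
    (hw : IsSourceSolution L T h α β U₀ f w) (hw' : IsSourceSolution L T h α β U₀' f' w') :
    IsSourceSolution L T h α β (U₀ - U₀') (fun t => f t - f' t) (w - w') := by
  rw [isSourceSolution_iff hR hβh hT _ (fun _ _ => rfl)] at *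
  obtain ⟨hf, V, hV, hm, hVw⟩ := hw
  obtain ⟨hf', V', hV', hm', hVw'⟩ := hw'
  refine ⟨hf.sub hf', fun t => V t - V' t, hV.sub hV', ?_, fun t => ?_⟩
  · have := hm.sub hV hV' (intervalIntegrable_inclX hT hf) (intervalIntegrable_inclX hT hf') hm'
    simpa only [map_sub] using this
  · rw [ContinuousMap.sub_apply, ← hVw, ← hVw']; rfl

/-- Well-posedness bound for the source problem in `𝓑`. -/
theorem IsSourceSolution.bound (hR : IsHSResolvent L h α β R S b c) (hL : 0 < L)
    (hβh : 0 < β * h) (hT : 0 ≤ T) {U₀ : H L} {f : ℝ → X0 L} {w : C(Icc (0 : ℝ) T, X0 L)}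
    (hw : IsSourceSolution L T h α β U₀ f w) :
    w ∈ spaceB L T ∧
      bNorm w ≤ 2 * (1 + √(‖b‖ / c)) * (hNorm h β U₀ + ∫ s in (0 : ℝ)..T, ‖f s‖) := by
  obtain ⟨hf, V, hV, hm, hVw⟩ := (isSourceSolution_iff hR hβh hT _ (fun _ _ => rfl) _).1 hw
  obtain ⟨-, h1, h2⟩ := hR.smoothing hL hT hf hV hm
  have hp : ∀ t ∈ Ioo 0 T, path w t = (V t).fst := fun t ht => by
    rw [path_of_mem w (Ioo_subset_Icc_self ht), ← hVw]
  have hpa : ∀ᵐ t ∂(volume.restrict (Ioo 0 T)), path w t = (V t).fst :=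
    (ae_restrict_iff' measurableSet_Ioo).2 (Eventually.of_forall hp)
  constructor
  · rw [mem_spaceB_iff]
    refine ⟨?_, (memLp_congr_ae ?_).2 h1.2⟩
    · filter_upwards [hpa, h1.1] with t e1 e2
      rwa [e1]
    · filter_upwards [hpa] with t e1
      rw [e1]
  · have e : ∫ t in Ioo 0 T, ‖xderiv (path w t)‖ ^ 2 = ∫ t in Ioo 0 T, ‖xderiv (V t).fst‖ ^ 2 :=
      setIntegral_congr_fun measurableSet_Ioo fun t ht => by simp only [hp t ht]
    rw [norm_scaleZ hβh.le] at h2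
    set I := ∫ s in (0 : ℝ)..T, ‖f s‖ with hI
    have hI0 : 0 ≤ I := intervalIntegral.integral_nonneg hT fun _ _ => norm_nonneg _
    have hn0 : 0 ≤ hNorm h β U₀ := Real.sqrt_nonneg _
    have h3 : ‖w‖ ≤ hNorm h β U₀ + 2 * I := by
      refine (ContinuousMap.norm_le _ (by positivity)).2 fun t => ?_
      rw [← hVw]
      refine (norm_fst_le _).trans ?_
      have := hm.norm_le hR.diss hV (intervalIntegrable_inclX hT hf) t.2
      simpa only [norm_inclX, norm_scaleZ hβh.le] using this
    rw [bNorm_eq, e]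
    have hs := Real.sqrt_nonneg (‖b‖ / c)
    nlinarith [mul_nonneg hs hn0]

theorem IsSourceSolution.unique (hR : IsHSResolvent L h α β R S b c) (hL : 0 < L)
    (hβh : 0 < β * h) (hT : 0 ≤ T) {U₀ : H L} {f : ℝ → X0 L} {w w' : C(Icc (0 : ℝ) T, X0 L)}
    (hw : IsSourceSolution L T h α β U₀ f w) (hw' : IsSourceSolution L T h α β U₀ f w') :
    w = w' := by
  have h1 := ((hw.sub hR hβh hT hw').bound hR hL hβh hT).2
  have h2 : hNorm h β (0 : H L) = 0 := by simp [hNorm]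
  have h3 := (norm_le_bNorm _).trans h1
  simp only [sub_self, norm_zero, intervalIntegral.integral_zero, h2, add_zero, mul_zero] at h3
  exact sub_eq_zero.1 (norm_le_zero_iff.1 h3)

end Source

/-! ### Nonlinear solutions and their continuation -/

section Flow

theorem IsMild.congr {E : Type*} [NormedAddCommGroup E] [InnerProductSpace ℝ E] {R : E →L[ℝ] E}
    {T : ℝ} {x : E} {F F' U U' : ℝ → E} (h : IsMild R T x F U) (hF : ∀ t ∈ Icc 0 T, F t = F' t)
    (hU : ∀ t ∈ Icc 0 T, U t = U' t) : IsMild R T x F' U' := by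
  intro t ht
  have hsub : ∀ s ∈ uIcc 0 t, s ∈ Icc 0 T := fun s hs => by
    rw [uIcc_of_le ht.1] at hs
    exact ⟨hs.1, hs.2.trans ht.2⟩
  rw [← intervalIntegral.integral_congr fun s hs => hU s (hsub s hs),
    ← intervalIntegral.integral_congr fun s hs => hF s (hsub s hs), ← hU t ht]
  exact h t ht

theorem integral_eq_integral_shift {E : Type*} [NormedAddCommGroup E] [NormedSpace ℝ E]
    {f g : ℝ → E} {a t : ℝ} (hat : a ≤ t) (h : ∀ s, a ≤ s → f s = g (s - a)) :
    ∫ s in a..t, f s = ∫ s in (0 : ℝ)..(t - a), g s := by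
  have e := intervalIntegral.integral_comp_sub_right g a (a := a) (b := t)
  rw [sub_self] at e
  rw [← e]
  refine intervalIntegral.integral_congr fun s hs => ?_
  rw [uIcc_of_le hat] at hs
  exact h s hs.1

variable {L T h α β : ℝ} {R : H L →L[ℝ] H L} {S : H L →L[ℝ] X0 L}
  {b : H L →L[ℝ] H L →L[ℝ] ℝ} {c : ℝ}

/-- `V` is, in the coordinates of `scaleZ`, a mild solution on `[0,T]` of the nonlinear system with
initial value `x`. -/
structure IsHSFlow (R : H L →L[ℝ] H L) (T : ℝ) (x : H L) (V : ℝ → H L) : Prop where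
  cont : Continuous V
  int : IntegrableOn (fun t => nonlin (V t).fst) (Ioc 0 T)
  mild : IsMild R T x (fun s => inclX L (nonlin (V s).fst)) V

/-- Solutions of the nonlinear system as flows; membership in `𝓑` is automatic by smoothing. -/
theorem isHSSolution_iff (hR : IsHSResolvent L h α β R S b c) (hL : 0 < L) (hβh : 0 < β * h)
    (hT : 0 ≤ T) (U₀ : H L) (w : C(Icc (0 : ℝ) T, X0 L)) :
    IsHSSolution L T h α β U₀ w ↔ ∃ V, IsHSFlow R T (scaleZ L (√(β * h)) U₀) V ∧
      ∀ t : Icc (0 : ℝ) T, (V t).fst = w t := by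
  constructor
  · rintro ⟨-, hw⟩
    obtain ⟨hf, V, hV, hm, hVw⟩ := (isSourceSolution_iff hR hβh hT _ (fun _ _ => rfl) _).1 hw
    have e : ∀ t ∈ Icc 0 T, nonlin (path w t) = nonlin (V t).fst := fun t ht => by
      rw [path_of_mem w ht, ← hVw]
    refine ⟨V, ⟨hV, (integrableOn_congr_fun (fun s hs => e s (Ioc_subset_Icc_self hs))
      measurableSet_Ioc).1 hf, hm.congr (fun t ht => ?_) fun _ _ => rfl⟩, hVw⟩
    rw [e t ht]
  · rintro ⟨V, hV, hVw⟩
    have e : ∀ t ∈ Icc 0 T, nonlin (path w t) = nonlin (V t).fst := fun t ht => by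
      rw [path_of_mem w ht, ← hVw]
    have hs := (isSourceSolution_iff hR hβh hT U₀ e w).2 ⟨hV.int, V, hV.cont, hV.mild, hVw⟩
    exact ⟨(hs.bound hR hL hβh hT).1, hs⟩

/-- The energy does not increase. -/
theorem IsHSFlow.norm_le (hR : IsHSResolvent L h α β R S b c) (hL : 0 < L) (hT : 0 ≤ T)
    {x : H L} {V : ℝ → H L} (hV : IsHSFlow R T x V) : ‖V T‖ ≤ ‖x‖ := by
  have h1 := hV.mild.energy hR.diss hV.cont (intervalIntegrable_inclX hT hV.int) ⟨hT, le_rfl⟩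
  have h2 : ∫ s in (0 : ℝ)..T, ⟪inclX L (nonlin (V s).fst), V s⟫ = 0 := by
    rw [← setIntegral_Ioo_eq hT]
    refine integral_eq_zero_of_ae ?_
    filter_upwards [(hR.smoothing hL hT hV.int hV.cont hV.mild).1] with s hs
    have e : ⟪inclX L (nonlin (V s).fst), V s⟫
        = ⟪nonlin (V s).fst, (V s).fst⟫ + ⟪(0 : L2 0 1), (V s).snd⟫ := rfl
    rw [e, inner_nonlin_self hL hs.1.1.1 hs.1.1.2 hs.2.1 hs.2.2, inner_zero_left, add_zero]
    rfl
  rw [h2, mul_zero, add_zero] at h1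
  exact le_of_sq_le_sq h1 (norm_nonneg _)

theorem IsHSFlow.mono {x : H L} {V : ℝ → H L} (hV : IsHSFlow R T x V) {T' : ℝ} (hT' : T' ≤ T) :
    IsHSFlow R T' x V :=
  ⟨hV.cont, hV.int.mono_set (Ioc_subset_Ioc_right hT'), fun t ht =>
    hV.mild t ⟨ht.1, ht.2.trans hT'⟩⟩

theorem IsHSFlow.congr {x : H L} {V V' : ℝ → H L} (hV : IsHSFlow R T x V) (hV' : Continuous V')
    (hVV : ∀ t ∈ Icc 0 T, V t = V' t) : IsHSFlow R T x V' := by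
  refine ⟨hV', (integrableOn_congr_fun (fun s hs => ?_) measurableSet_Ioc).1 hV.int,
    hV.mild.congr (fun t ht => ?_) hVV⟩
  · simp only [hVV s (Ioc_subset_Icc_self hs)]
  · rw [hVV t ht]

theorem IsHSFlow.apply_zero (hR : IsHSResolvent L h α β R S b c) (hT : 0 ≤ T)
    {x : H L} {V : ℝ → H L} (hV : IsHSFlow R T x V) : V 0 = x := by
  have h1 := hV.mild 0 ⟨le_rfl, hT⟩
  simp only [intervalIntegral.integral_same, zero_sub, add_zero] at h1
  have h2 := hR.diss.inj (h1.symm.trans (map_zero R).symm)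
  rw [neg_add_eq_zero] at h2
  exact h2

/-- Solutions can be concatenated. -/
theorem IsHSFlow.concat (hR : IsHSResolvent L h α β R S b c) {a : ℝ} (ha : 0 ≤ a) (hT : 0 ≤ T)
    {x : H L} {V V' : ℝ → H L} (hV : IsHSFlow R a x V) (hV' : IsHSFlow R T (V a) V') :
    ∃ W, IsHSFlow R (a + T) x W ∧ (∀ t ≤ a, W t = V t) ∧ W (a + T) = V' T := by
  have h0 := hV'.apply_zero hR hT
  set W : ℝ → H L := fun t => if t ≤ a then V t else V' (t - a) with hW
  have hWV : ∀ t ≤ a, W t = V t := fun t ht => if_pos ht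
  have hWV' : ∀ t, a ≤ t → W t = V' (t - a) := by
    intro t ht
    rcases ht.eq_or_lt with rfl | ht
    · rw [hWV _ le_rfl, sub_self, h0]
    · exact if_neg ht.not_ge
  have hWc : Continuous W := by
    refine Continuous.if_le hV.cont (hV'.cont.comp (continuous_id.sub continuous_const))
      continuous_id continuous_const fun t ht => ?_
    rw [ht]
    rw [sub_self, h0]
  have hi1 : IntegrableOn (fun t => nonlin (W t).fst) (Ioc 0 a) := by
    refine (integrableOn_congr_fun (fun s hs => ?_) measurableSet_Ioc).1 hV.int
    simp only [hWV s hs.2]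
  have hi2 : IntervalIntegrable (fun t => nonlin (W t).fst) volume a (a + T) := by
    have h1 := ((intervalIntegrable_iff_integrableOn_Ioc_of_le hT).2 hV'.int).comp_sub_right a
    rw [zero_add, add_comm T a] at h1
    refine h1.congr fun s hs => ?_
    rw [uIoc_of_le (by linarith)] at hs
    simp only [hWV' s hs.1.le]
  have hi : IntegrableOn (fun t => nonlin (W t).fst) (Ioc 0 (a + T)) := by
    rw [← Ioc_union_Ioc_eq_Ioc ha (by linarith : a ≤ a + T)]
    exact hi1.union ((intervalIntegrable_iff_integrableOn_Ioc_of_le (by linarith)).1 hi2)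
  have hFi := intervalIntegrable_inclX (by linarith : 0 ≤ a + T) hi
  have hVa := (hV.congr hWc fun t ht => (hWV t ht.2).symm).mild
  refine ⟨W, ⟨hWc, hi, fun t ht => ?_⟩, hWV, ?_⟩
  swap
  · rw [hWV' _ (by linarith), add_sub_cancel_left]
  rcases le_total t a with hta | hta
  · exact hVa t ⟨ht.1, hta⟩
  have e1 := intervalIntegral.integral_add_adjacent_intervals
    (hWc.intervalIntegrable (μ := volume) 0 a) (hWc.intervalIntegrable a t)
  have haT : a ∈ Icc 0 (a + T) := ⟨ha, by linarith⟩
  have e2 := intervalIntegral.integral_add_adjacent_intervals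
    (intervalIntegrable_sub hFi (by linarith) ⟨le_rfl, by linarith⟩ haT)
    (intervalIntegrable_sub hFi (by linarith) haT ht)
  have e3 : ∫ s in a..t, W s = ∫ s in (0 : ℝ)..(t - a), V' s :=
    integral_eq_integral_shift hta hWV'
  have e4 : ∫ s in a..t, inclX L (nonlin (W s).fst)
      = ∫ s in (0 : ℝ)..(t - a), inclX L (nonlin (V' s).fst) :=
    integral_eq_integral_shift (g := fun s => inclX L (nonlin (V' s).fst)) hta
      fun s hs => by rw [hWV' s hs]
  have m1 := hVa a ⟨ha, le_rfl⟩
  have m2 := hV'.mild (t - a) ⟨by linarith, by linarith [ht.2]⟩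
  rw [← hWV a le_rfl, ← e3, ← e4, ← hWV' t hta] at m2
  rw [← e1, ← e2]
  conv_lhs => rw [m1, m2]
  rw [← map_add]
  congr 1
  abel

/-- If every small initial value admits a solution on `[0,T]`, then every small initial value
admits a global one extending a given solution on `[0,T]`. -/
theorem IsHSFlow.exists_global (hR : IsHSResolvent L h α β R S b c) (hL : 0 < L) (hT : 0 < T)
    {r : ℝ} (hloc : ∀ x : H L, ‖x‖ ≤ r → ∃ V, IsHSFlow R T x V) {x : H L} (hx : ‖x‖ ≤ r)
    {V : ℝ → H L} (hV : IsHSFlow R T x V) :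
    ∃ W : ℝ → H L, (∀ t ≤ T, W t = V t) ∧ ∀ T' : ℝ, IsHSFlow R T' x W := by
  -- `Φ x` solves the system on `[0,T]` with small initial value `x`; `W n` solves it on
  -- `[0,(n+1)T]`, and these solutions extend one another
  choose! Φ hΦ using hloc
  have step : ∀ (n : ℕ) (W : ℝ → H L), IsHSFlow R ((n + 1) * T) x W ∧ ‖W ((n + 1) * T)‖ ≤ r →
      ∃ W' : ℝ → H L, (IsHSFlow R (((n + 1 : ℕ) + 1) * T) x W' ∧
        ‖W' (((n + 1 : ℕ) + 1) * T)‖ ≤ r) ∧ ∀ t ≤ ((n : ℝ) + 1) * T, W' t = W t := by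
    rintro n W ⟨h1, h2⟩
    obtain ⟨W', a1, a2, a3⟩ := h1.concat hR (by positivity) hT.le (hΦ _ h2)
    have e : ((n : ℝ) + 1) * T + T = ((n + 1 : ℕ) + 1) * T := by push_cast; ring
    rw [e] at a1 a3
    refine ⟨W', ⟨a1, ?_⟩, a2⟩
    rw [a3]
    exact ((hΦ _ h2).norm_le hR hL hT.le).trans h2
  choose! Ψ hΨ1 hΨ2 using step
  let W : ℕ → ℝ → H L := fun n => Nat.rec V (fun n f => Ψ n f) n
  have hW : ∀ n : ℕ, IsHSFlow R ((n + 1) * T) x (W n) ∧ ‖W n ((n + 1) * T)‖ ≤ r := by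
    intro n
    induction n with
    | zero =>
      have e : (((0 : ℕ) : ℝ) + 1) * T = T := by simp
      rw [e]
      exact ⟨hV, (hV.norm_le hR hL hT.le).trans hx⟩
    | succ n ih => exact hΨ1 n _ ih
  have hsucc : ∀ n : ℕ, ∀ t ≤ ((n : ℝ) + 1) * T, W (n + 1) t = W n t := fun n => hΨ2 n _ (hW n)
  have hadd : ∀ n k : ℕ, ∀ t ≤ ((n : ℝ) + 1) * T, W (n + k) t = W n t := by
    intro n k t ht
    induction k with
    | zero => rfl
    | succ k ih =>
      rw [← add_assoc, hsucc (n + k) t ?_, ih]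
      refine ht.trans (mul_le_mul_of_nonneg_right ?_ hT.le)
      push_cast
      linarith [(Nat.cast_nonneg k : (0 : ℝ) ≤ k)]
  -- any index with `t ≤ (n+1)T` gives the same value at `t`
  set G : ℝ → H L := fun t => W ⌈t / T⌉₊ t with hG
  have hGW : ∀ n : ℕ, ∀ t ≤ ((n : ℝ) + 1) * T, G t = W n t := by
    intro n t ht
    have h1 : t ≤ ((⌈t / T⌉₊ : ℝ) + 1) * T := by
      have := Nat.le_ceil (t / T)
      rw [div_le_iff₀ hT] at this
      linarith
    rw [hG]
    rcases le_total ⌈t / T⌉₊ n with hn | hn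
    · obtain ⟨k, rfl⟩ := Nat.exists_eq_add_of_le hn
      exact (hadd _ k t h1).symm
    · obtain ⟨k, hk⟩ := Nat.exists_eq_add_of_le hn
      simp only
      rw [hk]
      exact hadd n k t ht
  have hex : ∀ t : ℝ, ∃ n : ℕ, t < ((n : ℝ) + 1) * T := by
    intro t
    obtain ⟨n, hn⟩ := exists_nat_gt (t / T)
    rw [div_lt_iff₀ hT] at hn
    exact ⟨n, by linarith⟩
  have hGc : Continuous G := by
    refine continuous_iff_continuousAt.2 fun t => ?_
    obtain ⟨n, hn⟩ := hex t
    refine (hW n).1.cont.continuousAt.congr ?_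
    filter_upwards [Iio_mem_nhds hn] with s hs using (hGW n s (le_of_lt hs)).symm
  refine ⟨G, fun t ht => hGW 0 t (by simpa using ht), fun T' => ?_⟩
  obtain ⟨n, hn⟩ := hex T'
  exact ((hW n).1.congr hGc fun t ht => (hGW n t ht.2).symm).mono hn.le

end Flow

/-! ### Completeness of `𝓑` and the contraction principle -/

section FixedPoint
variable {L T : ℝ}

/-- The spatial derivative of a path in `𝓑`, as an element of `L²(0,T;X₀)`. -/
def derivLp {w : C(Icc (0 : ℝ) T, X0 L)} (hw : w ∈ spaceB L T) :
    Lp (X0 L) 2 (volume.restrict (Ioo 0 T)) :=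
  (mem_spaceB_iff.1 hw).2.toLp _

theorem bNorm_eq_norm_derivLp {w : C(Icc (0 : ℝ) T, X0 L)} (hw : w ∈ spaceB L T) :
    bNorm w = ‖w‖ + ‖derivLp hw‖ := by
  rw [bNorm_eq, ← norm_toLp_sq (mem_spaceB_iff.1 hw).2, Real.sqrt_sq (norm_nonneg _)]
  rfl

theorem derivLp_sub (hL : 0 < L) {w w' : C(Icc (0 : ℝ) T, X0 L)} (hw : w ∈ spaceB L T)
    (hw' : w' ∈ spaceB L T) : derivLp (sub_mem_spaceB hL hw hw') = derivLp hw - derivLp hw' := by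
  unfold derivLp
  rw [← MemLp.toLp_sub, MemLp.toLp_eq_toLp_iff]
  filter_upwards [hw.1, hw'.1] with t h1 h2
  rw [path_sub]
  exact xderiv_sub hL h1 h2

theorem bNorm_sub_eq (hL : 0 < L) {w w' : C(Icc (0 : ℝ) T, X0 L)} (hw : w ∈ spaceB L T)
    (hw' : w' ∈ spaceB L T) : bNorm (w - w') = ‖w - w'‖ + ‖derivLp hw - derivLp hw'‖ := by
  rw [bNorm_eq_norm_derivLp (sub_mem_spaceB hL hw hw'), derivLp_sub hL hw hw']

theorem bNorm_sub_comm (hL : 0 < L) {w w' : C(Icc (0 : ℝ) T, X0 L)} (hw : w ∈ spaceB L T)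
    (hw' : w' ∈ spaceB L T) : bNorm (w - w') = bNorm (w' - w) := by
  rw [bNorm_sub_eq hL hw hw', bNorm_sub_eq hL hw' hw, norm_sub_rev, norm_sub_rev (derivLp hw)]

theorem bNorm_sub_le (hL : 0 < L) {w₁ w₂ w₃ : C(Icc (0 : ℝ) T, X0 L)} (h₁ : w₁ ∈ spaceB L T)
    (h₂ : w₂ ∈ spaceB L T) (h₃ : w₃ ∈ spaceB L T) :
    bNorm (w₁ - w₃) ≤ bNorm (w₁ - w₂) + bNorm (w₂ - w₃) := by
  rw [bNorm_sub_eq hL h₁ h₃, bNorm_sub_eq hL h₁ h₂, bNorm_sub_eq hL h₂ h₃]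
  linarith [norm_sub_le_norm_sub_add_norm_sub w₁ w₂ w₃,
    norm_sub_le_norm_sub_add_norm_sub (derivLp h₁) (derivLp h₂) (derivLp h₃)]

theorem eq_of_bNorm_sub_le_zero {w w' : C(Icc (0 : ℝ) T, X0 L)} (h : bNorm (w - w') ≤ 0) :
    w = w' :=
  sub_eq_zero.1 (norm_le_zero_iff.1 ((norm_le_bNorm _).trans h))

/-- `𝓑` is complete. -/
theorem exists_tendsto_bNorm (hL : 0 < L) {w : ℕ → C(Icc (0 : ℝ) T, X0 L)}
    (hw : ∀ n, w n ∈ spaceB L T) {K κ : ℝ} (hκ : κ < 1)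
    (hle : ∀ n, bNorm (w n - w (n + 1)) ≤ K * κ ^ n) :
    ∃ w' ∈ spaceB L T, Tendsto (fun n => bNorm (w n - w')) atTop (𝓝 0) := by
  have h1 : ∀ n, dist (w n) (w (n + 1)) ≤ K * κ ^ n := fun n => by
    rw [dist_eq_norm]
    exact (norm_le_bNorm _).trans (hle n)
  have h2 : ∀ n, dist (derivLp (hw n)) (derivLp (hw (n + 1))) ≤ K * κ ^ n := fun n => by
    rw [dist_eq_norm]
    refine le_trans ?_ (hle n)
    rw [bNorm_sub_eq hL (hw n) (hw (n + 1))]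
    exact le_add_of_nonneg_left (norm_nonneg _)
  obtain ⟨w', hw'⟩ := cauchySeq_tendsto_of_complete (cauchySeq_of_le_geometric κ K hκ h1)
  obtain ⟨g, hg⟩ := cauchySeq_tendsto_of_complete (cauchySeq_of_le_geometric κ K hκ h2)
  obtain ⟨φ, hφ, hlim⟩ := (tendstoInMeasure_of_tendsto_Lp hg).exists_seq_tendsto_ae
  have hcoe : ∀ᵐ t ∂(volume.restrict (Ioo 0 T)), ∀ n,
      derivLp (hw n) t = xderiv (path (w n) t) :=
    ae_all_iff.2 fun n => MemLp.coeFn_toLp _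
  have hH1 : ∀ᵐ t ∂(volume.restrict (Ioo 0 T)), ∀ n,
      MemH1 (path (w n) t).fst ∧ MemH1 (path (w n) t).snd := ae_all_iff.2 fun n => (hw n).1
  have hgr : ∀ᵐ t ∂(volume.restrict (Ioo 0 T)), (path w' t, g t) ∈ graphH1 L := by
    filter_upwards [hlim, hcoe, hH1] with t a1 a2 a3
    have hp : Tendsto (fun n => path (w (φ n)) t) atTop (𝓝 (path w' t)) := by
      rw [tendsto_iff_norm_sub_tendsto_zero]
      refine squeeze_zero (fun _ => norm_nonneg _) (fun n => ?_)
        ((tendsto_iff_norm_sub_tendsto_zero.1 hw').comp hφ.tendsto_atTop)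
      rw [← path_sub]
      exact norm_path_le _ t
    refine (isClosed_graphH1 hL).mem_of_tendsto (hp.prodMk_nhds a1)
      (Eventually.of_forall fun n => ?_)
    exact ⟨a3 _, (a2 _).symm⟩
  have hge : (fun t => xderiv (path w' t)) =ᵐ[volume.restrict (Ioo 0 T)] g := by
    filter_upwards [hgr] with t ht using ht.2
  have hmem : w' ∈ spaceB L T := by
    rw [mem_spaceB_iff]
    exact ⟨by filter_upwards [hgr] with t ht using ht.1, (memLp_congr_ae hge).2 (Lp.memLp g)⟩
  have hD : derivLp hmem = g := by
    refine Lp.ext ?_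
    exact (MemLp.coeFn_toLp _).trans hge
  refine ⟨w', hmem, ?_⟩
  have h3 := (tendsto_iff_norm_sub_tendsto_zero.1 hw').add (tendsto_iff_norm_sub_tendsto_zero.1 hg)
  rw [add_zero] at h3
  refine h3.congr fun n => ?_
  rw [bNorm_sub_eq hL (hw n) hmem, hD]

/-- The contraction principle in a closed ball of `𝓑`. -/
theorem exists_fixedPoint (hL : 0 < L) {Γ : spaceB L T → spaceB L T} {R κ : ℝ} (hR : 0 ≤ R)
    (hκ : κ < 1) (hball : ∀ w : spaceB L T, bNorm w.1 ≤ R → bNorm (Γ w).1 ≤ R)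
    (hcontr : ∀ w₁ w₂ : spaceB L T, bNorm w₁.1 ≤ R → bNorm w₂.1 ≤ R →
      bNorm ((Γ w₁).1 - (Γ w₂).1) ≤ κ * bNorm (w₁.1 - w₂.1)) (hκ0 : 0 ≤ κ) :
    ∃ w : spaceB L T, bNorm w.1 ≤ R ∧ Γ w = w := by
  let w : ℕ → spaceB L T := fun n => Γ^[n] ⟨0, zero_mem_spaceB hL⟩
  have hsucc : ∀ n, w (n + 1) = Γ (w n) := fun n => Function.iterate_succ_apply' Γ n _
  have hwR : ∀ n, bNorm (w n).1 ≤ R := by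
    intro n
    induction n with
    | zero => exact (bNorm_zero hL).trans_le hR
    | succ n ih => rw [hsucc]; exact hball _ ih
  have hle : ∀ n, bNorm ((w n).1 - (w (n + 1)).1) ≤ bNorm ((w 0).1 - (w 1).1) * κ ^ n := by
    intro n
    induction n with
    | zero => simp
    | succ n ih =>
      rw [hsucc n, hsucc (n + 1)]
      refine (hcontr _ _ (hwR n) (hwR (n + 1))).trans ?_
      rw [pow_succ, ← mul_assoc, mul_comm κ]
      exact mul_le_mul_of_nonneg_right ih hκ0
  obtain ⟨w', hw', hlim⟩ := exists_tendsto_bNorm hL (fun n => (w n).2) hκ hle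
  have hb : bNorm w' ≤ R := by
    refine le_of_tendsto_of_tendsto tendsto_const_nhds
      (by simpa using hlim.const_add R : Tendsto _ atTop (𝓝 R)) (Eventually.of_forall fun n => ?_)
    have h1 := bNorm_sub_le hL hw' (w n).2 (zero_mem_spaceB hL)
    rw [sub_zero, sub_zero, bNorm_sub_comm hL hw' (w n).2] at h1
    dsimp only
    linarith [hwR n]
  refine ⟨⟨w', hw'⟩, hb, Subtype.ext (eq_of_bNorm_sub_le_zero ?_)⟩
  refine ge_of_tendsto
    (by simpa using (hlim.const_mul κ).add (hlim.comp (tendsto_add_atTop_nat 1)) :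
    Tendsto _ atTop (𝓝 (0 : ℝ))) (Eventually.of_forall fun n => ?_)
  refine (bNorm_sub_le hL (Γ ⟨w', hw'⟩).2 (w (n + 1)).2 hw').trans (add_le_add ?_ le_rfl)
  rw [hsucc, bNorm_sub_comm hL (Γ ⟨w', hw'⟩).2 (Γ (w n)).2]
  exact hcontr _ _ (hwR n) hb

end FixedPoint

end HirotaSatsuma

/-! ### The well-posedness theorem -/

open HirotaSatsuma in
theorem theorem2p4 (L T h α β : ℝ) (hL : 0 < L) (hT : 0 < T) (hh : 0 < h) (hβ : 0 < β)
    (hcond : 0 < 2 * α ^ 2 + 3 / 2 * β ∧ 2 * α ^ 2 + 3 / 2 * β < 1 / 2) :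
    ∃ C r κ : ℝ, 0 < C ∧ 0 < r ∧ 0 ≤ κ ∧ κ < 1 ∧
      ∀ U₀ : HirotaSatsuma.H L, HirotaSatsuma.hNorm h β U₀ ≤ r →
        -- the map `Γ : 𝓑 → 𝓑` is well defined by the source problem
        ∃ Γ : HirotaSatsuma.spaceB L T → HirotaSatsuma.spaceB L T,
          (∀ (w : HirotaSatsuma.spaceB L T) (w' : C(Set.Icc (0 : ℝ) T, HirotaSatsuma.X0 L)),
            HirotaSatsuma.IsSourceSolution L T h α β U₀
              (fun t => HirotaSatsuma.nonlin (HirotaSatsuma.path w.1 t)) w' ↔ w' = (Γ w).1) ∧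
          ∀ R : ℝ, 2 * C * HirotaSatsuma.hNorm h β U₀ ≤ R → R ≤ 2 * C * r →
            -- `Γ` is a contraction of the closed ball of radius `R`
            (∀ w : HirotaSatsuma.spaceB L T, HirotaSatsuma.bNorm w.1 ≤ R →
              HirotaSatsuma.bNorm (Γ w).1 ≤ R) ∧
            (∀ w₁ w₂ : HirotaSatsuma.spaceB L T,
              HirotaSatsuma.bNorm w₁.1 ≤ R → HirotaSatsuma.bNorm w₂.1 ≤ R →
              HirotaSatsuma.bNorm ((Γ w₁).1 - (Γ w₂).1)
                ≤ κ * HirotaSatsuma.bNorm (w₁.1 - w₂.1)) ∧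
            -- there is exactly one solution in this ball, and it is global
            ∃ w ∈ HirotaSatsuma.ballB L T R,
              HirotaSatsuma.IsHSSolution L T h α β U₀ w ∧
              (∀ w' ∈ HirotaSatsuma.ballB L T R,
                HirotaSatsuma.IsHSSolution L T h α β U₀ w' → w' = w) ∧
              ∃ W : C(ℝ, HirotaSatsuma.X0 L),
                (∀ t : Set.Icc (0 : ℝ) T, W t = w t) ∧
                ∀ T' : ℝ, 0 < T' →
                  HirotaSatsuma.IsHSSolution L T' h α β U₀ (W.restrict (Set.Icc 0 T')) := by
  obtain ⟨R, S, b, c, hR⟩ := exists_isHSResolvent hL hh hβ hcond.2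
  have hβh : 0 < β * h := mul_pos hβ hh
  -- `C` is the constant of the linear estimate, and `K` the one of the nonlinear estimate
  set C := 2 * (1 + √(‖b‖ / c)) with hC
  have hC0 : 0 < C := by positivity
  set K := ‖nl hL.le‖ * (T + 1) + 1 with hK
  have hn0 : 0 ≤ ‖nl hL.le‖ := (nl hL.le).opNorm_nonneg
  have hK0 : 0 < K := by positivity
  have hN : ∀ w₁ w₂ : spaceB L T,
      ∫ t in (0 : ℝ)..T, ‖nonlin (path w₁.1 t) - nonlin (path w₂.1 t)‖
        ≤ K * ((bNorm w₁.1 + bNorm w₂.1) * bNorm (w₁.1 - w₂.1)) := fun w₁ w₂ =>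
    (integral_norm_nonlin_sub_le hL hT.le w₁.2 w₂.2).trans (mul_le_mul_of_nonneg_right
      (le_add_of_nonneg_right zero_le_one) (mul_nonneg (add_nonneg (bNorm_nonneg _)
        (bNorm_nonneg _)) (bNorm_nonneg _)))
  have hN0 : ∀ w : spaceB L T, ∫ t in (0 : ℝ)..T, ‖nonlin (path w.1 t)‖ ≤ K * bNorm w.1 ^ 2 := by
    intro w
    have h1 := hN w ⟨0, zero_mem_spaceB hL⟩
    simp only [path_zero, nonlin_zero hL, sub_zero, bNorm_zero hL, add_zero, ← sq] at h1
    exact h1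
  -- chosen so that `Γ` has Lipschitz constant `2 C K ρ ≤ 4 C² K r = 1 / 2` on the ball of radius
  -- `ρ ≤ 2 C r`
  set r := 1 / (8 * C ^ 2 * K) with hr
  have hr0 : 0 < r := by positivity
  have hCr : 4 * C ^ 2 * K * r = 1 / 2 := by
    rw [hr]; field_simp; norm_num
  -- no bound on `U₀` is needed here: it is implied as soon as some `ρ` is admissible
  have main : ∀ U₀ : H L, ∃ Γ : spaceB L T → spaceB L T,
      (∀ (w : spaceB L T) (w' : C(Set.Icc (0 : ℝ) T, X0 L)), IsSourceSolution L T h α β U₀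
        (fun t => nonlin (path w.1 t)) w' ↔ w' = (Γ w).1) ∧
      ∀ ρ : ℝ, 2 * C * hNorm h β U₀ ≤ ρ → ρ ≤ 2 * C * r →
        (∀ w : spaceB L T, bNorm w.1 ≤ ρ → bNorm (Γ w).1 ≤ ρ) ∧
        (∀ w₁ w₂ : spaceB L T, bNorm w₁.1 ≤ ρ → bNorm w₂.1 ≤ ρ →
          bNorm ((Γ w₁).1 - (Γ w₂).1) ≤ 1 / 2 * bNorm (w₁.1 - w₂.1)) ∧
        ∃ w ∈ ballB L T ρ, IsHSSolution L T h α β U₀ w ∧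
          ∀ w' ∈ ballB L T ρ, IsHSSolution L T h α β U₀ w' → w' = w := by
    intro U₀
    have hex : ∀ w : spaceB L T, ∃ w' : spaceB L T,
        IsSourceSolution L T h α β U₀ (fun t => nonlin (path w.1 t)) w'.1 := fun w => by
      obtain ⟨w', hw'⟩ := exists_isSourceSolution hR hβh hT.le U₀ (integrableOn_nonlin hL hT.le w.2)
      exact ⟨⟨w', (hw'.bound hR hL hβh hT.le).1⟩, hw'⟩
    choose Γ hΓ using hex
    have hn := Real.sqrt_nonneg (‖U₀.fst‖ ^ 2 + β * h * ‖U₀.snd‖ ^ 2)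
    change 0 ≤ hNorm h β U₀ at hn
    refine ⟨Γ, fun w w' => ⟨fun hw => hw.unique hR hL hβh hT.le (hΓ w), fun e => e ▸ hΓ w⟩,
      fun ρ h1 h2 => ?_⟩
    have hρ0 : 0 ≤ ρ := le_trans (by positivity) h1
    have hsmall : 2 * C * K * ρ ≤ 1 / 2 := by
      have := mul_le_mul_of_nonneg_left h2 (by positivity : 0 ≤ 2 * C * K)
      linarith
    have hball : ∀ w : spaceB L T, bNorm w.1 ≤ ρ → bNorm (Γ w).1 ≤ ρ := by
      intro w hw
      have h3 := ((hΓ w).bound hR hL hβh hT.le).2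
      rw [← hC] at h3
      have h4 : K * bNorm w.1 ^ 2 ≤ K * (ρ * ρ) := by
        rw [← sq]
        exact mul_le_mul_of_nonneg_left (pow_le_pow_left₀ (bNorm_nonneg _) hw 2) hK0.le
      have h5 := mul_le_mul_of_nonneg_left ((hN0 w).trans h4) hC0.le
      have h6 := mul_le_mul_of_nonneg_right hsmall hρ0
      linarith
    have hcontr : ∀ w₁ w₂ : spaceB L T, bNorm w₁.1 ≤ ρ → bNorm w₂.1 ≤ ρ →
        bNorm ((Γ w₁).1 - (Γ w₂).1) ≤ 1 / 2 * bNorm (w₁.1 - w₂.1) := by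
      intro w₁ w₂ hw₁ hw₂
      have h3 := (((hΓ w₁).sub hR hβh hT.le (hΓ w₂)).bound hR hL hβh hT.le).2
      have h0 : hNorm h β (U₀ - U₀) = 0 := by simp [hNorm]
      rw [← hC, h0, zero_add] at h3
      have hd := bNorm_nonneg (w₁.1 - w₂.1)
      refine h3.trans ((mul_le_mul_of_nonneg_left (hN w₁ w₂) hC0.le).trans ?_)
      calc C * (K * ((bNorm w₁.1 + bNorm w₂.1) * bNorm (w₁.1 - w₂.1)))
          ≤ C * (K * ((ρ + ρ) * bNorm (w₁.1 - w₂.1))) := by gcongr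
        _ = 2 * C * K * ρ * bNorm (w₁.1 - w₂.1) := by ring
        _ ≤ _ := mul_le_mul_of_nonneg_right hsmall hd
    refine ⟨hball, hcontr, ?_⟩
    obtain ⟨w, hw, hfix⟩ := exists_fixedPoint hL hρ0 (by norm_num) hball hcontr (by norm_num)
    refine ⟨w.1, ⟨w.2, hw⟩, ⟨w.2, ?_⟩, ?_⟩
    · have := hΓ w
      rwa [hfix] at this
    · rintro w' ⟨hw', hwρ'⟩ ⟨-, hs⟩
      have hfix' : (Γ ⟨w', hw'⟩).1 = w' := (hΓ ⟨w', hw'⟩).unique hR hL hβh hT.le hs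
      have h3 := hcontr ⟨w', hw'⟩ w hwρ' hw
      rw [hfix', hfix] at h3
      exact eq_of_bNorm_sub_le_zero (by linarith)
  refine ⟨C, r, 1 / 2, hC0, hr0, by norm_num, by norm_num, fun U₀ hU₀ => ?_⟩
  obtain ⟨Γ, hΓ, hΓR⟩ := main U₀
  refine ⟨Γ, hΓ, fun ρ h1 h2 => ?_⟩
  obtain ⟨hball, hcontr, w, hw, hsol, huniq⟩ := hΓR ρ h1 h2
  refine ⟨hball, hcontr, w, hw, hsol, huniq, ?_⟩
  have hs : √(β * h) * (√(β * h))⁻¹ = 1 := mul_inv_cancel₀ (Real.sqrt_pos.2 hβh).ne'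
  have hloc : ∀ x : H L, ‖x‖ ≤ r → ∃ V, IsHSFlow R T x V := by
    intro x hx
    have e := scaleZ_scaleZ hs x
    have hx' : hNorm h β (scaleZ L (√(β * h))⁻¹ x) ≤ r := by
      rwa [← norm_scaleZ hβh.le, e]
    obtain ⟨Γx, -, hΓx⟩ := main (scaleZ L (√(β * h))⁻¹ x)
    obtain ⟨-, -, w', -, hw', -⟩ := hΓx (2 * C * r)
      (mul_le_mul_of_nonneg_left hx' (by positivity)) le_rfl
    obtain ⟨V, hV, -⟩ := (isHSSolution_iff hR hL hβh hT.le _ _).1 hw'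
    rw [e] at hV
    exact ⟨V, hV⟩
  obtain ⟨V, hV, hVw⟩ := (isHSSolution_iff hR hL hβh hT.le _ _).1 hsol
  obtain ⟨W, hWV, hW⟩ := hV.exists_global hR hL hT hloc (by rwa [norm_scaleZ hβh.le])
  refine ⟨⟨fun t => (W t).fst, (WithLp.fstL 2 ℝ (X0 L) (L2 0 1)).continuous.comp (hW 0).cont⟩,
    fun t => ?_, fun T' hT' => ?_⟩
  · rw [← hVw, ← hWV t t.2.2]; rfl
  · exact (isHSSolution_iff hR hL hβh hT'.le _ _).2 ⟨W, hW T', fun _ => rfl⟩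

end
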